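/- Let $J\ge 1$. Packages of source $S_i$, $i=1,\dots,J$, arrive at an aggregator at the points $t_{i,1}<t_{i,2}<\cdots$ of a Poisson process on $(0,\infty)$ of rate $\lambda_i>0$. Each package of $S_i$ is first processed, for the time $(C_i-\tilde C_i)/\tau_i$, where $C_i>\tilde C_i$ are the package sizes before and after processing and $\tau_i>0$ is the processing rate. There is one processor with an infinite buffer and non-preemptive priorities: whenever the processor is free and packages are present, it takes a package of the source with the smallest index among the sources present, in order of arrival within a source. Processed packages join an infinite-buffer first-come-first-served queue of a single transmitter. The transmission times $Z^T_{i,n}\ge 0$ of the packages of $S_i$ have a common law, with an arbitrary mean $\mathbb E[Z_i^T]\in[0,\infty]$; all transmission times and all interarrival times are independent. The system is empty at time $0$. Assume that the processing queue is stable, $\sum_{i}\lambda_i (C_i-\tilde C_i)/\tau_i<1$, and that the transmission queue is not exactly critically loaded, $\sum_i\lambda_i\mathbb E[Z_i^T]\neq 1$ (in particular this holds if it is stable, i.e. if the sum is less than $1$). Fix a source $S_j$. Let $\hat t_{j,n}$ be the time at which its $n$-th package arrives at the destination, and let $W^P_{j,n}$ and $W^T_{j,n}$ be the waiting times of this package in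 the processing queue and in the transmission queue. With initial age $\Delta_j(0)\ge 0$, the peak ages of information are $\Delta_{j,1}=\Delta_j(0)+\hat t_{j,1}$ and $\Delta_{j,n}=(t_{j,n}-t_{j,n-1})+(\hat t_{j,n}-t_{j,n})$ for $n>1$. Let $N_j(t)$ be the number of packages of $S_j$ that have arrived at the destination by time $t$. Then the steady-state mean waiting times $\mathbb E[W_j^P]=\lim_{n\to\infty}\mathbb E[W_{j,n}^P]$ and $\mathbb E[W_j^T]=\lim_{n\to\infty}\mathbb E[W_{j,n}^T]$ exist in $[0,\infty]$, and almost surely the average peak age of information satisfies, in $[0,\infty]$, $$\lim_{t\to\infty}\frac1{N_j(t)}\sum_{n=1}^{N_j(t)}\Delta_{j,n}=\frac1{\lambda_j}+\frac{C_j-\tilde C_j}{\tau_j}+\mathbb E[W_j^P]+\mathbb E[Z_j^T]+\mathbb E[W_j^T].$$ -/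

import Mathlib

open MeasureTheory ProbabilityTheory Filter Topology
open scoped ENNReal

/-!
A data aggregator serves `J` sources.  Source `0` has the highest priority.  Packages of each source
are numbered `0, 1, 2, …` in their order of arrival.  Sample-path data:

* `t j n` : arrival time at the aggregator of package `n` of source `j`;
* `D j`   : processing time of every package of source `j`;
* `z j n` : transmission time of package `n` of source `j`.

Both queues are empty at time `0`.
-/

namespace PAoI

noncomputable section

/-- Arrival times with interarrival times `x`: package `n` arrives at `x 0 + ⋯ + x n`. -/
def arrival {J : ℕ} (x : Fin J → ℕ → ℝ) (j : Fin J) (n : ℕ) : ℝ :=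
  ∑ i ∈ Finset.range (n + 1), x j i

/-! ### The processor: non-preemptive priority, first come first served within a source -/

/-- State of the processor between two services: how many packages of each source have been
taken into service so far, and the time at which the processor is released by the last of them. -/
structure ProcState (J : ℕ) where
  served : Fin J → ℕ
  free : ℝ

/-- The next service begins as soon as the processor is free and some package is present. -/
def nextBegin {J : ℕ} (t : Fin J → ℕ → ℝ) (s : ProcState J) : ℝ :=
  max s.free (⨅ j, t j (s.served j))

/-- The source served next: the one of highest priority (least index) among those
with a package present when the next service begins. -/
def nextSource {J : ℕ} [NeZero J] (t : Fin J → ℕ → ℝ) (s : ProcState J) : Fin J :=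
  sInf {j | t j (s.served j) ≤ nextBegin t s}

/-- One service, carried out without interruption. -/
def procStep {J : ℕ} [NeZero J] (t : Fin J → ℕ → ℝ) (D : Fin J → ℝ) (s : ProcState J) :
    ProcState J where
  served := Function.update s.served (nextSource t s) (s.served (nextSource t s) + 1)
  free := nextBegin t s + D (nextSource t s)

/-- The state after `k` services, from an empty system at time `0`. -/
def procState {J : ℕ} [NeZero J] (t : Fin J → ℕ → ℝ) (D : Fin J → ℝ) : ℕ → ProcState J
  | 0 => ⟨fun _ => 0, 0⟩
  | k + 1 => procStep t D (procState t D k)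

/-- Source of the `k`-th package to be processed (counting from `0`). -/
def procSource {J : ℕ} [NeZero J] (t : Fin J → ℕ → ℝ) (D : Fin J → ℝ) (k : ℕ) : Fin J :=
  nextSource t (procState t D k)

/-- Number, within its source, of the `k`-th package to be processed. -/
def procIndex {J : ℕ} [NeZero J] (t : Fin J → ℕ → ℝ) (D : Fin J → ℝ) (k : ℕ) : ℕ :=
  (procState t D k).served (procSource t D k)

/-- Time at which the processing of the `k`-th processed package begins. -/
def procBegin {J : ℕ} [NeZero J] (t : Fin J → ℕ → ℝ) (D : Fin J → ℝ) (k : ℕ) : ℝ :=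
  nextBegin t (procState t D k)

/-- Time at which the `k`-th processed package leaves the processor and joins the transmission
queue. -/
def procEnd {J : ℕ} [NeZero J] (t : Fin J → ℕ → ℝ) (D : Fin J → ℝ) (k : ℕ) : ℝ :=
  procBegin t D k + D (procSource t D k)

/-! ### The transmitter: a single server, first come first served -/

/-- Time at which the transmission of the `k`-th processed package begins, if the transmitter is
released by the previous packages at time `prev`. -/
def transBeginAfter {J : ℕ} [NeZero J] (t : Fin J → ℕ → ℝ) (D : Fin J → ℝ) (prev : ℝ) (k : ℕ) :
    ℝ :=
  max prev (procEnd t D k)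

/-- Time at which the transmitter is released by the first `k` processed packages. -/
def transFree {J : ℕ} [NeZero J] (t : Fin J → ℕ → ℝ) (D : Fin J → ℝ) (z : Fin J → ℕ → ℝ) : ℕ → ℝ
  | 0 => 0
  | k + 1 => transBeginAfter t D (transFree t D z k) k + z (procSource t D k) (procIndex t D k)

/-! ### Quantities attached to package `n` of source `j` -/

/-- Position of package `n` of source `j` in the order of processing. -/
def rank {J : ℕ} [NeZero J] (t : Fin J → ℕ → ℝ) (D : Fin J → ℝ) (j : Fin J) (n : ℕ) : ℕ :=
  sInf {k | procSource t D k = j ∧ procIndex t D k = n}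

/-- Waiting time in the processing queue. -/
def procWait {J : ℕ} [NeZero J] (t : Fin J → ℕ → ℝ) (D : Fin J → ℝ) (j : Fin J) (n : ℕ) : ℝ :=
  procBegin t D (rank t D j n) - t j n

/-- Waiting time in the transmission queue. -/
def transWait {J : ℕ} [NeZero J] (t : Fin J → ℕ → ℝ) (D : Fin J → ℝ) (z : Fin J → ℕ → ℝ)
    (j : Fin J) (n : ℕ) : ℝ :=
  transBeginAfter t D (transFree t D z (rank t D j n)) (rank t D j n) - procEnd t D (rank t D j n)

/-- Time of arrival at the destination. -/
def delivery {J : ℕ} [NeZero J] (t : Fin J → ℕ → ℝ) (D : Fin J → ℝ) (z : Fin J → ℕ → ℝ)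
    (j : Fin J) (n : ℕ) : ℝ :=
  transFree t D z (rank t D j n + 1)

/-! ### Peak age of information -/

/-- The peak ages of one source with initial age `a`, arrival times `t n` at the aggregator and
arrival times `d n` at the destination: the value of the age just before `d n`. -/
def peakAge (a : ℝ) (t d : ℕ → ℝ) : ℕ → ℝ
  | 0 => a + d 0
  | n + 1 => (t (n + 1) - t n) + (d (n + 1) - t (n + 1))

/-- Number of packages that reached the destination up to time `T`. -/
def numDelivered (d : ℕ → ℝ) (T : ℝ) : ℕ :=
  Set.ncard {n | d n ≤ T}

/-- Average of the peak ages attained up to time `T`. -/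
def avgPeakAge (a : ℝ) (t d : ℕ → ℝ) (T : ℝ) : ℝ :=
  (∑ n ∈ Finset.range (numDelivered d T), peakAge a t d n) / (numDelivered d T : ℝ)

end

end PAoI

/-! ### Limit theorems for nonnegative random variables and renewal sequences -/

/-! The system is a regenerative process, and every limit is a renewal-reward limit taken in
`[0,∞]`. All data are coordinates of a path with independent coordinates (law `PAoI.pathLaw`), and
the order of processing depends on the interarrival times only. Time is replaced by the number `k`
of completed services. If no package arrives between those already served and a clock time attached
to `k`, then the residual interarrival times are again exponential, by memorylessness. The rest of
the path therefore has the original law and is independent of the past. With `procClock` this says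
that the processor is empty after `k` services; with `transClock`, that both queues are. This is
`PAoI.IsClock.regeneration`, and `Regeneration.cycleShift` turns it into independent identically
distributed cycles.

Let `N` be the number of packages of source `j` in a cycle. Package `N + m` waits exactly as long as
package `m` of the path after the cycle. The strong law over cycles then gives the almost sure
average of the waits as (mean total wait in a cycle) / (mean of `N`). The mean wait of the `n`-th
package is a convolution of a sequence with the renewal measure of `N`, and this measure tends to
the inverse mean of `N` by the discrete renewal theorem. So the individual means have the same limit
(`CycleShift.limit`). The value `N = 1` has positive probability, which replaces aperiodicity.
Rewards are nonnegative, so no moment condition on the waits or transmission times is needed.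

What remains is that cycles have finite mean length. It is enough that regenerations have positive
density in the mean: decomposing at the last regeneration gives a convolution identity which then
bounds the sum of the return tails (`tsum_ne_top_of_convolution`). For the processor, stability
forces idle time to accumulate linearly, while each idle period has bounded mean and can only follow
a regeneration. For the transmitter with load below 1, compare work and time over processor cycles:
the backlog must be below some level `M` at a positive fraction of the cycle ends, and with positive
probability no arrival then occurs during a further time `M`, so that both queues empty.

With load above 1 there are no such cycles to use, but the work brought by successive processor
cycles outgrows their duration. Transmission waits then tend to infinity almost surely, and so do
their means, by Fatou.

Finally the peak ages telescope: their sum is the initial age, plus the last arrival time, plus the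
sum of the sojourn times. -/

theorem slln_of_lintegral_ne_top {Ω : Type*} [MeasurableSpace Ω] {μ : Measure Ω}
    (Y : ℕ → Ω → ℝ≥0∞) (hm : ∀ i, Measurable (Y i))
    (hind : Pairwise fun i k => IndepFun (Y i) (Y k) μ)
    (hid : ∀ i, IdentDistrib (Y i) (Y 0) μ μ) (hfin : ∫⁻ ω, Y 0 ω ∂μ ≠ ∞) :
    ∀ᵐ ω ∂μ, Tendsto (fun n : ℕ => (∑ i ∈ Finset.range n, Y i ω) / n) atTop
      (𝓝 (∫⁻ ω, Y 0 ω ∂μ)) := by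
  have hfi : ∀ᵐ ω ∂μ, ∀ i, Y i ω ≠ ∞ := by
    rw [ae_all_iff]
    intro i
    have : ∫⁻ ω, Y i ω ∂μ ≠ ∞ := by rwa [(hid i).lintegral_eq]
    filter_upwards [ae_lt_top (hm i) this] with ω h using h.ne
  have h := strong_law_ae_real (μ := μ) (fun i ω => (Y i ω).toReal)
    (integrable_toReal_of_lintegral_ne_top (hm 0).aemeasurable hfin)
    (fun i k hik => (hind hik).comp ENNReal.measurable_toReal ENNReal.measurable_toReal)
    (fun i => (hid i).comp ENNReal.measurable_toReal)
  filter_upwards [h, hfi] with ω h1 h2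
  have h3 := ENNReal.tendsto_ofReal h1
  rw [integral_toReal (hm 0).aemeasurable (ae_lt_top (hm 0) hfin),
    ENNReal.ofReal_toReal hfin] at h3
  refine h3.congr' ?_
  filter_upwards [eventually_gt_atTop 0] with n hn
  rw [ENNReal.ofReal_div_of_pos (by exact_mod_cast hn),
    ENNReal.ofReal_sum_of_nonneg (fun _ _ => ENNReal.toReal_nonneg), ENNReal.ofReal_natCast]
  congr 1
  exact Finset.sum_congr rfl fun i _ => ENNReal.ofReal_toReal (h2 i)

/-- If the mean is infinite, the truncations at every integer level obey the finite law, and their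
means increase to infinity by monotone convergence; they bound the averages from below. -/
theorem slln_ennreal {Ω : Type*} [MeasurableSpace Ω] {μ : Measure Ω} [IsProbabilityMeasure μ]
    (Y : ℕ → Ω → ℝ≥0∞) (hm : ∀ i, Measurable (Y i))
    (hind : Pairwise fun i k => IndepFun (Y i) (Y k) μ)
    (hid : ∀ i, IdentDistrib (Y i) (Y 0) μ μ) :
    ∀ᵐ ω ∂μ, Tendsto (fun n : ℕ => (∑ i ∈ Finset.range n, Y i ω) / n) atTop
      (𝓝 (∫⁻ ω, Y 0 ω ∂μ)) := by
  by_cases hfin : ∫⁻ ω, Y 0 ω ∂μ = ∞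
  swap
  · exact slln_of_lintegral_ne_top Y hm hind hid hfin
  have hmin : ∀ M : ℕ, Measurable fun y : ℝ≥0∞ => min y M := fun M => by fun_prop
  have htr : ∀ᵐ ω ∂μ, ∀ M : ℕ, Tendsto
      (fun n : ℕ => (∑ i ∈ Finset.range n, min (Y i ω) M) / n) atTop
      (𝓝 (∫⁻ ω, min (Y 0 ω) M ∂μ)) := by
    rw [ae_all_iff]
    intro M
    refine slln_of_lintegral_ne_top (fun i ω => min (Y i ω) M) (fun i => (hmin M).comp (hm i))
      (fun i k hik => (hind hik).comp (hmin M) (hmin M)) (fun i => (hid i).comp (hmin M)) ?_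
    refine ne_top_of_le_ne_top (b := ∫⁻ _, (M : ℝ≥0∞) ∂μ) (by simp) ?_
    exact lintegral_mono fun ω => min_le_right _ _
  have hlim : Tendsto (fun M : ℕ => ∫⁻ ω, min (Y 0 ω) M ∂μ) atTop (𝓝 ∞) := by
    rw [← hfin]
    refine lintegral_tendsto_of_tendsto_of_monotone
      (fun M => ((hmin M).comp (hm 0)).aemeasurable) ?_ ?_
    · refine ae_of_all _ fun ω a b hab => ?_
      exact min_le_min le_rfl (by exact_mod_cast hab)
    · refine ae_of_all _ fun ω => ?_
      have := (tendsto_const_nhds (x := Y 0 ω)).min ENNReal.tendsto_nat_nhds_top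
      simpa using this
  filter_upwards [htr] with ω h
  rw [hfin, ENNReal.tendsto_nhds_top_iff_nnreal]
  intro x
  obtain ⟨M, hM⟩ := (hlim.eventually (lt_mem_nhds (ENNReal.coe_lt_top (r := x)))).exists
  filter_upwards [(h M).eventually (lt_mem_nhds hM)] with n hn
  refine hn.trans_le ?_
  gcongr
  exact min_le_left _ _

/-- Maximum principle for averages with positive weight at one step ahead. -/
theorem eq_of_averaging_of_le {p v : ℕ → ℝ} {B : ℝ} (hp : ∀ m, 0 ≤ p m) (hp1 : 0 < p 1)
    (hs : HasSum p 1) (hB : ∀ k, |v k| ≤ B)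
    (hv : ∀ k, v k = ∑' m, p m * v (k + m)) (hle : ∀ k, v k ≤ v 0) (k : ℕ) : v k = v 0 := by
  induction k with
  | zero => rfl
  | succ k ih =>
    refine le_antisymm (hle _) ?_
    have hsm : Summable fun m => p m * v (k + m) := by
      refine Summable.of_norm_bounded (hs.summable.mul_right B) fun m => ?_
      rw [Real.norm_eq_abs, abs_mul, abs_of_nonneg (hp m)]
      exact mul_le_mul_of_nonneg_left (hB _) (hp m)
    have h1 : HasSum (fun m => p m * (v 0 - v (k + m))) (v 0 - v k) := by
      have h := (hs.mul_right (v 0)).sub hsm.hasSum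
      rw [← hv k, one_mul] at h
      exact h.congr_fun (fun m => by ring)
    -- Once `v k` is maximal, an average of nonnegative deficits vanishes. The deficit one step
    -- ahead has positive weight, so it is zero.
    have h2 : p 1 * (v 0 - v (k + 1)) ≤ v 0 - v k :=
      le_hasSum h1 1 fun m _ => mul_nonneg (hp m) (sub_nonneg.2 (hle _))
    rw [ih, sub_self] at h2
    nlinarith

/-- Discrete renewal theorem, for a step distribution `p` that charges `1`, with tails `r`. -/
theorem renewal_tendsto {u p r : ℕ → ℝ} {B : ℝ} (hu : ∀ n, 0 ≤ u n) (hB : ∀ n, u n ≤ B)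
    (hp : ∀ m, 0 ≤ p m) (hp1 : 0 < p 1) (hs : HasSum p 1) (hr : ∀ m, 0 ≤ r m) (hrs : Summable r)
    (hrec : ∀ n, u (n + 1) = ∑ m ∈ Finset.range (n + 2), p m * u (n + 1 - m))
    (hone : ∀ n, ∑ m ∈ Finset.range (n + 1), r m * u (n - m) = 1) :
    Tendsto u atTop (𝓝 (∑' m, r m)⁻¹) := by
  have hB0 : 0 ≤ B := (hu 0).trans (hB 0)
  have hK : IsCompact (Set.Icc 0 B) := isCompact_Icc
  have hmem : ∀ n, u n ∈ Set.Icc 0 B := fun n => ⟨hu n, hB n⟩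
  -- limits along an ultrafilter
  have hlim : ∀ V : Ultrafilter ℕ, ∃ x ∈ Set.Icc 0 B, Tendsto u V (𝓝 x) := by
    intro V
    obtain ⟨x, hx, h⟩ := hK.ultrafilter_le_nhds (V.map u)
      (le_principal_iff.2 (Filter.Eventually.of_forall (f := (V : Filter ℕ)) hmem))
    exact ⟨x, hx, h⟩
  -- Compactness gives limits of all backward shifts along one ultrafilter, so a whole limit
  -- sequence `v` is obtained without extracting subsequences.
  have hsh : ∀ V : Ultrafilter ℕ, (V : Filter ℕ) ≤ atTop → ∃ v : ℕ → ℝ,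
      (∀ k, v k ∈ Set.Icc 0 B) ∧ (∀ k, Tendsto (fun n => u (n - k)) V (𝓝 (v k))) := by
    intro V hV
    have : ∀ k, ∃ x ∈ Set.Icc 0 B, Tendsto (fun n => u (n - k)) V (𝓝 x) := by
      intro k
      obtain ⟨x, hx, h⟩ := hlim (V.map fun n => n - k)
      exact ⟨x, hx, by rwa [Ultrafilter.coe_map, tendsto_map'_iff] at h⟩
    choose v hv h using this
    exact ⟨v, hv, h⟩
  -- convolutions pass to the limit
  have hconv : ∀ (V : Ultrafilter ℕ), (V : Filter ℕ) ≤ atTop → ∀ v : ℕ → ℝ,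
      (∀ k, Tendsto (fun n => u (n - k)) V (𝓝 (v k))) → ∀ q : ℕ → ℝ, (∀ m, 0 ≤ q m) →
      Summable q → ∀ k, Tendsto (fun n => ∑ m ∈ Finset.range (n - k + 1), q m * u (n - k - m)) V
        (𝓝 (∑' m, q m * v (k + m))) := by
    intro V hV v hv q hq hqs k
    have : ∀ n, ∑ m ∈ Finset.range (n - k + 1), q m * u (n - k - m)
        = ∑' m, (if m ∈ Finset.range (n - k + 1) then q m * u (n - k - m) else 0) := by
      intro n
      rw [tsum_eq_sum (s := Finset.range (n - k + 1)) (fun m hm => by simp [hm])]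
      exact Finset.sum_congr rfl fun m hm => by simp [hm]
    simp_rw [this]
    refine tendsto_tsum_of_dominated_convergence (hqs.mul_right B) ?_ ?_
    · intro m
      have h1 : Tendsto (fun n => q m * u (n - (k + m))) V (𝓝 (q m * v (k + m))) :=
        (hv (k + m)).const_mul _
      refine h1.congr' ?_
      filter_upwards [hV (eventually_ge_atTop (k + m))] with n hn
      have : m ∈ Finset.range (n - k + 1) := by simp only [Finset.mem_range]; omega
      rw [if_pos this, Nat.sub_sub]
    · refine Eventually.of_forall fun n m => ?_
      split_ifs
      · rw [Real.norm_eq_abs, abs_mul, abs_of_nonneg (hq m), abs_of_nonneg (hu _)]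
        exact mul_le_mul_of_nonneg_left (hB _) (hq m)
      · simpa using mul_nonneg (hq m) hB0
  have hval : ∀ (V : Ultrafilter ℕ), (V : Filter ℕ) ≤ atTop → ∀ v : ℕ → ℝ,
      (∀ k, v k ∈ Set.Icc 0 B) → (∀ k, Tendsto (fun n => u (n - k)) V (𝓝 (v k))) →
      ((∀ k, v k ≤ v 0) ∨ (∀ k, v 0 ≤ v k)) → v 0 = (∑' m, r m)⁻¹ := by
    intro V hV v hvm hv hor
    -- The renewal recursion survives in the limit as a harmonicity relation for `v`.
    have havg : ∀ k, v k = ∑' m, p m * v (k + m) := by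
      intro k
      refine tendsto_nhds_unique (hv k) ((hconv V hV v hv p hp hs.summable k).congr' ?_)
      filter_upwards [hV (eventually_ge_atTop (k + 1))] with n hn
      obtain ⟨l, hl⟩ : ∃ l, n - k = l + 1 := ⟨n - k - 1, by omega⟩
      rw [hl, hrec]
    have habs : ∀ k, |v k| ≤ B := fun k => by
      rw [abs_of_nonneg (hvm k).1]; exact (hvm k).2
    -- A harmonic sequence that attains its maximum or minimum at `0` is constant; the tail identity
    -- `hone` then determines the constant.
    have hc : ∀ k, v k = v 0 := by
      rcases hor with h | h
      · exact eq_of_averaging_of_le hp hp1 hs habs havg h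
      · intro k
        have := eq_of_averaging_of_le (v := fun k => - v k) hp hp1 hs (by simpa using habs)
          (fun k => by simp only [mul_neg, tsum_neg]; rw [← havg k]) (fun k => neg_le_neg (h k)) k
        simpa using this
    have h1 : ∑' m, r m * v (0 + m) = 1 := by
      refine tendsto_nhds_unique (hconv V hV v hv r hr hrs 0) ?_
      simp only [tsub_zero, hone]
      exact tendsto_const_nhds
    simp only [hc, tsum_mul_right] at h1
    exact eq_inv_of_mul_eq_one_right h1
  -- greatest and least cluster points
  set C : Set ℝ := {x | MapClusterPt x atTop u} with hC
  have hCc : IsClosed C := isClosed_setOfPred_clusterPt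
  have hCK : C ⊆ Set.Icc 0 B := fun x hx =>
    isClosed_Icc.closure_subset (ClusterPt.mem_closure_of_mem hx _
      (Filter.Eventually.of_forall (f := atTop) hmem))
  have hCcomp : IsCompact C := hK.of_isClosed_subset hCc hCK
  have hCne : C.Nonempty := by
    obtain ⟨x, -, hx⟩ := hK.exists_mapClusterPt (f := atTop) (u := u)
      (le_principal_iff.2 (Filter.Eventually.of_forall (f := atTop) hmem))
    exact ⟨x, hx⟩
  have hsubC : ∀ (V : Ultrafilter ℕ), (V : Filter ℕ) ≤ atTop → ∀ v : ℕ → ℝ,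
      (∀ k, Tendsto (fun n => u (n - k)) V (𝓝 (v k))) → ∀ k, v k ∈ C := by
    intro V hV v hv k
    refine mapClusterPt_iff_ultrafilter.2 ⟨V.map fun n => n - k, ?_, ?_⟩
    · rw [Ultrafilter.coe_map]
      exact (tendsto_sub_atTop_nat k).mono_left hV
    · rw [Ultrafilter.coe_map, tendsto_map'_iff]
      exact hv k
  -- Realize an extreme cluster point as `v 0`. Every `v k` is also a cluster point, so `v` is
  -- extremal at `0` and `hval` applies.
  have hext : ∀ x ∈ C, ((∀ y ∈ C, y ≤ x) ∨ (∀ y ∈ C, x ≤ y)) → x = (∑' m, r m)⁻¹ := by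
    intro x hx hor
    obtain ⟨V, hV, hVx⟩ := mapClusterPt_iff_ultrafilter.1 hx
    obtain ⟨v, hvm, hv⟩ := hsh V hV
    have h0 : v 0 = x := tendsto_nhds_unique (hv 0) (by simpa using hVx)
    rw [← h0]
    refine hval V hV v hvm hv ?_
    rw [h0]
    exact hor.imp (fun h k => h _ (hsubC V hV v hv k)) (fun h k => h _ (hsubC V hV v hv k))
  obtain ⟨x, hx⟩ := hCcomp.exists_isGreatest hCne
  obtain ⟨y, hy⟩ := hCcomp.exists_isLeast hCne
  have hx' := hext x hx.1 (Or.inl fun z hz => hx.2 hz)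
  have hy' := hext y hy.1 (Or.inr fun z hz => hy.2 hz)
  refine hK.tendsto_nhds_of_unique_mapClusterPt (Eventually.of_forall hmem) ?_
  intro z _ hz
  exact le_antisymm (hx' ▸ hx.2 hz) (hy' ▸ hy.2 hz)

/-- With a finite sum this is dominated convergence. With an infinite sum, finitely many terms
already exceed any bound in the limit, because `c` is nonzero. -/
theorem tendsto_convolution {a U : ℕ → ℝ≥0∞} {c B : ℝ≥0∞} (hU : Tendsto U atTop (𝓝 c))
    (hc : c ≠ 0) (hB : ∀ n, U n ≤ B) (hB' : B ≠ ∞) :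
    Tendsto (fun n => ∑ k ∈ Finset.range (n + 1), a k * U (n - k)) atTop (𝓝 ((∑' k, a k) * c)) := by
  have hterm : ∀ k, Tendsto (fun n => a k * U (n - k)) atTop (𝓝 (a k * c)) := fun k =>
    ENNReal.Tendsto.const_mul (hU.comp (tendsto_sub_atTop_nat k)) (Or.inl hc)
  by_cases hs : ∑' k, a k = ∞
  · rw [hs, ENNReal.top_mul hc, ENNReal.tendsto_nhds_top_iff_nnreal]
    intro x
    have h1 : Tendsto (fun M : ℕ => ∑ k ∈ Finset.range M, a k * c) atTop (𝓝 ∞) := by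
      have := ENNReal.tendsto_nat_tsum (fun k => a k * c)
      rwa [ENNReal.tsum_mul_right, hs, ENNReal.top_mul hc] at this
    obtain ⟨M, hM⟩ := (h1.eventually (lt_mem_nhds (ENNReal.coe_lt_top (r := x)))).exists
    have h2 : Tendsto (fun n => ∑ k ∈ Finset.range M, a k * U (n - k)) atTop
        (𝓝 (∑ k ∈ Finset.range M, a k * c)) := tendsto_finsetSum _ fun k _ => hterm k
    filter_upwards [h2.eventually (lt_mem_nhds hM), eventually_ge_atTop M] with n hn hnM
    refine hn.trans_le (Finset.sum_le_sum_of_subset fun k hk => ?_)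
    simp only [Finset.mem_range] at hk ⊢
    omega
  · have h1 : ∀ n, ∑ k ∈ Finset.range (n + 1), a k * U (n - k)
        = ∫⁻ k, (if k ∈ Finset.range (n + 1) then a k * U (n - k) else 0) ∂Measure.count := by
      intro n
      rw [lintegral_count, tsum_eq_sum (s := Finset.range (n + 1)) (fun m hm => by simp [hm])]
      exact Finset.sum_congr rfl fun m hm => by simp [hm]
    simp_rw [h1]
    rw [← ENNReal.tsum_mul_right, ← lintegral_count]
    refine tendsto_lintegral_of_dominated_convergence (fun k => a k * B)
      (fun n => measurable_of_countable _) (fun n => ae_of_all _ fun k => ?_) ?_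
      (ae_of_all _ fun k => ?_)
    · dsimp only
      split_ifs
      · gcongr; exact hB _
      · exact zero_le
    · rw [lintegral_count, ENNReal.tsum_mul_right]
      exact ENNReal.mul_ne_top hs hB'
    · refine (hterm k).congr' ?_
      filter_upwards [eventually_ge_atTop k] with n hn
      rw [if_pos (by simp only [Finset.mem_range]; omega)]

/-! ### Shifts by independent cycles -/

/-- `Θ` removes the first cycle of a path: what remains has the same law and is independent of
every function that takes the same value at paths with the same first cycle (relation `s`). -/
structure CycleShift {E : Type*} [MeasurableSpace E] (μ : Measure E) (Θ : E → E)
    (s : E → E → Prop) : Prop where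
  measurable : Measurable Θ
  lintegral_mul : ∀ f g : E → ℝ≥0∞, Measurable f → Measurable g →
    (∀ ω ω', s ω ω' → f ω = f ω') →
    ∫⁻ ω, f ω * g (Θ ω) ∂μ = (∫⁻ ω, f ω ∂μ) * ∫⁻ ω, g ω ∂μ

/-- Cycle sums of a function. -/
def cycleSum {E : Type*} (Θ : E → E) (N : E → ℕ) (c : ℕ) (ω : E) : ℕ :=
  ∑ i ∈ Finset.range c, N (Θ^[i] ω)

namespace CycleShift

variable {E : Type*} [MeasurableSpace E] {μ : Measure E} [IsProbabilityMeasure μ] {Θ : E → E}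
  {s : E → E → Prop}

theorem measurePreserving (h : CycleShift μ Θ s) : MeasurePreserving Θ μ μ := by
  refine ⟨h.measurable, ?_⟩
  ext S hS
  have := h.lintegral_mul (fun _ => 1) (S.indicator 1) measurable_const
    (measurable_one.indicator hS) (fun _ _ _ => rfl)
  simp only [one_mul, lintegral_const, measure_univ, lintegral_indicator_one hS] at this
  rw [Measure.map_apply h.measurable hS, ← this,
    ← lintegral_indicator_one (h.measurable hS)]
  rfl

theorem indepFun (h : CycleShift μ Θ s) {R g : E → ℝ≥0∞} (hR : Measurable R) (hg : Measurable g)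
    (hs : ∀ ω ω', s ω ω' → R ω = R ω') : IndepFun R (fun ω => g (Θ ω)) μ := by
  rw [indepFun_iff_measure_inter_preimage_eq_mul]
  intro S T hS hT
  have := h.lintegral_mul ((R ⁻¹' S).indicator 1) ((g ⁻¹' T).indicator 1)
    (measurable_one.indicator (hR hS)) (measurable_one.indicator (hg hT)) (fun ω ω' hω => by
      change S.indicator 1 (R ω) = S.indicator 1 (R ω')
      rw [hs ω ω' hω])
  rw [lintegral_indicator_one (hR hS), lintegral_indicator_one (hg hT)] at this
  have h2 : μ ((fun ω => g (Θ ω)) ⁻¹' T) = μ (g ⁻¹' T) :=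
    h.measurePreserving.measure_preimage (hg hT).nullMeasurableSet
  have m2 : MeasurableSet ((fun ω => g (Θ ω)) ⁻¹' T) := hg.comp h.measurable hT
  rw [h2, ← this, ← lintegral_indicator_one ((hR hS).inter m2)]
  refine lintegral_congr fun ω => ?_
  rw [Set.inter_indicator_one]
  rfl

/-- The copies of `R` at successive cycles are identically distributed because `Θ` preserves the
measure. They are pairwise independent, which suffices for the strong law. -/
theorem slln (h : CycleShift μ Θ s) {R : E → ℝ≥0∞} (hR : Measurable R)
    (hs : ∀ ω ω', s ω ω' → R ω = R ω') :
    ∀ᵐ ω ∂μ, Tendsto (fun n : ℕ => (∑ i ∈ Finset.range n, R (Θ^[i] ω)) / n) atTop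
      (𝓝 (∫⁻ ω, R ω ∂μ)) := by
  have hmp := fun i => h.measurePreserving.iterate i
  -- Pulling back by `Θ^[i]` reduces to the first cycle against a function of the path after it.
  have hlt : ∀ i k, i < k → IndepFun (fun ω => R (Θ^[i] ω)) (fun ω => R (Θ^[k] ω)) μ := by
    intro i k hik
    have h1 := h.indepFun hR (hR.comp (hmp (k - i - 1)).measurable) hs
    rw [indepFun_iff_measure_inter_preimage_eq_mul] at h1 ⊢
    intro S T hS hT
    have hk : ∀ ω, R (Θ^[k] ω) = R (Θ^[k - i - 1] (Θ (Θ^[i] ω))) := fun ω => by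
      rw [← Function.iterate_succ_apply, ← Function.iterate_add_apply]
      congr 2; omega
    have e1 : (fun ω => R (Θ^[i] ω)) ⁻¹' S = Θ^[i] ⁻¹' (R ⁻¹' S) := rfl
    have e2 : (fun ω => R (Θ^[k] ω)) ⁻¹' T
        = Θ^[i] ⁻¹' ((fun ω => (R ∘ Θ^[k - i - 1]) (Θ ω)) ⁻¹' T) := by
      ext ω; simp [hk]
    have m2 : MeasurableSet ((fun ω => (R ∘ Θ^[k - i - 1]) (Θ ω)) ⁻¹' T) :=
      (hR.comp (hmp _).measurable).comp h.measurable hT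
    rw [e1, e2, ← Set.preimage_inter, (hmp i).measure_preimage
      ((hR hS).inter m2).nullMeasurableSet, (hmp i).measure_preimage (hR hS).nullMeasurableSet,
      (hmp i).measure_preimage m2.nullMeasurableSet]
    exact h1 S T hS hT
  refine slln_ennreal (fun i ω => R (Θ^[i] ω)) (fun i => hR.comp (hmp i).measurable) ?_ ?_
  · intro i k hik
    rcases lt_or_gt_of_ne hik with hl | hl
    · exact hlt i k hl
    · exact (hlt k i hl).symm
  · intro i
    refine ⟨(hR.comp (hmp i).measurable).aemeasurable, hR.aemeasurable, ?_⟩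
    have : Measure.map (R ∘ Θ^[i]) μ = Measure.map R μ := by
      rw [← Measure.map_map hR (hmp i).measurable, (hmp i).map_eq]
    exact this

end CycleShift

theorem cycleSum_succ {E : Type*} (Θ : E → E) (N : E → ℕ) (c : ℕ) (ω : E) :
    cycleSum Θ N (c + 1) ω = N ω + cycleSum Θ N c (Θ ω) := by
  simp only [cycleSum, Finset.sum_range_succ', Function.iterate_succ_apply,
    Function.iterate_zero, id_eq]
  ring

theorem cycleSum_succ' {E : Type*} (Θ : E → E) (N : E → ℕ) (c : ℕ) (ω : E) :
    cycleSum Θ N (c + 1) ω = cycleSum Θ N c ω + N (Θ^[c] ω) :=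
  Finset.sum_range_succ _ _

theorem cycleSum_mono {E : Type*} (Θ : E → E) (N : E → ℕ) (ω : E) :
    Monotone fun c => cycleSum Θ N c ω :=
  monotone_nat_of_le_succ fun c => by simp [cycleSum_succ']

/-- A monotone unbounded sequence of naturals starting at `0` brackets every natural. -/
theorem exists_bracket {S : ℕ → ℕ} (h0 : S 0 = 0) (hS : Tendsto S atTop atTop)
    (n : ℕ) : ∃ c, S c ≤ n ∧ n < S (c + 1) := by
  obtain ⟨C, hC⟩ := (hS.eventually (eventually_gt_atTop n)).exists
  classical
  have hex : ∃ C, n < S C := ⟨C, hC⟩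
  have hpos : Nat.find hex ≠ 0 := fun h => by
    have := Nat.find_spec hex
    rw [h, h0] at this
    omega
  refine ⟨Nat.find hex - 1, not_lt.1 (Nat.find_min hex (by omega)), ?_⟩
  have := Nat.find_spec hex
  rwa [show Nat.find hex - 1 + 1 = Nat.find hex by omega]

theorem bracket_unique {S : ℕ → ℕ} (hm : Monotone S) {n c d : ℕ} (hc : S c ≤ n)
    (hc' : n < S (c + 1)) (hd : S d ≤ n) (hd' : n < S (d + 1)) : c = d := by
  rcases lt_trichotomy c d with h | h | h
  · have : S (c + 1) ≤ S d := hm h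
    omega
  · exact h
  · have : S (d + 1) ≤ S c := hm h
    omega

/-- Averages of a monotone sequence from its growth along a subsequence. -/
theorem cesaro_of_cycles {S : ℕ → ℕ} {b B : ℕ → ℝ≥0∞} {β ν : ℝ≥0∞} (h0 : S 0 = 0)
    (hν : ν ≠ 0) (hν' : ν ≠ ∞)
    (hS : Tendsto (fun c : ℕ => (S c : ℝ≥0∞) / c) atTop (𝓝 ν)) (hB : Monotone B)
    (hBS : ∀ c, B (S c) = b c) (hb : Tendsto (fun c : ℕ => b c / c) atTop (𝓝 β)) :
    Tendsto (fun n : ℕ => B n / n) atTop (𝓝 (β * ν⁻¹)) := by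
  have hSinv : Tendsto (fun c : ℕ => (c : ℝ≥0∞) / S c) atTop (𝓝 ν⁻¹) := by
    have := tendsto_inv_iff.2 hS
    refine this.congr' ?_
    filter_upwards [eventually_gt_atTop 0] with c hc
    rw [ENNReal.inv_div] <;> simp [hc.ne']
  have hSt : Tendsto S atTop atTop := by
    have h1 : Tendsto (fun c : ℕ => (S c : ℝ≥0∞)) atTop (𝓝 ∞) := by
      have h2 := ENNReal.Tendsto.mul hS (Or.inl hν) ENNReal.tendsto_nat_nhds_top (Or.inr hν')
      rw [ENNReal.mul_top hν] at h2
      refine h2.congr' ?_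
      filter_upwards [eventually_gt_atTop 0] with c hc
      rw [ENNReal.div_mul_cancel] <;> simp [hc.ne']
    rw [tendsto_atTop]
    intro n
    filter_upwards [h1.eventually (lt_mem_nhds (ENNReal.natCast_lt_top n))] with c hc
    exact_mod_cast hc.le
  -- `c n` is the cycle containing the index `n`.
  choose c hc hc' using fun n => exists_bracket h0 hSt n
  have hct : Tendsto c atTop atTop := by
    rw [tendsto_atTop]
    intro d
    have : ∃ M, ∀ k ≤ d, S k ≤ M :=
      ⟨∑ k ∈ Finset.range (d + 1), S k, fun k hk =>
        Finset.single_le_sum (f := S) (fun _ _ => Nat.zero_le _) (by simp; omega)⟩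
    obtain ⟨M, hM⟩ := this
    filter_upwards [eventually_ge_atTop M] with n hn
    by_contra hlt
    have := hM (c n + 1) (by omega)
    have := hc' n
    omega
  have hνi : ν⁻¹ ≠ 0 := ENNReal.inv_ne_zero.2 hν'
  have hνi' : ν⁻¹ ≠ ∞ := ENNReal.inv_ne_top.2 hν
  have hsucc : Tendsto (fun c : ℕ => ((c + 1 : ℕ) : ℝ≥0∞) / c) atTop (𝓝 1) := by
    have h1 : Tendsto (fun c : ℕ => 1 + (c : ℝ≥0∞)⁻¹) atTop (𝓝 (1 + 0)) :=
      tendsto_const_nhds.add ENNReal.tendsto_inv_nat_nhds_zero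
    rw [add_zero] at h1
    refine h1.congr' ?_
    filter_upwards [eventually_gt_atTop 0] with c hc
    rw [Nat.cast_add, ENNReal.add_div, ENNReal.div_self (by simp [hc.ne']) (by simp)]
    simp
  have hsucc' : Tendsto (fun c : ℕ => (c : ℝ≥0∞) / ((c + 1 : ℕ) : ℝ≥0∞)) atTop (𝓝 1) := by
    have := tendsto_inv_iff.2 hsucc
    rw [inv_one] at this
    refine this.congr fun c => ?_
    rw [ENNReal.inv_div] <;> simp
  -- Monotonicity gives `b c / S (c + 1) ≤ B n / n ≤ b (c + 1) / S c` for `c = c n`; both bounds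
  -- have the same limit because `(c + 1) / c` tends to `1`.
  have hlow : Tendsto (fun c : ℕ => b c / S (c + 1)) atTop (𝓝 (β * ν⁻¹)) := by
    have h1 := hSinv.comp (tendsto_add_atTop_nat 1)
    have h2 := ENNReal.Tendsto.mul hsucc' (Or.inl one_ne_zero) h1 (Or.inr ENNReal.one_ne_top)
    rw [one_mul] at h2
    have h3 := ENNReal.Tendsto.mul hb (Or.inr hνi') h2 (Or.inl hνi)
    refine h3.congr' ?_
    filter_upwards [eventually_gt_atTop 0] with c hc
    simp only [div_eq_mul_inv, Function.comp_apply]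
    rw [mul_assoc (b c), ← mul_assoc _ (_ * _) (_ * _), ← mul_assoc _ (c : ℝ≥0∞),
      ENNReal.inv_mul_cancel (by simp [hc.ne']) (by simp), one_mul, ← mul_assoc _ _ (_⁻¹),
      ENNReal.inv_mul_cancel (by simp) (by simp), one_mul]
  have hup : Tendsto (fun c : ℕ => b (c + 1) / S c) atTop (𝓝 (β * ν⁻¹)) := by
    have h1 := hb.comp (tendsto_add_atTop_nat 1)
    have h2 := ENNReal.Tendsto.mul hsucc (Or.inl one_ne_zero) hSinv (Or.inr ENNReal.one_ne_top)
    rw [one_mul] at h2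
    have h3 := ENNReal.Tendsto.mul h1 (Or.inr hνi') h2 (Or.inl hνi)
    refine h3.congr' ?_
    filter_upwards [eventually_gt_atTop 0] with c hc
    simp only [div_eq_mul_inv, Function.comp_apply]
    rw [mul_assoc (b (c + 1)), ← mul_assoc _ (_ * _) (_ * _), ← mul_assoc _ ((c + 1 : ℕ) : ℝ≥0∞),
      ENNReal.inv_mul_cancel (by simp) (by simp), one_mul, ← mul_assoc _ _ (_⁻¹),
      ENNReal.inv_mul_cancel (by simp [hc.ne']) (by simp), one_mul]
  refine tendsto_of_tendsto_of_tendsto_of_le_of_le (hlow.comp hct) (hup.comp hct) ?_ ?_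
  · intro n
    simp only [Function.comp_apply]
    rw [← hBS]
    exact ENNReal.div_le_div (hB (hc n)) (by exact_mod_cast (hc' n).le)
  · intro n
    simp only [Function.comp_apply]
    rw [← hBS]
    exact ENNReal.div_le_div (hB (hc' n).le) (by exact_mod_cast hc n)

theorem lintegral_ite_one {E : Type*} [MeasurableSpace E] {μ : Measure E} (p : E → Prop)
    [DecidablePred p] (hp : MeasurableSet {ω | p ω}) :
    ∫⁻ ω, (if p ω then 1 else 0) ∂μ = μ {ω | p ω} := by
  rw [← lintegral_indicator_one hp]
  refine lintegral_congr fun ω => ?_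
  simp [Set.indicator_apply]

/-! ### Renewal structure of the counts in successive cycles -/

namespace CycleShift

variable {E : Type*} [MeasurableSpace E] {μ : Measure E} [IsProbabilityMeasure μ] {Θ : E → E}
  {s : E → E → Prop} {N : E → ℕ}

theorem measurable_cycleSum (h : CycleShift μ Θ s) (hN : Measurable N) (c : ℕ) :
    Measurable (cycleSum Θ N c) :=
  Finset.measurable_sum _ fun i _ => hN.comp (h.measurePreserving.iterate i).measurable

/-- Condition on the count `k` of the first cycle, which is independent of everything after it. -/
theorem lintegral_cycleSum_succ (h : CycleShift μ Θ s) (hN : Measurable N)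
    (hs : ∀ ω ω', s ω ω' → N ω = N ω') {g : E → ℝ≥0∞} (hg : Measurable g) (c m : ℕ) :
    ∫⁻ ω, (if cycleSum Θ N (c + 1) ω = m then 1 else 0) * g (Θ^[c + 1] ω) ∂μ
      = ∑ k ∈ Finset.range (m + 1), μ {ω | N ω = k} *
        ∫⁻ ω, (if cycleSum Θ N c ω = m - k then 1 else 0) * g (Θ^[c] ω) ∂μ := by
  have hS := h.measurable_cycleSum hN c
  have hgc : Measurable fun ω => g (Θ^[c] ω) := hg.comp (h.measurePreserving.iterate c).measurable
  have hpt : ∀ ω, (if cycleSum Θ N (c + 1) ω = m then (1 : ℝ≥0∞) else 0) * g (Θ^[c + 1] ω)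
      = ∑ k ∈ Finset.range (m + 1), (if N ω = k then (1 : ℝ≥0∞) else 0) *
        ((if cycleSum Θ N c (Θ ω) = m - k then 1 else 0) * g (Θ^[c] (Θ ω))) := by
    intro ω
    rw [cycleSum_succ, Function.iterate_succ_apply]
    by_cases hle : N ω ≤ m
    · rw [Finset.sum_eq_single (N ω)]
      · have : (N ω + cycleSum Θ N c (Θ ω) = m) ↔ (cycleSum Θ N c (Θ ω) = m - N ω) := by omega
        simp [this]
      · intro k _ hk
        simp [hk.symm]
      · intro hk
        simp at hk
        omega
    · rw [if_neg (by omega), zero_mul, Finset.sum_eq_zero]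
      intro k hk
      have : N ω ≠ k := by simp at hk; omega
      simp [this]
  have hind : ∀ k, Measurable fun ω => (if cycleSum Θ N c ω = m - k then (1 : ℝ≥0∞) else 0) *
      g (Θ^[c] ω) := fun k =>
    (Measurable.ite (hS (measurableSet_singleton _)) measurable_const measurable_const).mul hgc
  have hNk : ∀ k, Measurable fun ω => if N ω = k then (1 : ℝ≥0∞) else 0 := fun k =>
    Measurable.ite (hN (measurableSet_singleton k)) measurable_const measurable_const
  simp_rw [hpt]
  have hprod : ∀ k, Measurable fun ω => (if N ω = k then (1 : ℝ≥0∞) else 0) *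
      ((if cycleSum Θ N c (Θ ω) = m - k then 1 else 0) * g (Θ^[c] (Θ ω))) := fun k =>
    (hNk k).mul ((hind k).comp h.measurable)
  rw [lintegral_finsetSum _ fun k _ => hprod k]
  refine Finset.sum_congr rfl fun k _ => ?_
  rw [h.lintegral_mul _ _ (hNk k) (hind k) (fun ω ω' hω => by rw [hs ω ω' hω])]
  rw [lintegral_ite_one (fun ω => N ω = k) (hN (measurableSet_singleton k))]

/-- The path after `c` cycles is independent of the count accumulated in them. By induction, the
integrals for `g` and for the constant `1` satisfy the same recursion. -/
theorem lintegral_cycleSum_mul (h : CycleShift μ Θ s) (hN : Measurable N)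
    (hs : ∀ ω ω', s ω ω' → N ω = N ω') {g : E → ℝ≥0∞} (hg : Measurable g) (c m : ℕ) :
    ∫⁻ ω, (if cycleSum Θ N c ω = m then 1 else 0) * g (Θ^[c] ω) ∂μ
      = μ {ω | cycleSum Θ N c ω = m} * ∫⁻ ω, g ω ∂μ := by
  have hone : ∀ c m, ∫⁻ ω, (if cycleSum Θ N c ω = m then 1 else 0) * (1 : ℝ≥0∞) ∂μ
      = μ {ω | cycleSum Θ N c ω = m} := by
    intro c m
    simp_rw [mul_one]
    exact lintegral_ite_one _ (h.measurable_cycleSum hN c (measurableSet_singleton m))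
  induction c generalizing m with
  | zero =>
    by_cases hm : m = 0
    · simp [cycleSum, hm]
    · simp [cycleSum, Ne.symm hm]
  | succ c ih =>
    rw [h.lintegral_cycleSum_succ hN hs hg, ← hone (c + 1),
      h.lintegral_cycleSum_succ hN hs (g := fun _ => 1) measurable_const, Finset.sum_mul]
    refine Finset.sum_congr rfl fun k _ => ?_
    rw [ih, hone, mul_assoc]

/-- Expected number of cycles that begin at the count `m`. -/
noncomputable def renewalMeasure (μ : Measure E) (Θ : E → E) (N : E → ℕ) (m : ℕ) : ℝ≥0∞ :=
  ∑' c, μ {ω | cycleSum Θ N c ω = m}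

/-- Only positive arguments appear because the empty sum of cycles contributes an extra `1` at `0`.
The term `k = 0` is kept: a cycle may contain no package of the source, so the renewal measure can
exceed `1`. -/
theorem renewalMeasure_succ (h : CycleShift μ Θ s) (hN : Measurable N)
    (hs : ∀ ω ω', s ω ω' → N ω = N ω') (m : ℕ) :
    renewalMeasure μ Θ N (m + 1)
      = ∑ k ∈ Finset.range (m + 2), μ {ω | N ω = k} * renewalMeasure μ Θ N (m + 1 - k) := by
  have hrec : ∀ c, μ {ω | cycleSum Θ N (c + 1) ω = m + 1}
      = ∑ k ∈ Finset.range (m + 2), μ {ω | N ω = k} * μ {ω | cycleSum Θ N c ω = m + 1 - k} := by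
    intro c
    have h1 := h.lintegral_cycleSum_mul hN hs (g := fun _ => 1) measurable_const (c + 1) (m + 1)
    rw [h.lintegral_cycleSum_succ hN hs (g := fun _ => 1) measurable_const] at h1
    simp only [lintegral_const, measure_univ, mul_one] at h1
    rw [← h1]
    refine Finset.sum_congr rfl fun k _ => ?_
    have h2 := h.lintegral_cycleSum_mul hN hs (g := fun _ => 1) measurable_const c (m + 1 - k)
    simp only [lintegral_const, measure_univ, mul_one] at h2
    rw [h2]
  rw [renewalMeasure, tsum_eq_zero_add' ENNReal.summable]
  simp only [hrec]
  rw [Summable.tsum_finsetSum fun _ _ => ENNReal.summable]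
  simp only [ENNReal.tsum_mul_left, renewalMeasure]
  simp [cycleSum]

theorem tendsto_cycleSum (h : CycleShift μ Θ s) (hN : Measurable N)
    (hs : ∀ ω ω', s ω ω' → N ω = N ω') (hpos : ∫⁻ ω, (N ω : ℝ≥0∞) ∂μ ≠ 0) :
    ∀ᵐ ω ∂μ, Tendsto (fun c => cycleSum Θ N c ω) atTop atTop := by
  have hNm : Measurable fun ω => (N ω : ℝ≥0∞) := measurable_of_countable _ |>.comp hN
  filter_upwards [h.slln hNm fun ω ω' hω => by rw [hs ω ω' hω]] with ω hω
  have h2 := ENNReal.Tendsto.mul hω (Or.inl hpos) ENNReal.tendsto_nat_nhds_top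
    (Or.inl ENNReal.top_ne_zero)
  rw [ENNReal.mul_top hpos] at h2
  rw [tendsto_atTop]
  intro n
  filter_upwards [h2.eventually (lt_mem_nhds (ENNReal.natCast_lt_top n)),
    eventually_gt_atTop 0] with c hc hc0
  rw [ENNReal.div_mul_cancel (by simp [hc0.ne']) (by simp)] at hc
  have : (n : ℝ≥0∞) < (cycleSum Θ N c ω : ℕ) := by
    rw [cycleSum]; push_cast; exact hc
  exact_mod_cast this.le

theorem ae_cycleSum_add (h : CycleShift μ Θ s) {W : ℕ → E → ℝ≥0∞}
    (hW : ∀ᵐ ω ∂μ, ∀ m, W (N ω + m) ω = W m (Θ ω)) :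
    ∀ᵐ ω ∂μ, ∀ c m, W (cycleSum Θ N c ω + m) ω = W m (Θ^[c] ω) := by
  have h1 : ∀ᵐ ω ∂μ, ∀ c, ∀ m, W (N (Θ^[c] ω) + m) (Θ^[c] ω) = W m (Θ (Θ^[c] ω)) := by
    rw [ae_all_iff]
    exact fun c => (h.measurePreserving.iterate c).quasiMeasurePreserving.ae hW
  filter_upwards [h1] with ω hω c
  induction c with
  | zero => intro m; simp [cycleSum]
  | succ c ih =>
    intro m
    rw [cycleSum_succ', add_assoc, ih, hω, Function.iterate_succ_apply']

/-- Decomposition of a mean according to the cycle in which the index falls. -/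
theorem lintegral_eq_convolution (h : CycleShift μ Θ s) (hN : Measurable N)
    (hs : ∀ ω ω', s ω ω' → N ω = N ω') (hpos : ∫⁻ ω, (N ω : ℝ≥0∞) ∂μ ≠ 0)
    {W : ℕ → E → ℝ≥0∞} (hWm : ∀ n, Measurable (W n))
    (hW : ∀ᵐ ω ∂μ, ∀ m, W (N ω + m) ω = W m (Θ ω)) (n : ℕ) :
    ∫⁻ ω, W n ω ∂μ = ∑ k ∈ Finset.range (n + 1),
      (∫⁻ ω, (if k < N ω then W k ω else 0) ∂μ) * renewalMeasure μ Θ N (n - k) := by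
  have ham : ∀ k, Measurable fun ω => if k < N ω then W k ω else 0 := fun k =>
    Measurable.ite (measurableSet_lt measurable_const hN) (hWm k) measurable_const
  -- Exactly one cycle contains the index `n`. Splitting by its starting count `m` gives products to
  -- which independence applies.
  have hae : ∀ᵐ ω ∂μ, W n ω = ∑' c, ∑ m ∈ Finset.range (n + 1),
      (if cycleSum Θ N c ω = m then 1 else 0) *
        (if n - m < N (Θ^[c] ω) then W (n - m) (Θ^[c] ω) else 0) := by
    filter_upwards [h.tendsto_cycleSum hN hs hpos, h.ae_cycleSum_add hW] with ω h1 h2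
    obtain ⟨c, hc, hc'⟩ := exists_bracket (by simp [cycleSum]) h1 n
    have hin : ∀ d, ∑ m ∈ Finset.range (n + 1), (if cycleSum Θ N d ω = m then (1 : ℝ≥0∞) else 0) *
        (if n - m < N (Θ^[d] ω) then W (n - m) (Θ^[d] ω) else 0)
        = if cycleSum Θ N d ω ≤ n ∧ n < cycleSum Θ N (d + 1) ω then W n ω else 0 := by
      intro d
      by_cases hd : cycleSum Θ N d ω ≤ n
      · rw [Finset.sum_eq_single (cycleSum Θ N d ω)]
        · have e : n - cycleSum Θ N d ω < N (Θ^[d] ω) ↔ n < cycleSum Θ N (d + 1) ω := by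
            rw [cycleSum_succ']; omega
          rw [← h2, Nat.add_sub_cancel' hd]
          simp [hd, e]
        · intro m _ hm
          simp [hm.symm]
        · intro hm
          simp at hm
          omega
      · rw [if_neg (by tauto), Finset.sum_eq_zero]
        intro m hm
        have : cycleSum Θ N d ω ≠ m := by simp at hm; omega
        simp [this]
    simp_rw [hin]
    rw [tsum_eq_single c, if_pos ⟨hc, hc'⟩]
    intro d hd
    rw [if_neg]
    rintro ⟨h3, h4⟩
    exact hd (bracket_unique (cycleSum_mono Θ N ω) h3 h4 hc hc')
  have hmeas : ∀ c m, Measurable fun ω => (if cycleSum Θ N c ω = m then (1 : ℝ≥0∞) else 0) *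
        (if n - m < N (Θ^[c] ω) then W (n - m) (Θ^[c] ω) else 0) := fun c m =>
    (Measurable.ite (h.measurable_cycleSum hN c (measurableSet_singleton m)) measurable_const
      measurable_const).mul ((ham (n - m)).comp (h.measurePreserving.iterate c).measurable)
  rw [lintegral_congr_ae hae, lintegral_tsum fun c =>
    (Finset.measurable_fun_sum _ fun m _ => hmeas c m).aemeasurable]
  simp_rw [lintegral_finsetSum _ fun m _ => hmeas _ m]
  simp_rw [h.lintegral_cycleSum_mul hN hs (ham _)]
  rw [Summable.tsum_finsetSum fun _ _ => ENNReal.summable]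
  simp_rw [ENNReal.tsum_mul_right]
  rw [← Finset.sum_flip]
  refine Finset.sum_congr rfl fun k hk => ?_
  have : n - (n - k) = k := by simp at hk; omega
  rw [this, mul_comm, renewalMeasure]

theorem sum_tail_eq {ρ : Measure E} (hN : Measurable N) {W : ℕ → E → ℝ≥0∞}
    (hWm : ∀ n, Measurable (W n)) :
    ∑' k, ∫⁻ ω, (if k < N ω then W k ω else 0) ∂ρ
      = ∫⁻ ω, ∑ k ∈ Finset.range (N ω), W k ω ∂ρ := by
  have ham : ∀ k, Measurable fun ω => if k < N ω then W k ω else 0 := fun k =>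
    Measurable.ite (measurableSet_lt measurable_const hN) (hWm k) measurable_const
  rw [← lintegral_tsum fun k => (ham k).aemeasurable]
  refine lintegral_congr fun ω => ?_
  rw [tsum_eq_sum (s := Finset.range (N ω)) fun k hk => by simp at hk; simp [hk]]
  exact Finset.sum_congr rfl fun k hk => by simp at hk; simp [hk]

theorem sum_tail {ρ : Measure E} (hN : Measurable N) :
    ∑' k, ρ {ω | k < N ω} = ∫⁻ ω, (N ω : ℝ≥0∞) ∂ρ := by
  have := sum_tail_eq (ρ := ρ) hN (W := fun _ _ => 1) fun _ => measurable_const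
  simp only [Finset.sum_const, Finset.card_range, nsmul_eq_mul, mul_one] at this
  rw [← this]
  refine tsum_congr fun k => ?_
  rw [lintegral_ite_one _ (measurableSet_lt measurable_const hN)]

theorem lintegral_count_ne_zero {ρ : Measure E} (hp1 : ρ {ω | N ω = 1} ≠ 0) (hN : Measurable N) :
    ∫⁻ ω, (N ω : ℝ≥0∞) ∂ρ ≠ 0 := by
  intro h0
  rw [← sum_tail hN, ENNReal.tsum_eq_zero] at h0
  exact hp1 (measure_mono_null (fun ω (hω : N ω = 1) => by simp [hω]) (h0 0))

/-- The hypotheses of the analytic renewal theorem come from the convolution decomposition: applied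
to the constant reward `1`, it is the tail identity. -/
theorem renewalMeasure_tendsto (h : CycleShift μ Θ s) (hN : Measurable N)
    (hs : ∀ ω ω', s ω ω' → N ω = N ω') (hp1 : μ {ω | N ω = 1} ≠ 0)
    (hfin : ∫⁻ ω, (N ω : ℝ≥0∞) ∂μ ≠ ∞) :
    (∃ B, B ≠ ∞ ∧ ∀ n, renewalMeasure μ Θ N n ≤ B) ∧
    Tendsto (renewalMeasure μ Θ N) atTop (𝓝 (∫⁻ ω, (N ω : ℝ≥0∞) ∂μ)⁻¹) := by
  have hpos := lintegral_count_ne_zero hp1 hN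
  have hone : ∀ n, ∑ k ∈ Finset.range (n + 1), μ {ω | k < N ω} * renewalMeasure μ Θ N (n - k)
      = 1 := by
    intro n
    have h1 := h.lintegral_eq_convolution hN hs hpos (W := fun _ _ => 1)
      (fun _ => measurable_const) (ae_of_all _ fun _ _ => rfl) n
    rw [lintegral_const, measure_univ, one_mul] at h1
    rw [h1]
    refine Finset.sum_congr rfl fun k _ => ?_
    rw [lintegral_ite_one _ (measurableSet_lt measurable_const hN)]
  have hr0 : μ {ω | 0 < N ω} ≠ 0 := fun h0 =>
    hp1 (measure_mono_null (fun ω (hω : N ω = 1) => by simp [hω]) h0)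
  -- One term of the tail identity, `k = 0`, bounds the renewal measure uniformly.
  have hB : ∀ n, renewalMeasure μ Θ N n ≤ (μ {ω | 0 < N ω})⁻¹ := by
    intro n
    rw [ENNReal.le_inv_iff_mul_le, mul_comm, ← hone n]
    exact Finset.single_le_sum
      (f := fun k => μ {ω | k < N ω} * renewalMeasure μ Θ N (n - k)) (fun _ _ => zero_le)
      (Finset.mem_range.2 (Nat.succ_pos n))
  have hBt : (μ {ω | 0 < N ω})⁻¹ ≠ ∞ := ENNReal.inv_ne_top.2 hr0
  have hUt : ∀ n, renewalMeasure μ Θ N n ≠ ∞ := fun n => ne_top_of_le_ne_top hBt (hB n)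
  refine ⟨⟨_, hBt, hB⟩, ?_⟩
  have hsumN := sum_tail (ρ := μ) hN
  have hps : ∑' m, μ {ω | N ω = m} = 1 := by
    have := tsum_measure_preimage_singleton (μ := μ) (f := N) (Set.countable_univ)
      (fun y _ => hN (measurableSet_singleton y))
    rw [Set.preimage_univ, measure_univ] at this
    rw [← this]
    exact (tsum_univ (fun m => μ (N ⁻¹' {m}))).symm
  have key := renewal_tendsto (u := fun n => (renewalMeasure μ Θ N n).toReal)
    (p := fun m => (μ {ω | N ω = m}).toReal) (r := fun m => (μ {ω | m < N ω}).toReal)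
    (B := ((μ {ω | 0 < N ω})⁻¹).toReal) (fun _ => ENNReal.toReal_nonneg)
    (fun n => ENNReal.toReal_mono hBt (hB n)) (fun _ => ENNReal.toReal_nonneg)
    (ENNReal.toReal_pos hp1 (measure_ne_top _ _))
    (by
      have := ENNReal.hasSum_toReal (f := fun m => μ {ω | N ω = m}) (by rw [hps]; simp)
      rwa [← ENNReal.tsum_toReal_eq fun _ => measure_ne_top _ _, hps, ENNReal.toReal_one] at this)
    (fun _ => ENNReal.toReal_nonneg)
    (ENNReal.summable_toReal (by rwa [hsumN]))
    (fun n => by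
      rw [h.renewalMeasure_succ hN hs, ENNReal.toReal_sum fun k _ =>
        ENNReal.mul_ne_top (measure_ne_top _ _) (hUt _)]
      simp only [ENNReal.toReal_mul])
    (fun n => by
      rw [← ENNReal.toReal_one, ← hone n, ENNReal.toReal_sum fun k _ =>
        ENNReal.mul_ne_top (measure_ne_top _ _) (hUt _)]
      simp only [ENNReal.toReal_mul])
  rw [← ENNReal.tsum_toReal_eq fun _ => measure_ne_top _ _, hsumN, ← ENNReal.toReal_inv] at key
  have h3 := ENNReal.tendsto_ofReal key
  rw [ENNReal.ofReal_toReal (ENNReal.inv_ne_top.2 hpos)] at h3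
  exact h3.congr fun n => ENNReal.ofReal_toReal (hUt n)

/-- Means and averages of a sequence that starts afresh with each cycle. -/
theorem limit (h : CycleShift μ Θ s) (hN : Measurable N)
    (hs : ∀ ω ω', s ω ω' → N ω = N ω') (hp1 : μ {ω | N ω = 1} ≠ 0)
    (hfin : ∫⁻ ω, (N ω : ℝ≥0∞) ∂μ ≠ ∞) {W : ℕ → E → ℝ≥0∞} (hWm : ∀ n, Measurable (W n))
    (hW : ∀ᵐ ω ∂μ, ∀ m, W (N ω + m) ω = W m (Θ ω))
    (hWs : ∀ ω ω', s ω ω' → ∀ k < N ω, W k ω = W k ω') :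
    ∃ w : ℝ≥0∞, Tendsto (fun n => ∫⁻ ω, W n ω ∂μ) atTop (𝓝 w) ∧
      ∀ᵐ ω ∂μ, Tendsto (fun n : ℕ => (∑ k ∈ Finset.range n, W k ω) / n) atTop (𝓝 w) := by
  have hpos := lintegral_count_ne_zero hp1 hN
  obtain ⟨⟨B, hB', hB⟩, hU⟩ := h.renewalMeasure_tendsto hN hs hp1 hfin
  -- The renewal-reward value: mean reward in a cycle over mean count in a cycle.
  refine ⟨(∫⁻ ω, ∑ k ∈ Finset.range (N ω), W k ω ∂μ) * (∫⁻ ω, (N ω : ℝ≥0∞) ∂μ)⁻¹, ?_, ?_⟩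
  · rw [← sum_tail_eq hN hWm]
    simp_rw [h.lintegral_eq_convolution hN hs hpos hWm hW]
    exact tendsto_convolution hU (ENNReal.inv_ne_zero.2 hfin) hB hB'
  · have hRm : Measurable fun ω => ∑ k ∈ Finset.range (N ω), W k ω := by
      have : Measurable fun p : ℕ × E => ∑ k ∈ Finset.range p.1, W k p.2 :=
        measurable_from_prod_countable_right fun n => by
          simpa using Finset.measurable_fun_sum (Finset.range n) fun k _ => hWm k
      exact this.comp (hN.prodMk measurable_id)
    have hRs : ∀ ω ω', s ω ω' → ∑ k ∈ Finset.range (N ω), W k ω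
        = ∑ k ∈ Finset.range (N ω'), W k ω' := by
      intro ω ω' hω
      rw [← hs ω ω' hω]
      exact Finset.sum_congr rfl fun k hk => hWs ω ω' hω k (Finset.mem_range.1 hk)
    have hNm : Measurable fun ω => (N ω : ℝ≥0∞) := measurable_of_countable _ |>.comp hN
    filter_upwards [h.slln hRm hRs, h.slln hNm fun ω ω' hω => by rw [hs ω ω' hω],
      h.ae_cycleSum_add hW] with ω h1 h2 h3
    refine cesaro_of_cycles (S := fun c => cycleSum Θ N c ω)
      (b := fun c => ∑ i ∈ Finset.range c, ∑ k ∈ Finset.range (N (Θ^[i] ω)), W k (Θ^[i] ω))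
      (by simp [cycleSum]) hpos hfin ?_ ?_ ?_ h1
    · refine h2.congr fun c => ?_
      rw [cycleSum]; push_cast; rfl
    · intro a b hab
      exact Finset.sum_le_sum_of_subset (Finset.range_mono hab)
    · intro c
      induction c with
      | zero => simp [cycleSum]
      | succ c ih =>
        rw [Finset.sum_range_succ, ← ih, cycleSum_succ', Finset.sum_range_add]
        simp only [h3]

end CycleShift

/-! ### Regeneration at random discrete epochs -/

/-- `A k` is the event that epoch `k` is a regeneration, `θ k` the path after it, and `r k` relates
paths that agree up to epoch `k`. -/
structure Regeneration {E : Type*} [MeasurableSpace E] (μ : Measure E) (A : ℕ → Set E)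
    (θ : ℕ → E → E) (r : ℕ → E → E → Prop) : Prop where
  measurableSet : ∀ k, MeasurableSet (A k)
  measurable : ∀ k, Measurable (θ k)
  ae_zero : ∀ᵐ ω ∂μ, ω ∈ A 0
  mem_add : ∀ k l ω, ω ∈ A k → (ω ∈ A (k + l) ↔ θ k ω ∈ A l)
  mem_congr : ∀ k l ω ω', ω ∈ A k → ω' ∈ A k → r k ω ω' → l ≤ k → (ω ∈ A l ↔ ω' ∈ A l)
  lintegral_mul : ∀ k (f g : E → ℝ≥0∞), Measurable f → Measurable g →
    (∀ ω ω', ω ∈ A k → ω' ∈ A k → r k ω ω' → f ω = f ω') →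
    ∫⁻ ω in A k, f ω * g (θ k ω) ∂μ = (∫⁻ ω in A k, f ω ∂μ) * ∫⁻ ω, g ω ∂μ

/-- No regeneration at the epochs `1, …, m`. -/
def noReturn {E : Type*} (A : ℕ → Set E) (m : ℕ) : Set E := {ω | ∀ l, 1 ≤ l → l ≤ m → ω ∉ A l}

/-- First regeneration after epoch `0`. -/
noncomputable def firstReturn {E : Type*} (A : ℕ → Set E) (ω : E) : ℕ :=
  sInf {l | 1 ≤ l ∧ ω ∈ A l}

/-- Path after the first regeneration. -/
noncomputable def returnShift {E : Type*} (A : ℕ → Set E) (θ : ℕ → E → E) (ω : E) : E :=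
  θ (firstReturn A ω) ω

/-- The two paths have the same first cycle. -/
def SameCycle {E : Type*} (A : ℕ → Set E) (r : ℕ → E → E → Prop) (ω ω' : E) : Prop :=
  firstReturn A ω = firstReturn A ω' ∧ 1 ≤ firstReturn A ω ∧ ω ∈ A (firstReturn A ω) ∧
    ω' ∈ A (firstReturn A ω) ∧ r (firstReturn A ω) ω ω'

theorem firstReturn_eq {E : Type*} {A : ℕ → Set E} {ω : E} {k : ℕ} (hk : ω ∈ A (k + 1))
    (hn : ω ∈ noReturn A k) : firstReturn A ω = k + 1 := by
  refine le_antisymm (Nat.sInf_le ⟨by omega, hk⟩) ?_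
  have hne : {l | 1 ≤ l ∧ ω ∈ A l}.Nonempty := ⟨k + 1, by omega, hk⟩
  by_contra hlt
  obtain ⟨h1, h2⟩ := Nat.sInf_mem hne
  exact hn _ h1 (by unfold firstReturn at hlt; omega) h2

theorem firstReturn_spec {E : Type*} {A : ℕ → Set E} {ω : E} (h : ∃ l, 1 ≤ l ∧ ω ∈ A l) :
    1 ≤ firstReturn A ω ∧ ω ∈ A (firstReturn A ω) :=
  Nat.sInf_mem (s := {l | 1 ≤ l ∧ ω ∈ A l}) h

theorem notMem_of_lt_firstReturn {E : Type*} {A : ℕ → Set E} {ω : E} {l : ℕ} (h1 : 1 ≤ l)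
    (h : l < firstReturn A ω) : ω ∉ A l := fun hl =>
  Nat.notMem_of_lt_sInf (s := {l | 1 ≤ l ∧ ω ∈ A l}) h ⟨h1, hl⟩

theorem mem_noReturn_of_lt {E : Type*} {A : ℕ → Set E} {ω : E} {m : ℕ}
    (h : m < firstReturn A ω) : ω ∈ noReturn A m := fun _ h1 h2 =>
  notMem_of_lt_firstReturn h1 (h2.trans_lt h)

/-- Bound for the sum of `r` when `u * r = 1` and `u` has positive lower density. -/
theorem tsum_ne_top_of_convolution {u r : ℕ → ℝ≥0∞} {δ : ℝ≥0∞} (hδ : δ ≠ 0)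
    (hone : ∀ n, ∑ c ∈ Finset.range (n + 1), u c * r (n - c) = 1)
    (hu : ∀ᶠ n : ℕ in atTop, δ * n ≤ ∑ c ∈ Finset.range n, u c) : ∑' m, r m ≠ ∞ := by
  -- Every pair of indices below `m` has sum below `2 * m`, so the product of partial sums is part
  -- of the first `2 * m` convolutions, each equal to `1`.
  have hle : ∀ m, (∑ c ∈ Finset.range m, u c) * (∑ k ∈ Finset.range m, r k) ≤ (2 * m : ℕ) := by
    intro m
    have h1 : ((2 * m : ℕ) : ℝ≥0∞) = ∑ n ∈ Finset.range (2 * m),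
        ∑ c ∈ Finset.range (2 * m), if c ≤ n then u c * r (n - c) else 0 := by
      rw [Finset.sum_congr rfl (g := fun _ => (1 : ℝ≥0∞))]
      · simp
      · intro n hn
        rw [← hone n, ← Finset.sum_filter]
        congr 1
        ext c
        simp at hn ⊢
        omega
    rw [h1, Finset.sum_comm, Finset.sum_mul]
    refine (Finset.sum_le_sum fun c hc => ?_).trans
      (Finset.sum_le_sum_of_subset (Finset.range_mono (by omega : m ≤ 2 * m)))
    rw [Finset.mul_sum]
    have h2 : ∑ k ∈ Finset.range m, u c * r k
        = ∑ n ∈ Finset.Ico c (c + m), u c * r (n - c) := by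
      rw [Finset.sum_Ico_eq_sum_range]
      simp
    rw [h2, ← Finset.sum_filter]
    refine Finset.sum_le_sum_of_subset fun n hn => ?_
    simp at hn hc ⊢
    omega
  have hb : ∀ᶠ m : ℕ in atTop, ∑ k ∈ Finset.range m, r k ≤ 2 / δ := by
    filter_upwards [hu, eventually_gt_atTop 0] with m hm hm0
    have h1 : δ * m * ∑ k ∈ Finset.range m, r k ≤ (2 * m : ℕ) :=
      (mul_le_mul_left hm _).trans (hle m)
    have hm' : (m : ℝ≥0∞) ≠ 0 := by simp [hm0.ne']
    rw [ENNReal.le_div_iff_mul_le (Or.inl hδ) (Or.inr (by simp))]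
    rw [← ENNReal.mul_le_mul_iff_left hm' (by simp)]
    calc (∑ k ∈ Finset.range m, r k) * δ * m = δ * m * ∑ k ∈ Finset.range m, r k := by ring
      _ ≤ _ := h1
      _ = 2 * m := by push_cast; ring
  exact ne_top_of_le_ne_top (ENNReal.div_ne_top (by simp) hδ)
    (le_of_tendsto (ENNReal.tendsto_nat_tsum r) hb)

theorem measurableSet_noReturn {E : Type*} [MeasurableSpace E] {A : ℕ → Set E}
    (h : ∀ k, MeasurableSet (A k)) (m : ℕ) :
    MeasurableSet (noReturn A m) := by
  have : noReturn A m = ⋂ l, ⋂ (_ : 1 ≤ l), ⋂ (_ : l ≤ m), (A l)ᶜ := by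
    ext ω; simp [noReturn]
  rw [this]
  exact MeasurableSet.iInter fun l => MeasurableSet.iInter fun _ => MeasurableSet.iInter fun _ =>
    (h l).compl

theorem measurable_firstReturn {E : Type*} [MeasurableSpace E] {A : ℕ → Set E}
    (h : ∀ k, MeasurableSet (A k)) :
    Measurable (firstReturn A) := by
  refine measurable_to_countable' fun k => ?_
  cases k with
  | zero =>
    -- The value `0` is the infimum of the empty set, taken exactly when there is no return.
    have : firstReturn A ⁻¹' {0} = ⋂ l, noReturn A l := by
      ext ω
      simp only [Set.mem_preimage, Set.mem_singleton_iff, Set.mem_iInter]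
      constructor
      · intro h0 m l h1 _ hl
        have := (firstReturn_spec ⟨l, h1, hl⟩).1
        omega
      · intro hn
        by_contra h0
        have hne : {l | 1 ≤ l ∧ ω ∈ A l}.Nonempty := Nat.nonempty_of_pos_sInf (by
          unfold firstReturn at h0; omega)
        obtain ⟨l, h1, h2⟩ := hne
        exact hn l l h1 le_rfl h2
    rw [this]
    exact MeasurableSet.iInter fun l => measurableSet_noReturn h l
  | succ k =>
    have : firstReturn A ⁻¹' {k + 1} = A (k + 1) ∩ noReturn A k := by
      ext ω
      simp only [Set.mem_preimage, Set.mem_singleton_iff]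
      constructor
      · intro h0
        have hne : {l | 1 ≤ l ∧ ω ∈ A l}.Nonempty := Nat.nonempty_of_pos_sInf (by
          unfold firstReturn at h0; omega)
        have := firstReturn_spec hne
        rw [h0] at this
        exact ⟨this.2, mem_noReturn_of_lt (by omega)⟩
      · rintro ⟨h1, h2⟩
        exact firstReturn_eq h1 h2
    rw [this]
    exact (h _).inter (measurableSet_noReturn h _)

namespace Regeneration

variable {E : Type*} [MeasurableSpace E] {μ : Measure E} [IsProbabilityMeasure μ] {A : ℕ → Set E}
  {θ : ℕ → E → E} {r : ℕ → E → E → Prop}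

theorem measurableSet_noReturn {ρ : Measure E} (h : Regeneration ρ A θ r) (m : ℕ) :
    MeasurableSet (noReturn A m) := _root_.measurableSet_noReturn h.measurableSet m

theorem measurable_firstReturn {ρ : Measure E} (h : Regeneration ρ A θ r) :
    Measurable (firstReturn A) := _root_.measurable_firstReturn h.measurableSet

theorem measurable_returnShift {ρ : Measure E} (h : Regeneration ρ A θ r) :
    Measurable (returnShift A θ) := by
  have : Measurable fun p : ℕ × E => θ p.1 p.2 :=
    measurable_from_prod_countable_right fun n => by simpa using h.measurable n
  exact this.comp (h.measurable_firstReturn.prodMk measurable_id)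

/-- The events "the last regeneration up to `n` is at `c`" partition the space, and the path after
`c` is independent of regeneration at `c`. -/
theorem sum_last_regeneration (h : Regeneration μ A θ r) (n : ℕ) :
    ∑ c ∈ Finset.range (n + 1), μ (A c) * μ (noReturn A (n - c)) = 1 := by
  have h1 : ∀ c, μ (A c) * μ (noReturn A (n - c))
      = ∫⁻ ω in A c, (noReturn A (n - c)).indicator 1 (θ c ω) ∂μ := by
    intro c
    have := h.lintegral_mul c (fun _ => 1) ((noReturn A (n - c)).indicator 1) measurable_const
      (measurable_one.indicator (h.measurableSet_noReturn _)) (fun _ _ _ _ _ => rfl)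
    simp only [one_mul, lintegral_const, Measure.restrict_apply_univ,
      lintegral_indicator_one (h.measurableSet_noReturn _)] at this
    exact this.symm
  have hm : ∀ c, Measurable fun ω => (noReturn A (n - c)).indicator (1 : E → ℝ≥0∞) (θ c ω) :=
    fun c => (measurable_one.indicator (h.measurableSet_noReturn _)).comp (h.measurable c)
  simp_rw [h1, ← lintegral_indicator (h.measurableSet _)]
  rw [← lintegral_finsetSum _ fun c _ => (hm c).indicator (h.measurableSet c)]
  rw [← measure_univ (μ := μ), ← lintegral_one]
  refine lintegral_congr_ae ?_
  filter_upwards [h.ae_zero] with ω h0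
  classical
  set l := Nat.findGreatest (fun c => ω ∈ A c) n with hl
  have hlm : ω ∈ A l := Nat.findGreatest_spec (P := fun c => ω ∈ A c) (Nat.zero_le n) h0
  have hln : l ≤ n := Nat.findGreatest_le n
  have hgt : ∀ c, l < c → c ≤ n → ω ∉ A c := fun c h1 h2 => Nat.findGreatest_is_greatest h1 h2
  rw [Finset.sum_eq_single l]
  · rw [Set.indicator_of_mem hlm, Set.indicator_of_mem]
    · simp
    · intro c h1 h2 hc
      exact hgt (l + c) (by omega) (by omega) ((h.mem_add l c ω hlm).2 hc)
  · intro c hc hcl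
    by_cases hcm : ω ∈ A c
    · rw [Set.indicator_of_mem hcm, Set.indicator_of_notMem]
      intro hn
      have hlt : c < l := by
        by_contra hge
        exact hgt c (by omega) (by simp at hc; omega) hcm
      refine hn (l - c) (by omega) (by omega) ((h.mem_add c _ ω hcm).1 ?_)
      rwa [Nat.add_sub_cancel' hlt.le]
    · rw [Set.indicator_of_notMem hcm]
  · intro hl'
    simp at hl'
    omega

/-- If regenerations have positive density in the mean, then cycles have finite mean. -/
theorem tsum_noReturn_ne_top (h : Regeneration μ A θ r) {δ : ℝ≥0∞} (hδ : δ ≠ 0)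
    (hu : ∀ᶠ n : ℕ in atTop, δ * n ≤ ∑ c ∈ Finset.range n, μ (A c)) :
    ∑' m, μ (noReturn A m) ≠ ∞ :=
  tsum_ne_top_of_convolution hδ h.sum_last_regeneration hu

theorem lintegral_firstReturn_ne_top {ρ : Measure E} (h : Regeneration ρ A θ r)
    (hr : ∑' m, ρ (noReturn A m) ≠ ∞) : ∫⁻ ω, (firstReturn A ω : ℝ≥0∞) ∂ρ ≠ ∞ := by
  rw [← CycleShift.sum_tail h.measurable_firstReturn]
  exact ne_top_of_le_ne_top hr
    (ENNReal.tsum_le_tsum fun m => measure_mono fun ω hω => mem_noReturn_of_lt hω)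

theorem ae_exists_return {ρ : Measure E} (hr : ∑' m, ρ (noReturn A m) ≠ ∞) :
    ∀ᵐ ω ∂ρ, ∃ l, 1 ≤ l ∧ ω ∈ A l := by
  rw [ae_iff]
  have h0 := ENNReal.tendsto_atTop_zero_of_tsum_ne_top hr
  refine le_antisymm (ge_of_tendsto h0 (Eventually.of_forall fun m => measure_mono ?_)) zero_le
  intro ω hω l h1 _ hl
  exact hω ⟨l, h1, hl⟩

/-- On the event that the first return is `k + 1`, the random shift is the fixed shift `θ (k + 1)`.
That event is determined by the path up to epoch `k + 1`, so independence at fixed epochs suffices;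
then sum over `k`. -/
theorem cycleShift {ρ : Measure E} (h : Regeneration ρ A θ r)
    (hret : ∀ᵐ ω ∂ρ, ∃ l, 1 ≤ l ∧ ω ∈ A l) :
    CycleShift ρ (returnShift A θ) (SameCycle A r) := by
  refine ⟨h.measurable_returnShift, fun f g hf hg hs => ?_⟩
  set B : ℕ → Set E := fun k => A (k + 1) ∩ noReturn A k with hB
  have hBm : ∀ k, MeasurableSet (B k) := fun k =>
    (h.measurableSet _).inter (h.measurableSet_noReturn _)
  have hBd : Pairwise (Function.onFun Disjoint B) := by
    intro a b hab
    refine Set.disjoint_left.2 fun ω ha hb => hab ?_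
    have h1 := firstReturn_eq ha.1 ha.2
    have h2 := firstReturn_eq hb.1 hb.2
    omega
  have hBu : (⋃ k, B k) =ᵐ[ρ] Set.univ := by
    rw [eventuallyEq_univ]
    filter_upwards [hret] with ω hω
    obtain ⟨h1, h2⟩ := firstReturn_spec hω
    obtain ⟨k, hk⟩ : ∃ k, firstReturn A ω = k + 1 := ⟨firstReturn A ω - 1, by omega⟩
    exact Set.mem_iUnion.2 ⟨k, hk ▸ h2, mem_noReturn_of_lt (by omega)⟩
  have hsplit : ∀ F : E → ℝ≥0∞, ∫⁻ ω, F ω ∂ρ = ∑' k, ∫⁻ ω in B k, F ω ∂ρ := by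
    intro F
    rw [← lintegral_iUnion hBm hBd, setLIntegral_congr hBu, setLIntegral_univ]
  rw [hsplit, hsplit f, ← ENNReal.tsum_mul_right]
  refine tsum_congr fun k => ?_
  have hin : ∀ F : E → ℝ≥0∞, ∫⁻ ω in B k, F ω ∂ρ
      = ∫⁻ ω in A (k + 1), (noReturn A k).indicator F ω ∂ρ := by
    intro F
    rw [lintegral_indicator (h.measurableSet_noReturn k), Measure.restrict_restrict
      (h.measurableSet_noReturn k), Set.inter_comm]
  rw [hin, hin f, ← h.lintegral_mul (k + 1) _ g (hf.indicator (h.measurableSet_noReturn k)) hg]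
  · refine setLIntegral_congr_fun (h.measurableSet _) fun ω hω => ?_
    by_cases hn : ω ∈ noReturn A k
    · simp only [Set.indicator_of_mem hn, returnShift, firstReturn_eq hω hn]
    · simp only [Set.indicator_of_notMem hn, zero_mul]
  · intro ω ω' hω hω' hr
    have hiff : ω ∈ noReturn A k ↔ ω' ∈ noReturn A k := by
      refine forall_congr' fun l => ?_
      refine imp_congr_right fun _ => ⟨fun hh hl => ?_, fun hh hl => ?_⟩
      · rw [← h.mem_congr (k + 1) l ω ω' hω hω' hr (by omega)]; exact hh hl
      · rw [h.mem_congr (k + 1) l ω ω' hω hω' hr (by omega)]; exact hh hl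
    by_cases hn : ω ∈ noReturn A k
    · have hn' := hiff.1 hn
      rw [Set.indicator_of_mem hn, Set.indicator_of_mem hn']
      have e1 := firstReturn_eq hω hn
      have e2 := firstReturn_eq hω' hn'
      exact hs ω ω' ⟨by rw [e1, e2], by omega, by rwa [e1], by rwa [e1], by rwa [e1]⟩
    · rw [Set.indicator_of_notMem hn, Set.indicator_of_notMem (mt hiff.2 hn)]

end Regeneration

/-! ### Sample-path properties of the two queues -/

namespace PAoI

theorem iInf_le_arrival {J : ℕ} (t : Fin J → ℕ → ℝ) (n : Fin J → ℕ) (i : Fin J) :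
    ⨅ j, t j (n j) ≤ t i (n i) := ciInf_le (Set.finite_range _).bddBelow i

theorem exists_iInf_eq {J : ℕ} [NeZero J] (t : Fin J → ℕ → ℝ) (n : Fin J → ℕ) :
    ∃ i, t i (n i) = ⨅ j, t j (n j) := by
  obtain ⟨i, hi⟩ := Finite.exists_min fun j => t j (n j)
  exact ⟨i, le_antisymm (le_ciInf hi) (iInf_le_arrival t n i)⟩

theorem le_iInf_arrival {J : ℕ} [NeZero J] {t : Fin J → ℕ → ℝ} {n : Fin J → ℕ} {a : ℝ}
    (h : ∀ i, a ≤ t i (n i)) :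
    a ≤ ⨅ j, t j (n j) := le_ciInf h

variable {J : ℕ} [NeZero J] {t t' : Fin J → ℕ → ℝ} {D : Fin J → ℝ} {z z' : Fin J → ℕ → ℝ}

theorem nextSource_mem (t : Fin J → ℕ → ℝ) (s : ProcState J) :
    t (nextSource t s) (s.served (nextSource t s)) ≤ nextBegin t s := by
  have hne : {j | t j (s.served j) ≤ nextBegin t s}.Nonempty := by
    obtain ⟨i, hi⟩ := exists_iInf_eq t s.served
    exact ⟨i, hi.le.trans (le_max_right _ _)⟩
  exact csInf_mem hne

theorem procState_succ_served (k : ℕ) (i : Fin J) : (procState t D (k + 1)).served i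
    = (procState t D k).served i + if i = procSource t D k then 1 else 0 := by
  change Function.update _ (procSource t D k) _ i = _
  rw [Function.update_apply]
  by_cases h : i = procSource t D k
  · rw [if_pos h, if_pos h, h]; rfl
  · rw [if_neg h, if_neg h]; rfl

theorem procState_succ_free (k : ℕ) : (procState t D (k + 1)).free = procEnd t D k := rfl

theorem free_le_procBegin (k : ℕ) : (procState t D k).free ≤ procBegin t D k := le_max_left _ _

theorem arrival_le_procBegin (k : ℕ) :
    t (procSource t D k) (procIndex t D k) ≤ procBegin t D k := nextSource_mem _ _

theorem procBegin_le_procEnd (hD : ∀ i, 0 ≤ D i) (k : ℕ) : procBegin t D k ≤ procEnd t D k :=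
  le_add_of_nonneg_right (hD _)

theorem free_mono (hD : ∀ i, 0 ≤ D i) : Monotone fun k => (procState t D k).free :=
  monotone_nat_of_le_succ fun k => (free_le_procBegin k).trans (procBegin_le_procEnd hD k)

theorem free_nonneg (hD : ∀ i, 0 ≤ D i) (k : ℕ) : 0 ≤ (procState t D k).free :=
  free_mono hD (Nat.zero_le k)

theorem procBegin_nonneg (hD : ∀ i, 0 ≤ D i) (k : ℕ) : 0 ≤ procBegin t D k :=
  (free_nonneg hD k).trans (free_le_procBegin k)

theorem served_mono (i : Fin J) : Monotone fun k => (procState t D k).served i :=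
  monotone_nat_of_le_succ fun k => by rw [procState_succ_served]; omega

theorem sum_served (k : ℕ) : ∑ i, (procState t D k).served i = k := by
  induction k with
  | zero => simp [procState]
  | succ k ih =>
    simp only [procState_succ_served, Finset.sum_add_distrib, ih]
    simp

theorem served_le (k : ℕ) (i : Fin J) : (procState t D k).served i ≤ k :=
  (Finset.single_le_sum (f := (procState t D k).served) (fun _ _ => Nat.zero_le _)
    (Finset.mem_univ i)).trans_eq (sum_served k)

theorem arrival_le_free (hD : ∀ i, 0 ≤ D i) {k m : ℕ} {i : Fin J}
    (h : m < (procState t D k).served i) : t i m ≤ (procState t D k).free := by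
  induction k with
  | zero => simp [procState] at h
  | succ k ih =>
    by_cases hm : m < (procState t D k).served i
    · exact (ih hm).trans (free_mono hD k.le_succ)
    · rw [procState_succ_served] at h
      split_ifs at h with hi
      · have hm' : m = (procState t D k).served i := by omega
        rw [hm', hi]
        exact (arrival_le_procBegin k).trans (procBegin_le_procEnd hD k)
      · omega

theorem procIndex_lt_served {k l : ℕ} (h : l < k) :
    procIndex t D l < (procState t D k).served (procSource t D l) := by
  refine lt_of_lt_of_le ?_ (served_mono _ (Nat.succ_le_of_lt h))
  change procIndex t D l < (procState t D (l + 1)).served (procSource t D l)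
  rw [procState_succ_served, if_pos rfl]
  exact Nat.lt_succ_self _

theorem exists_service {k n : ℕ} {j : Fin J} (h : n < (procState t D k).served j) :
    ∃ l < k, procSource t D l = j ∧ procIndex t D l = n := by
  induction k with
  | zero => simp [procState] at h
  | succ k ih =>
    by_cases hm : n < (procState t D k).served j
    · obtain ⟨l, hl, h'⟩ := ih hm
      exact ⟨l, by omega, h'⟩
    · rw [procState_succ_served] at h
      split_ifs at h with hj
      · refine ⟨k, by omega, hj.symm, ?_⟩
        rw [procIndex, ← hj]
        omega
      · omega

theorem service_unique {k l : ℕ} (hs : procSource t D k = procSource t D l)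
    (hi : procIndex t D k = procIndex t D l) : k = l := by
  rcases lt_trichotomy k l with h | h | h
  · have := procIndex_lt_served (t := t) (D := D) h
    rw [hs, hi] at this
    exact absurd this (lt_irrefl _)
  · exact h
  · have := procIndex_lt_served (t := t) (D := D) h
    rw [← hs, ← hi] at this
    exact absurd this (lt_irrefl _)

theorem rank_spec {j : Fin J} {n : ℕ} (h : ∃ k, n < (procState t D k).served j) :
    procSource t D (rank t D j n) = j ∧ procIndex t D (rank t D j n) = n := by
  obtain ⟨k, hk⟩ := h
  obtain ⟨l, -, hl⟩ := exists_service hk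
  exact Nat.sInf_mem (s := {k | procSource t D k = j ∧ procIndex t D k = n}) ⟨l, hl⟩

theorem rank_eq {j : Fin J} {n l : ℕ} (h1 : procSource t D l = j) (h2 : procIndex t D l = n) :
    rank t D j n = l := by
  have := Nat.sInf_mem (s := {k | procSource t D k = j ∧ procIndex t D k = n}) ⟨l, h1, h2⟩
  exact service_unique (this.1.trans h1.symm) (this.2.trans h2.symm)

theorem rank_lt {j : Fin J} {n k : ℕ} (h : n < (procState t D k).served j) :
    rank t D j n < k := by
  obtain ⟨l, hl, h1, h2⟩ := exists_service h
  rwa [rank_eq h1 h2]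

/-! #### Dependence on the packages served -/

/-- A candidate for service `l` is either among the first `k` services, where the paths agree, or
arrives on both paths after the processor is released, too late to affect the choice. -/
theorem next_congr {k l : ℕ} (hD : ∀ i, 0 ≤ D i) (hlk : l < k)
    (hag : ∀ i, ∀ m < (procState t D k).served i, t i m = t' i m)
    (hnx : ∀ i, (procState t D k).free < t i ((procState t D k).served i))
    (hnx' : ∀ i, (procState t D k).free < t' i ((procState t D k).served i)) :
    nextBegin t (procState t D l) = nextBegin t' (procState t D l) ∧
      nextSource t (procState t D l) = nextSource t' (procState t D l) := by
  have hb : nextBegin t (procState t D l) ≤ (procState t D k).free :=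
    (procBegin_le_procEnd hD l).trans (free_mono hD (Nat.succ_le_of_lt hlk))
  have hcase : ∀ i, t i ((procState t D l).served i) = t' i ((procState t D l).served i) ∨
      (nextBegin t (procState t D l) < t i ((procState t D l).served i) ∧
        nextBegin t (procState t D l) < t' i ((procState t D l).served i)) := by
    intro i
    rcases (served_mono (t := t) (D := D) i hlk.le).lt_or_eq with h | h
    · exact Or.inl (hag i _ h)
    · dsimp only at h
      rw [h]
      exact Or.inr ⟨hb.trans_lt (hnx i), hb.trans_lt (hnx' i)⟩
  have hinf : ⨅ j, t j ((procState t D l).served j) = ⨅ j, t' j ((procState t D l).served j) := by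
    have hib : ⨅ j, t j ((procState t D l).served j) ≤ nextBegin t (procState t D l) :=
      le_max_right _ _
    refine le_antisymm (le_iInf_arrival fun i => ?_) ?_
    · rcases hcase i with h | h
      · rw [← h]; exact iInf_le_arrival _ _ i
      · exact hib.trans h.2.le
    · obtain ⟨i, hi⟩ := exists_iInf_eq t (procState t D l).served
      rw [← hi]
      rcases hcase i with h | h
      · rw [h]; exact iInf_le_arrival _ _ i
      · exact absurd (hi ▸ h.1) (not_lt.2 hib)
  have hbeg : nextBegin t (procState t D l) = nextBegin t' (procState t D l) := by
    rw [nextBegin, nextBegin, hinf]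
  refine ⟨hbeg, ?_⟩
  have hset : {j | t j ((procState t D l).served j) ≤ nextBegin t (procState t D l)}
      = {j | t' j ((procState t D l).served j) ≤ nextBegin t' (procState t D l)} := by
    ext i
    rw [← hbeg]
    change t i _ ≤ _ ↔ t' i _ ≤ _
    rcases hcase i with h | h
    · rw [h]
    · exact iff_of_false (not_le.2 h.1) (not_le.2 h.2)
  rw [nextSource, nextSource, hset]

theorem procState_congr {k : ℕ} (hD : ∀ i, 0 ≤ D i)
    (hag : ∀ i, ∀ m < (procState t D k).served i, t i m = t' i m)
    (hnx : ∀ i, (procState t D k).free < t i ((procState t D k).served i))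
    (hnx' : ∀ i, (procState t D k).free < t' i ((procState t D k).served i)) {l : ℕ}
    (hl : l ≤ k) : procState t D l = procState t' D l := by
  induction l with
  | zero => rfl
  | succ l ih =>
    obtain ⟨h1, h2⟩ := next_congr hD (Nat.lt_of_succ_le hl) hag hnx hnx'
    change procStep t D (procState t D l) = procStep t' D (procState t' D l)
    rw [← ih (Nat.le_of_succ_le hl), procStep, procStep, h1, h2]

/-- Two sample paths with the same packages among the first `k` services, the processor being
empty after them. -/
structure SameServices (t t' : Fin J → ℕ → ℝ) (D : Fin J → ℝ) (k : ℕ) : Prop where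
  state : ∀ l ≤ k, procState t D l = procState t' D l
  source : ∀ l < k, procSource t D l = procSource t' D l
  begins : ∀ l < k, procBegin t D l = procBegin t' D l

theorem sameServices_of_agree {k : ℕ} (hD : ∀ i, 0 ≤ D i)
    (hag : ∀ i, ∀ m < (procState t D k).served i, t i m = t' i m)
    (hnx : ∀ i, (procState t D k).free < t i ((procState t D k).served i))
    (hnx' : ∀ i, (procState t D k).free < t' i ((procState t D k).served i)) :
    SameServices t t' D k where
  state _ hl := procState_congr hD hag hnx hnx' hl
  source l hl := by
    rw [procSource, procSource, ← procState_congr hD hag hnx hnx' hl.le]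
    exact (next_congr hD hl hag hnx hnx').2
  begins l hl := by
    rw [procBegin, procBegin, ← procState_congr hD hag hnx hnx' hl.le]
    exact (next_congr hD hl hag hnx hnx').1

theorem SameServices.symm {k : ℕ} (h : SameServices t t' D k) : SameServices t' t D k :=
  ⟨fun l hl => (h.state l hl).symm, fun l hl => (h.source l hl).symm,
    fun l hl => (h.begins l hl).symm⟩

/-- Each path is known to be empty only at its own release time. The path with the earlier release
is taken as reference, since the other one is then empty at that time too. -/
theorem sameServices_of_agree' {k : ℕ} (hD : ∀ i, 0 ≤ D i)
    (hse : (procState t D k).served = (procState t' D k).served)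
    (hag : ∀ i, ∀ m < (procState t D k).served i, t i m = t' i m)
    (hnx : ∀ i, (procState t D k).free < t i ((procState t D k).served i))
    (hnx' : ∀ i, (procState t' D k).free < t' i ((procState t' D k).served i)) :
    SameServices t t' D k := by
  rcases le_total (procState t D k).free (procState t' D k).free with h | h
  · exact sameServices_of_agree hD hag hnx fun i => h.trans_lt (hse ▸ hnx' i)
  · refine (sameServices_of_agree hD (fun i m hm => (hag i m (hse ▸ hm)).symm) hnx'
      fun i => h.trans_lt (hse ▸ hnx i)).symm

theorem SameServices.index {k l : ℕ} (h : SameServices t t' D k) (hl : l < k) :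
    procIndex t D l = procIndex t' D l := by
  rw [procIndex, procIndex, h.state l hl.le, h.source l hl]

theorem SameServices.ends {k l : ℕ} (h : SameServices t t' D k) (hl : l < k) :
    procEnd t D l = procEnd t' D l := by
  rw [procEnd, procEnd, h.begins l hl, h.source l hl]

theorem SameServices.transFree_eq {k l : ℕ} (h : SameServices t t' D k)
    (hz : ∀ i, ∀ m < (procState t D k).served i, z i m = z' i m) (hl : l ≤ k) :
    transFree t D z l = transFree t' D z' l := by
  induction l with
  | zero => rfl
  | succ l ih =>
    have hlk := Nat.lt_of_succ_le hl
    rw [transFree, transFree, transBeginAfter, transBeginAfter, ih hlk.le, h.ends hlk,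
      hz _ _ (procIndex_lt_served hlk), h.source l hlk, h.index hlk]

theorem SameServices.rank_eq {k n : ℕ} {j : Fin J} (h : SameServices t t' D k)
    (hn : n < (procState t D k).served j) : rank t D j n = rank t' D j n := by
  obtain ⟨l, hl, h1, h2⟩ := exists_service hn
  rw [PAoI.rank_eq h1 h2]
  exact (PAoI.rank_eq (by rw [← h.source l hl, h1]) (by rw [← h.index hl, h2])).symm

theorem SameServices.procWait_eq {k n : ℕ} {j : Fin J} (h : SameServices t t' D k)
    (hag : ∀ i, ∀ m < (procState t D k).served i, t i m = t' i m)
    (hn : n < (procState t D k).served j) : procWait t D j n = procWait t' D j n := by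
  rw [procWait, procWait, ← h.rank_eq hn, h.begins _ (rank_lt hn), hag j n hn]

theorem SameServices.transWait_eq {k n : ℕ} {j : Fin J} (h : SameServices t t' D k)
    (hz : ∀ i, ∀ m < (procState t D k).served i, z i m = z' i m)
    (hn : n < (procState t D k).served j) : transWait t D z j n = transWait t' D z' j n := by
  rw [transWait, transWait, ← h.rank_eq hn, transBeginAfter, transBeginAfter,
    h.ends (rank_lt hn), h.transFree_eq hz (rank_lt hn).le]

/-! #### Restarting the processor when it is empty -/

/-- `t'` is what remains of `t`, seen from the time `τ`, if the processor is empty after `k`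
services until time `τ`. -/
structure Restart (t t' : Fin J → ℕ → ℝ) (D : Fin J → ℝ) (k : ℕ) (τ : ℝ) : Prop where
  free_le : (procState t D k).free ≤ τ
  lt_arrival : ∀ i, τ < t i ((procState t D k).served i)
  shift : ∀ i m, t i ((procState t D k).served i + m) = τ + t' i m

namespace Restart

variable {k : ℕ} {τ : ℝ}

/-- The case `l = 0` is separate: the old processor may have been released before `τ` while the new
one starts free at `0`. This does not matter, since in both systems the next service waits for an
arrival. -/
theorem nextBegin_aux (h : Restart t t' D k τ) {l : ℕ}
    (hs : ∀ i, (procState t D (k + l)).served i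
      = (procState t D k).served i + (procState t' D l).served i)
    (hf : l = 0 ∨ (procState t D (k + l)).free = τ + (procState t' D l).free) :
    procBegin t D (k + l) = τ + procBegin t' D l ∧
      procSource t D (k + l) = procSource t' D l := by
  have hinf : ⨅ j, t j ((procState t D (k + l)).served j)
      = τ + ⨅ j, t' j ((procState t' D l).served j) := by
    simp only [hs, h.shift]
    exact ((OrderIso.addLeft τ).map_ciInf (Set.finite_range _).bddBelow).symm
  have hbeg : procBegin t D (k + l) = τ + procBegin t' D l := by
    rw [procBegin, procBegin, nextBegin, nextBegin, hinf]
    rcases hf with rfl | hf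
    · have h1 : 0 ≤ ⨅ j, t' j ((procState t' D 0).served j) := by
        refine le_iInf_arrival fun i => ?_
        have := h.shift i 0
        have := h.lt_arrival i
        simp only [procState, add_zero] at *
        linarith
      have h2 := h.free_le
      rw [max_eq_right, max_eq_right]
      · exact h1
      · rw [add_zero]; linarith
    · rw [hf, max_add_add_left]
  refine ⟨hbeg, ?_⟩
  rw [procBegin, procBegin] at hbeg
  rw [procSource, procSource, nextSource, nextSource, hbeg]
  congr 1
  ext i
  change t i _ ≤ _ ↔ t' i _ ≤ _
  rw [hs, h.shift]
  exact add_le_add_iff_left τ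

theorem state_aux (h : Restart t t' D k τ) (l : ℕ) :
    (∀ i, (procState t D (k + l)).served i
      = (procState t D k).served i + (procState t' D l).served i) ∧
    (l = 0 ∨ (procState t D (k + l)).free = τ + (procState t' D l).free) := by
  induction l with
  | zero => exact ⟨fun i => rfl, Or.inl rfl⟩
  | succ l ih =>
    obtain ⟨h1, h2⟩ := h.nextBegin_aux ih.1 ih.2
    refine ⟨fun i => ?_, Or.inr ?_⟩
    · rw [← add_assoc, procState_succ_served, procState_succ_served, ih.1, h2, add_assoc]
    · rw [← add_assoc, procState_succ_free, procState_succ_free, procEnd, procEnd, h1, h2,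
        add_assoc]

theorem served (h : Restart t t' D k τ) (l : ℕ) (i : Fin J) :
    (procState t D (k + l)).served i
      = (procState t D k).served i + (procState t' D l).served i := (h.state_aux l).1 i

theorem begins (h : Restart t t' D k τ) (l : ℕ) :
    procBegin t D (k + l) = τ + procBegin t' D l :=
  (h.nextBegin_aux (h.state_aux l).1 (h.state_aux l).2).1

theorem source (h : Restart t t' D k τ) (l : ℕ) :
    procSource t D (k + l) = procSource t' D l :=
  (h.nextBegin_aux (h.state_aux l).1 (h.state_aux l).2).2

theorem index (h : Restart t t' D k τ) (l : ℕ) :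
    procIndex t D (k + l)
      = (procState t D k).served (procSource t' D l) + procIndex t' D l := by
  rw [procIndex, procIndex, h.source, h.served]

theorem ends (h : Restart t t' D k τ) (l : ℕ) :
    procEnd t D (k + l) = τ + procEnd t' D l := by
  rw [procEnd, procEnd, h.begins, h.source, add_assoc]

theorem free (h : Restart t t' D k τ) (l : ℕ) :
    (procState t D (k + (l + 1))).free = τ + (procState t' D (l + 1)).free :=
  h.ends l

theorem rank_add (h : Restart t t' D k τ) {j : Fin J} {m : ℕ}
    (hm : ∃ l, m < (procState t' D l).served j) :
    rank t D j ((procState t D k).served j + m) = k + rank t' D j m := by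
  obtain ⟨h1, h2⟩ := rank_spec hm
  refine rank_eq (by rw [h.source, h1]) (by rw [h.index, h1, h2])

theorem procWait_add (h : Restart t t' D k τ) {j : Fin J} {m : ℕ}
    (hm : ∃ l, m < (procState t' D l).served j) :
    procWait t D j ((procState t D k).served j + m) = procWait t' D j m := by
  rw [procWait, procWait, h.rank_add hm, h.begins, h.shift]
  ring

theorem transBegin_add (h : Restart t t' D k τ) (hD : ∀ i, 0 ≤ D i)
    (hz : ∀ i m, z i ((procState t D k).served i + m) = z' i m)
    (hτ : transFree t D z k ≤ τ) (l : ℕ) :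
    transBeginAfter t D (transFree t D z (k + l)) (k + l)
      = τ + transBeginAfter t' D (transFree t' D z' l) l := by
  induction l with
  | zero =>
    have h1 := procBegin_nonneg (t := t') hD 0
    have h2 := procBegin_le_procEnd (t := t') hD 0
    rw [transBeginAfter, transBeginAfter, h.ends, transFree, max_eq_right, max_eq_right]
    · exact h1.trans h2
    · rw [add_zero]; linarith
  | succ l ih =>
    rw [transBeginAfter, transBeginAfter, ← add_assoc, transFree, transFree, ih, h.source,
      h.index, hz, add_assoc k l 1, h.ends, add_assoc, max_add_add_left]

theorem transFree_add (h : Restart t t' D k τ) (hD : ∀ i, 0 ≤ D i)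
    (hz : ∀ i m, z i ((procState t D k).served i + m) = z' i m)
    (hτ : transFree t D z k ≤ τ) (l : ℕ) :
    transFree t D z (k + (l + 1)) = τ + transFree t' D z' (l + 1) := by
  rw [← add_assoc, transFree, transFree, h.transBegin_add hD hz hτ, h.source, h.index, hz,
    add_assoc]

theorem transWait_add (h : Restart t t' D k τ) (hD : ∀ i, 0 ≤ D i)
    (hz : ∀ i m, z i ((procState t D k).served i + m) = z' i m)
    (hτ : transFree t D z k ≤ τ) {j : Fin J} {m : ℕ}
    (hm : ∃ l, m < (procState t' D l).served j) :
    transWait t D z j ((procState t D k).served j + m) = transWait t' D z' j m := by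
  rw [transWait, transWait, h.rank_add hm, h.transBegin_add hD hz hτ, h.ends]
  ring

/-- A max-plus bound for the effect of leftover work `V`: either the transmitter stays busy through
`V` and all new work, or it idles at some point, after which the leftover has no influence. -/
theorem transFree_le (h : Restart t t' D k τ)
    (hz : ∀ i m, z i ((procState t D k).served i + m) = z' i m) {V : ℝ}
    (hτ : transFree t D z k ≤ τ + V) (l : ℕ) :
    transFree t D z (k + l) ≤ τ + max (V + ∑ i ∈ Finset.range l,
      z' (procSource t' D i) (procIndex t' D i)) (transFree t' D z' l) := by
  induction l with
  | zero =>
    refine hτ.trans ?_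
    gcongr
    simp
  | succ l ih =>
    rw [← add_assoc, transFree, transFree, transBeginAfter, transBeginAfter, h.ends, h.source,
      h.index, hz, Finset.sum_range_succ, ← add_assoc V]
    rw [max_add_add_right, ← add_assoc]
    gcongr
    refine max_le (ih.trans ?_) ?_
    · gcongr
      exact le_max_left _ _
    · gcongr
      exact (le_max_right _ _).trans (le_max_right _ _)

end Restart

theorem transFree_nonneg_step (hz : ∀ i n, 0 ≤ z i n) (l : ℕ) :
    max (transFree t D z l) (procEnd t D l) ≤ transFree t D z (l + 1) :=
  le_add_of_nonneg_right (hz _ _)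

theorem free_le_transFree (hz : ∀ i n, 0 ≤ z i n) (l : ℕ) :
    (procState t D l).free ≤ transFree t D z l := by
  cases l with
  | zero => rfl
  | succ l => exact (le_max_right _ _).trans (transFree_nonneg_step hz l)

theorem transFree_mono (hz : ∀ i n, 0 ≤ z i n) : Monotone (transFree t D z) :=
  monotone_nat_of_le_succ fun l => (le_max_left _ _).trans (transFree_nonneg_step hz l)

theorem sum_trans_le_transFree (l : ℕ) :
    ∑ i ∈ Finset.range l, z (procSource t D i) (procIndex t D i) ≤ transFree t D z l := by
  induction l with
  | zero => simp [transFree]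
  | succ l ih =>
    rw [Finset.sum_range_succ, transFree]
    gcongr
    exact ih.trans (le_max_left _ _)

theorem transFree_le_free_add (hD : ∀ i, 0 ≤ D i) (hz : ∀ i n, 0 ≤ z i n) (l : ℕ) :
    transFree t D z l ≤ (procState t D l).free
      + ∑ i ∈ Finset.range l, z (procSource t D i) (procIndex t D i) := by
  induction l with
  | zero => simp [transFree, procState]
  | succ l ih =>
    rw [Finset.sum_range_succ, transFree, procState_succ_free, ← add_assoc]
    gcongr
    refine max_le (ih.trans ?_) (le_add_of_nonneg_right (Finset.sum_nonneg fun _ _ => hz _ _))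
    gcongr
    exact (free_le_procBegin l).trans (procBegin_le_procEnd hD l)

theorem sum_services_eq (f : Fin J → ℕ → ℝ) (k : ℕ) :
    ∑ l ∈ Finset.range k, f (procSource t D l) (procIndex t D l)
      = ∑ i, ∑ m ∈ Finset.range ((procState t D k).served i), f i m := by
  induction k with
  | zero => simp [procState]
  | succ k ih =>
    rw [Finset.sum_range_succ, ih]
    have : ∀ i, ∑ m ∈ Finset.range ((procState t D (k + 1)).served i), f i m
        = ∑ m ∈ Finset.range ((procState t D k).served i), f i m
          + if i = procSource t D k then f i ((procState t D k).served i) else 0 := by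
      intro i
      rw [procState_succ_served]
      split_ifs
      · rw [Finset.sum_range_succ]
      · simp
    simp only [this, Finset.sum_add_distrib]
    simp [procIndex]

/-- Elapsed time is idle time plus work done, the work being regrouped by source. -/
theorem free_eq_idle_add (k : ℕ) : (procState t D k).free
    = ∑ l ∈ Finset.range k, (procBegin t D l - (procState t D l).free)
      + ∑ i, (procState t D k).served i * D i := by
  have h := sum_services_eq (t := t) (D := D) (fun i _ => D i) k
  simp only [Finset.sum_const, Finset.card_range, nsmul_eq_mul] at h
  rw [← h, ← Finset.sum_add_distrib]
  induction k with
  | zero => simp [procState]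
  | succ k ih =>
    rw [Finset.sum_range_succ, ← ih (by simpa using sum_services_eq (fun i _ => D i) k),
      procState_succ_free, procEnd]
    ring

end PAoI

/-! ### The space of paths and measurability of the queues -/

namespace PAoI

/-- Interarrival times (left) and transmission times (right) of all packages. -/
abbrev Path (J : ℕ) : Type := (Fin J × ℕ) ⊕ (Fin J × ℕ) → ℝ

namespace Path

variable {J : ℕ}

/-- Arrival times along a path. -/
def arr (ω : Path J) : Fin J → ℕ → ℝ := arrival fun i n => ω (Sum.inl (i, n))

/-- Transmission times along a path, made nonnegative. -/
def trans (ω : Path J) (i : Fin J) (n : ℕ) : ℝ := max (ω (Sum.inr (i, n))) 0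

/-- The path seen from time `τ` after `n i` packages of each source `i`. -/
def shiftBy (n : Fin J → ℕ) (τ : ℝ) (ω : Path J) : Path J
  | Sum.inl (i, 0) => ω.arr i (n i) - τ
  | Sum.inl (i, m + 1) => ω (Sum.inl (i, n i + (m + 1)))
  | Sum.inr (i, m) => ω (Sum.inr (i, n i + m))

theorem trans_nonneg (ω : Path J) (i : Fin J) (n : ℕ) : 0 ≤ ω.trans i n := le_max_right _ _

theorem arr_shiftBy (n : Fin J → ℕ) (τ : ℝ) (ω : Path J) (i : Fin J) (m : ℕ) :
    ω.arr i (n i + m) = τ + (shiftBy n τ ω).arr i m := by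
  rw [arr, arrival, show n i + m + 1 = (n i + 1) + m by ring, Finset.sum_range_add, arr, arrival,
    Finset.sum_range_succ' _ m]
  have h : ∑ x ∈ Finset.range m, ω (Sum.inl (i, n i + 1 + x))
      = ∑ x ∈ Finset.range m, shiftBy n τ ω (Sum.inl (i, x + 1)) :=
    Finset.sum_congr rfl fun x _ => by rw [shiftBy, add_assoc, add_comm 1 x]
  rw [h]
  change _ = τ + (_ + ((∑ x ∈ Finset.range (n i + 1), ω (Sum.inl (i, x))) - τ))
  ring

theorem measurable_arr (i : Fin J) (m : ℕ) : Measurable fun ω : Path J => ω.arr i m :=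
  Finset.measurable_fun_sum (Finset.range (m + 1)) fun n _ =>
    measurable_pi_apply (Sum.inl (i, n) : (Fin J × ℕ) ⊕ (Fin J × ℕ))

theorem measurable_trans (i : Fin J) (m : ℕ) : Measurable fun ω : Path J => ω.trans i m :=
  (measurable_pi_apply _).max measurable_const

end Path

theorem measurable_comp_countable {E ι β : Type*} [MeasurableSpace E] [MeasurableSpace β]
    [MeasurableSpace ι] [Countable ι] [MeasurableSingletonClass ι] {f : ι → E → β} {c : E → ι}
    (hf : ∀ n, Measurable (f n)) (hc : Measurable c) : Measurable fun ω => f (c ω) ω := by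
  have : Measurable fun p : ι × E => f p.1 p.2 :=
    measurable_from_prod_countable_right fun n => by simpa using hf n
  exact this.comp (hc.prodMk measurable_id)

section Measurability

variable {J : ℕ} {D : Fin J → ℝ}

theorem measurable_nextBegin {n : Path J → Fin J → ℕ} {a : Path J → ℝ}
    (hn : ∀ i, Measurable fun ω => n ω i) (ha : Measurable a) :
    Measurable fun ω : Path J => nextBegin ω.arr ⟨n ω, a ω⟩ :=
  ha.max (Measurable.iInf fun j => measurable_comp_countable
    (fun m => Path.measurable_arr j m) (hn j))

theorem measurable_shift {n : Path J → Fin J → ℕ} {τ : Path J → ℝ}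
    (hn : ∀ i, Measurable fun ω => n ω i) (hτ : Measurable τ) :
    Measurable fun ω : Path J => Path.shiftBy (n ω) (τ ω) ω := by
  refine measurable_pi_lambda _ fun p => ?_
  rcases p with ⟨i, _ | m⟩ | ⟨i, m⟩
  · exact (measurable_comp_countable (fun m => Path.measurable_arr i m) (hn i)).sub hτ
  · exact measurable_comp_countable (f := fun l (ω : Path J) => ω (Sum.inl (i, l + (m + 1))))
      (fun l => measurable_pi_apply _) (hn i)
  · exact measurable_comp_countable (f := fun l (ω : Path J) => ω (Sum.inr (i, l + m)))
      (fun l => measurable_pi_apply _) (hn i)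

variable [NeZero J]

theorem nextSource_eq_iff (t : Fin J → ℕ → ℝ) (s : ProcState J) (i : Fin J) :
    nextSource t s = i ↔ t i (s.served i) ≤ nextBegin t s ∧
      ∀ l < i, nextBegin t s < t l (s.served l) := by
  constructor
  · rintro rfl
    refine ⟨nextSource_mem t s, fun l hl => ?_⟩
    by_contra hle
    exact absurd (csInf_le' (s := {j | t j (s.served j) ≤ nextBegin t s}) (not_lt.1 hle))
      (not_le.2 hl)
  · rintro ⟨h1, h2⟩
    refine le_antisymm (csInf_le' h1) ?_
    by_contra hlt
    exact absurd (nextSource_mem t s) (not_le.2 (h2 _ (not_le.1 hlt)))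

theorem measurable_nextSource {n : Path J → Fin J → ℕ} {a : Path J → ℝ}
    (hn : ∀ i, Measurable fun ω => n ω i) (ha : Measurable a) :
    Measurable fun ω : Path J => nextSource ω.arr ⟨n ω, a ω⟩ := by
  refine measurable_to_countable' fun i => ?_
  have hb := measurable_nextBegin hn ha
  have ht : ∀ l, Measurable fun ω : Path J => ω.arr l (n ω l) := fun l =>
    measurable_comp_countable (fun m => Path.measurable_arr l m) (hn l)
  have : (fun ω : Path J => nextSource ω.arr ⟨n ω, a ω⟩) ⁻¹' {i}
      = {ω | ω.arr i (n ω i) ≤ nextBegin ω.arr ⟨n ω, a ω⟩} ∩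
        ⋂ l, ⋂ (_ : l < i), {ω | nextBegin ω.arr ⟨n ω, a ω⟩ < ω.arr l (n ω l)} := by
    ext ω
    simp [nextSource_eq_iff]
  rw [this]
  exact (measurableSet_le (ht i) hb).inter
    (MeasurableSet.iInter fun l => MeasurableSet.iInter fun _ => measurableSet_lt hb (ht l))

theorem measurable_procState (k : ℕ) :
    (∀ i, Measurable fun ω : Path J => (procState ω.arr D k).served i) ∧
      Measurable fun ω : Path J => (procState ω.arr D k).free := by
  induction k with
  | zero => exact ⟨fun i => measurable_const, measurable_const⟩
  | succ k ih =>
    have hs : Measurable fun ω : Path J => procSource ω.arr D k := measurable_nextSource ih.1 ih.2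
    have hb : Measurable fun ω : Path J => procBegin ω.arr D k := measurable_nextBegin ih.1 ih.2
    refine ⟨fun i => ?_, ?_⟩
    · simp only [procState_succ_served]
      exact (ih.1 i).add (Measurable.ite (measurableSet_eq_fun measurable_const hs)
        measurable_const measurable_const)
    · exact hb.add ((measurable_of_countable D).comp hs)

theorem measurable_served (k : ℕ) (i : Fin J) :
    Measurable fun ω : Path J => (procState ω.arr D k).served i := (measurable_procState k).1 i

theorem measurable_free (k : ℕ) : Measurable fun ω : Path J => (procState ω.arr D k).free :=
  (measurable_procState k).2

theorem measurable_procSource (k : ℕ) : Measurable fun ω : Path J => procSource ω.arr D k :=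
  measurable_nextSource (measurable_procState k).1 (measurable_procState k).2

theorem measurable_procBegin (k : ℕ) : Measurable fun ω : Path J => procBegin ω.arr D k :=
  measurable_nextBegin (measurable_procState k).1 (measurable_procState k).2

theorem measurable_procEnd (k : ℕ) : Measurable fun ω : Path J => procEnd ω.arr D k :=
  measurable_free (k + 1)

theorem measurable_procIndex (k : ℕ) : Measurable fun ω : Path J => procIndex ω.arr D k :=
  measurable_comp_countable (fun i => measurable_served k i) (measurable_procSource k)

theorem measurable_serviceTrans (k : ℕ) : Measurable fun ω : Path J =>
    ω.trans (procSource ω.arr D k) (procIndex ω.arr D k) :=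
  measurable_comp_countable (f := fun (i : Fin J) (ω : Path J) => ω.trans i (procIndex ω.arr D k))
    (fun i => measurable_comp_countable (fun m => Path.measurable_trans i m)
      (measurable_procIndex k)) (measurable_procSource k)

theorem measurable_transFree (k : ℕ) :
    Measurable fun ω : Path J => transFree ω.arr D ω.trans k := by
  induction k with
  | zero => exact measurable_const
  | succ k ih => exact (ih.max (measurable_procEnd k)).add (measurable_serviceTrans k)

theorem measurable_arr_served (k : ℕ) (i : Fin J) :
    Measurable fun ω : Path J => ω.arr i ((procState ω.arr D k).served i) :=
  measurable_comp_countable (fun m => Path.measurable_arr i m) (measurable_served k i)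

theorem measurable_rank (j : Fin J) (n : ℕ) : Measurable fun ω : Path J => rank ω.arr D j n := by
  have hS : ∀ k, MeasurableSet {ω : Path J | procSource ω.arr D k = j ∧ procIndex ω.arr D k = n} :=
    fun k => (measurable_procSource k (measurableSet_singleton j)).inter
      (measurable_procIndex k (measurableSet_singleton n))
  refine measurable_to_countable' fun k => ?_
  have : (fun ω : Path J => rank ω.arr D j n) ⁻¹' {k}
      = {ω | procSource ω.arr D k = j ∧ procIndex ω.arr D k = n} ∪
        (if k = 0 then ⋂ l, {ω | procSource ω.arr D l = j ∧ procIndex ω.arr D l = n}ᶜ else ∅) := by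
    ext ω
    simp only [Set.mem_preimage, Set.mem_singleton_iff, Set.mem_union]
    constructor
    · intro hk
      by_cases hne : ∃ l, procSource ω.arr D l = j ∧ procIndex ω.arr D l = n
      · obtain ⟨l, h1, h2⟩ := hne
        rw [rank_eq h1 h2] at hk
        exact Or.inl (hk ▸ ⟨h1, h2⟩)
      · right
        have : rank ω.arr D j n = 0 := by
          rw [rank, Nat.sInf_eq_zero]
          right
          exact Set.eq_empty_of_forall_notMem fun l hl => hne ⟨l, hl⟩
        rw [if_pos (hk.symm.trans this)]
        exact Set.mem_iInter.2 fun l hl => hne ⟨l, hl⟩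
    · rintro (⟨h1, h2⟩ | h)
      · exact rank_eq h1 h2
      · split_ifs at h with h0
        · rw [h0, rank, Nat.sInf_eq_zero]
          right
          exact Set.eq_empty_of_forall_notMem fun l hl => Set.mem_iInter.1 h l hl
        · exact h.elim
  rw [this]
  refine (hS k).union ?_
  split_ifs
  · exact MeasurableSet.iInter fun l => (hS l).compl
  · exact MeasurableSet.empty

theorem measurable_procWait (j : Fin J) (n : ℕ) :
    Measurable fun ω : Path J => procWait ω.arr D j n :=
  (measurable_comp_countable (fun k => measurable_procBegin k) (measurable_rank j n)).sub
    (Path.measurable_arr j n)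

theorem measurable_transWait (j : Fin J) (n : ℕ) :
    Measurable fun ω : Path J => transWait ω.arr D ω.trans j n :=
  measurable_comp_countable (f := fun k (ω : Path J) =>
    transBeginAfter ω.arr D (transFree ω.arr D ω.trans k) k - procEnd ω.arr D k)
    (fun k => ((measurable_transFree k).max (measurable_procEnd k)).sub (measurable_procEnd k))
    (measurable_rank j n)

end Measurability

end PAoI

/-! ### Memorylessness -/

theorem expMeasure_memoryless {l c : ℝ} (hl : 0 < l) (hc : 0 ≤ c) {T : Set ℝ}
    (hT : MeasurableSet T) :
    expMeasure l (Set.Ioi c ∩ (fun x => x - c) ⁻¹' T)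
      = expMeasure l (Set.Ioi c) * expMeasure l T := by
  have hprob := isProbabilityMeasure_expMeasure hl
  have hpdf : Measurable (exponentialPDF l) := (measurable_exponentialPDFReal l).ennreal_ofReal
  have hwd : expMeasure l = volume.withDensity (exponentialPDF l) := rfl
  have key : ∀ S : Set ℝ, MeasurableSet S →
      expMeasure l (Set.Ioi c ∩ (fun x => x - c) ⁻¹' S)
        = ENNReal.ofReal (Real.exp (-(l * c))) * expMeasure l S := by
    intro S hS
    have hm : MeasurableSet (Set.Ioi c ∩ (fun x => x - c) ⁻¹' S) :=
      measurableSet_Ioi.inter ((measurable_id.sub_const c) hS)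
    rw [hwd, withDensity_apply _ hm, withDensity_apply _ hS,
      ← lintegral_const_mul _ hpdf, ← lintegral_indicator hm, ← lintegral_indicator hS,
      ← lintegral_add_right_eq_self _ c]
    refine lintegral_congr_ae ?_
    have h0 : ∀ᵐ y : ℝ, y ≠ 0 := by simp [ae_iff]
    filter_upwards [h0] with y hy
    have hiff : y + c ∈ Set.Ioi c ∩ (fun x => x - c) ⁻¹' S ↔ 0 < y ∧ y ∈ S := by
      simp
    by_cases hyS : y ∈ S
    · rw [Set.indicator_of_mem hyS]
      rcases lt_or_gt_of_ne hy with h | h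
      · rw [Set.indicator_of_notMem (fun hh => (hiff.1 hh).1.not_gt h),
          exponentialPDF_of_neg h, mul_zero]
      · rw [Set.indicator_of_mem (hiff.2 ⟨h, hyS⟩), exponentialPDF_of_nonneg (by linarith),
          exponentialPDF_of_nonneg h.le, ← ENNReal.ofReal_mul (Real.exp_nonneg _)]
        congr 1
        rw [mul_left_comm, ← Real.exp_add]
        ring_nf
    · rw [Set.indicator_of_notMem hyS, Set.indicator_of_notMem fun hh => hyS (hiff.1 hh).2]
  have huniv := key Set.univ MeasurableSet.univ
  rw [Set.preimage_univ, Set.inter_univ, measure_univ, mul_one] at huniv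
  rw [key T hT, huniv]

theorem expMeasure_Ioi_pos {l : ℝ} (hl : 0 < l) (c : ℝ) : expMeasure l (Set.Ioi c) ≠ 0 := by
  have hpdf : Measurable (exponentialPDF l) := (measurable_exponentialPDFReal l).ennreal_ofReal
  have hwd : expMeasure l = volume.withDensity (exponentialPDF l) := rfl
  intro h0
  rw [hwd, withDensity_apply _ measurableSet_Ioi, lintegral_eq_zero_iff hpdf,
    Filter.EventuallyEq, ae_restrict_iff' measurableSet_Ioi] at h0
  have h1 : volume (Set.Ioi (max c 0)) = 0 := by
    refine measure_mono_null (fun x hx => ?_) h0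
    simp only [Set.mem_Ioi, max_lt_iff, Set.mem_compl_iff] at hx ⊢
    intro hh
    have := hh hx.1
    rw [exponentialPDF, Pi.zero_apply, ENNReal.ofReal_eq_zero] at this
    exact absurd (exponentialPDFReal_pos hl hx.2) (not_lt.2 this)
  simp at h1

theorem expMeasure_Ioo_pos {l b : ℝ} (hl : 0 < l) (hb : 0 < b) :
    expMeasure l (Set.Ioo 0 b) ≠ 0 := by
  have hpdf : Measurable (exponentialPDF l) := (measurable_exponentialPDFReal l).ennreal_ofReal
  have hwd : expMeasure l = volume.withDensity (exponentialPDF l) := rfl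
  intro h0
  rw [hwd, withDensity_apply _ measurableSet_Ioo, lintegral_eq_zero_iff hpdf,
    Filter.EventuallyEq, ae_restrict_iff' measurableSet_Ioo] at h0
  have h1 : volume (Set.Ioo 0 b) = 0 := by
    refine measure_mono_null (fun x hx => ?_) h0
    simp only [Set.mem_compl_iff]
    intro hh
    have := hh hx
    rw [exponentialPDF, Pi.zero_apply, ENNReal.ofReal_eq_zero] at this
    exact absurd (exponentialPDFReal_pos hl hx.1) (not_lt.2 this)
  simp at h1
  linarith

theorem expMeasure_ae_pos {l : ℝ} : ∀ᵐ x ∂(expMeasure l), 0 < x := by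
  have hwd : expMeasure l = volume.withDensity (exponentialPDF l) := rfl
  have hpdf : Measurable (exponentialPDF l) := (measurable_exponentialPDFReal l).ennreal_ofReal
  rw [hwd, ae_withDensity_iff hpdf]
  have h0 : ∀ᵐ y : ℝ, y ≠ 0 := by simp [ae_iff]
  filter_upwards [h0] with y hy hne
  by_contra hle
  exact hne (exponentialPDF_of_neg (lt_of_le_of_ne (not_lt.1 hle) hy))

/-- `x` times the exponential density is `1 / l` times the Gamma density of shape `2`, which
integrates to `1`. -/
theorem lintegral_expMeasure {l : ℝ} (hl : 0 < l) :
    ∫⁻ x, ENNReal.ofReal x ∂(expMeasure l) = ENNReal.ofReal (1 / l) := by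
  have hwd : expMeasure l = volume.withDensity (exponentialPDF l) := rfl
  have hpdf : Measurable (exponentialPDF l) := (measurable_exponentialPDFReal l).ennreal_ofReal
  have hg : Measurable (gammaPDF 2 l) := (measurable_gammaPDFReal 2 l).ennreal_ofReal
  rw [hwd, lintegral_withDensity_eq_lintegral_mul _ hpdf ENNReal.measurable_ofReal]
  rw [← mul_one (ENNReal.ofReal (1 / l)), ← lintegral_gammaPDF_eq_one (a := 2) two_pos hl,
    ← lintegral_const_mul _ hg]
  refine lintegral_congr fun x => ?_
  rcases lt_or_ge x 0 with hx | hx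
  · simp [exponentialPDF_of_neg hx, gammaPDF_of_neg hx]
  · rw [Pi.mul_apply, exponentialPDF_of_nonneg hx, gammaPDF_of_nonneg hx,
      ← ENNReal.ofReal_mul (by positivity), ← ENNReal.ofReal_mul (by positivity)]
    congr 1
    rw [Real.Gamma_two]
    norm_num
    field_simp

/-! ### Infinite product measures -/

/-- Coordinatewise memorylessness lifts to the product: conditioning finitely many coordinates on
`cut` and applying `sub` restores the law. After normalization it suffices to compare finite boxes,
whose measures factor. -/
theorem infinitePi_restrict_map {ι : Type*} (law : ι → Measure ℝ)
    [∀ p, IsProbabilityMeasure (law p)]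
    (s₀ : Finset ι) (cut : ι → Set ℝ) (sub : ι → ℝ → ℝ) (hcut : ∀ p, MeasurableSet (cut p))
    (hsub : ∀ p, Measurable (sub p))
    (hmem : ∀ p ∉ s₀, ∀ T, MeasurableSet T → law p (sub p ⁻¹' T) = law p T)
    (h : ∀ p ∈ s₀, ∀ T, MeasurableSet T →
      law p (cut p ∩ sub p ⁻¹' T) = law p (cut p) * law p T)
    (hpos : Measure.infinitePi law (Set.pi s₀ cut) ≠ 0) :
    ((Measure.infinitePi law).restrict (Set.pi s₀ cut)).map (fun y p => sub p (y p))
      = Measure.infinitePi law (Set.pi s₀ cut) • Measure.infinitePi law := by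
  classical
  have hm : Measurable fun (y : ι → ℝ) p => sub p (y p) :=
    measurable_pi_lambda _ fun p => (hsub p).comp (measurable_pi_apply p)
  have hS : MeasurableSet (Set.pi (s₀ : Set ι) cut) :=
    MeasurableSet.pi s₀.countable_toSet fun p _ => hcut p
  have ht := measure_ne_top (Measure.infinitePi law) (Set.pi s₀ cut)
  have key : (Measure.infinitePi law (Set.pi s₀ cut))⁻¹ •
      ((Measure.infinitePi law).restrict (Set.pi s₀ cut)).map (fun y p => sub p (y p))
      = Measure.infinitePi law := by
    refine Measure.eq_infinitePi _ fun s t htm => ?_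
    have hst : MeasurableSet (Set.pi (s : Set ι) t) :=
      MeasurableSet.pi s.countable_toSet fun p _ => htm p
    rw [Measure.smul_apply, Measure.map_apply hm hst, Measure.restrict_apply (hm hst)]
    have hset : (fun (y : ι → ℝ) p => sub p (y p)) ⁻¹' Set.pi (s : Set ι) t ∩ Set.pi s₀ cut
        = Set.pi ((s ∪ s₀ : Finset ι) : Set ι) fun p =>
          (if p ∈ s₀ then cut p else Set.univ) ∩ (if p ∈ s then sub p ⁻¹' t p else Set.univ) := by
      ext y
      simp only [Set.mem_inter_iff, Set.mem_preimage, Set.mem_pi, Finset.coe_union, Set.mem_union,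
        Finset.mem_coe]
      constructor
      · rintro ⟨h1, h2⟩ p -
        constructor
        · split_ifs with hp
          · exact h2 p hp
          · trivial
        · split_ifs with hp
          · exact h1 p hp
          · trivial
      · intro hh
        refine ⟨fun p hp => ?_, fun p hp => ?_⟩
        · simpa [hp] using (hh p (Or.inl hp)).2
        · simpa [hp] using (hh p (Or.inr hp)).1
    rw [hset, Measure.infinitePi_pi (s := s ∪ s₀) _ fun p _ => ?_]
    · have hfac : ∀ p, law p ((if p ∈ s₀ then cut p else Set.univ) ∩
          (if p ∈ s then sub p ⁻¹' t p else Set.univ))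
          = (if p ∈ s₀ then law p (cut p) else 1) * (if p ∈ s then law p (t p) else 1) := by
        intro p
        split_ifs with h1 h2 h2
        · exact h p h1 _ (htm p)
        · simp
        · rw [Set.univ_inter, hmem p h1 _ (htm p), one_mul]
        · simp
      rw [Finset.prod_congr rfl fun p _ => hfac p, Finset.prod_mul_distrib, Finset.prod_ite_mem,
        Finset.prod_ite_mem,
        Finset.union_inter_cancel_right, Finset.union_inter_cancel_left,
        Measure.infinitePi_pi _ fun p _ => hcut p, smul_eq_mul, ← mul_assoc]
      rw [Measure.infinitePi_pi _ fun p _ => hcut p] at hpos ht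
      rw [ENNReal.inv_mul_cancel hpos ht, one_mul]
    · refine MeasurableSet.inter ?_ ?_
      · split_ifs
        exacts [hcut p, MeasurableSet.univ]
      · split_ifs
        exacts [hsub p (htm p), MeasurableSet.univ]
  have h1 := congrArg (fun m => Measure.infinitePi law (Set.pi s₀ cut) • m) key
  simpa only [smul_smul, ENNReal.mul_inv_cancel hpos ht, one_smul] using h1

/-! ### The law of a path, and resampling after a fixed head -/

namespace PAoI

variable {J : ℕ}

/-- Law of each coordinate of a path. -/
noncomputable def marginal (lam : Fin J → ℝ) (ν : Fin J → Measure ℝ) :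
    (Fin J × ℕ) ⊕ (Fin J × ℕ) → Measure ℝ :=
  Sum.elim (fun p => expMeasure (lam p.1)) (fun p => ν p.1)

/-- Law of a path with independent coordinates. -/
noncomputable def pathLaw (lam : Fin J → ℝ) (ν : Fin J → Measure ℝ)
    [∀ p, IsProbabilityMeasure (marginal lam ν p)] : Measure (Path J) :=
  Measure.infinitePi (marginal lam ν)

variable {lam : Fin J → ℝ} {ν : Fin J → Measure ℝ} [∀ p, IsProbabilityMeasure (marginal lam ν p)]

instance : IsProbabilityMeasure (pathLaw lam ν) := by unfold pathLaw; infer_instance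

/-- The first `n i` packages of each source `i` from one path, the others from a second path. -/
def glue (n : Fin J → ℕ) (h y : Path J) : Path J
  | Sum.inl (i, m) => if m < n i then h (Sum.inl (i, m)) else y (Sum.inl (i, m - n i))
  | Sum.inr (i, m) => if m < n i then h (Sum.inr (i, m)) else y (Sum.inr (i, m - n i))

theorem measurable_glue (n : Fin J → ℕ) : Measurable fun p : Path J × Path J => glue n p.1 p.2 := by
  refine measurable_pi_lambda _ fun p => ?_
  rcases p with ⟨i, m⟩ | ⟨i, m⟩ <;> simp only [glue] <;> split_ifs <;>
    first
    | exact (measurable_pi_apply _).comp measurable_fst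
    | exact (measurable_pi_apply _).comp measurable_snd

/-- Replacing all later packages by an independent copy only relabels independent coordinates, with
equal laws within each source. This makes it possible to integrate over the future with the head
frozen. -/
theorem map_glue (n : Fin J → ℕ) :
    ((pathLaw lam ν).prod (pathLaw lam ν)).map (fun p => glue n p.1 p.2) = pathLaw lam ν := by
  classical
  let src : (Fin J × ℕ) ⊕ (Fin J × ℕ) → Fin J × ℕ := Sum.elim id id
  let up : (Fin J × ℕ) ⊕ (Fin J × ℕ) → (Fin J × ℕ) ⊕ (Fin J × ℕ) :=
    Sum.map (fun q => (q.1, n q.1 + q.2)) (fun q => (q.1, n q.1 + q.2))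
  let down : (Fin J × ℕ) ⊕ (Fin J × ℕ) → (Fin J × ℕ) ⊕ (Fin J × ℕ) :=
    Sum.map (fun q => (q.1, q.2 - n q.1)) (fun q => (q.1, q.2 - n q.1))
  have hglue : ∀ h y p, glue n h y p = if (src p).2 < n (src p).1 then h p else y (down p) := by
    rintro h y (⟨i, m⟩ | ⟨i, m⟩) <;> rfl
  have hud : ∀ p, ¬ (src p).2 < n (src p).1 → up (down p) = p := by
    rintro (⟨i, m⟩ | ⟨i, m⟩) hp <;> simp [src, up, down] at hp ⊢ <;> omega
  have hlaw : ∀ p, marginal lam ν (up p) = marginal lam ν p := by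
    rintro (⟨i, m⟩ | ⟨i, m⟩) <;> rfl
  refine Measure.eq_infinitePi _ fun s t ht => ?_
  have hst : MeasurableSet (Set.pi (s : Set _) t) :=
    MeasurableSet.pi s.countable_toSet fun p _ => ht p
  rw [Measure.map_apply (measurable_glue n) hst]
  set s1 := s.filter fun p => (src p).2 < n (src p).1 with hs1
  set s2 := s.filter fun p => ¬ (src p).2 < n (src p).1 with hs2
  have hset : (fun p : Path J × Path J => glue n p.1 p.2) ⁻¹' Set.pi (s : Set _) t
      = Set.pi (s1 : Set _) t ×ˢ Set.pi ((s2.image down : Finset _) : Set _) (t ∘ up) := by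
    ext ⟨h, y⟩
    simp only [Set.mem_preimage, Set.mem_pi, Set.mem_prod, Finset.mem_coe, hs1, hs2,
      Finset.mem_filter, Finset.mem_image, Function.comp_apply, hglue]
    constructor
    · intro hh
      refine ⟨fun p hp => ?_, ?_⟩
      · have := hh p hp.1
        rwa [if_pos hp.2] at this
      · rintro _ ⟨p, ⟨hp1, hp2⟩, rfl⟩
        have := hh p hp1
        rw [if_neg hp2] at this
        rwa [hud p hp2]
    · rintro ⟨h1, h2⟩ p hp
      by_cases hlt : (src p).2 < n (src p).1
      · rw [if_pos hlt]; exact h1 p ⟨hp, hlt⟩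
      · rw [if_neg hlt]
        have := h2 (down p) ⟨p, ⟨hp, hlt⟩, rfl⟩
        rwa [hud p hlt] at this
  rw [hset, Measure.prod_prod, pathLaw, Measure.infinitePi_pi _ fun p _ => ht p,
    Measure.infinitePi_pi (t := t ∘ up) _ fun p _ => ht (up p), Finset.prod_image]
  · rw [← Finset.prod_filter_mul_prod_filter_not s fun p => (src p).2 < n (src p).1]
    congr 1
    refine Finset.prod_congr rfl fun p hp => ?_
    have := hud p (Finset.mem_filter.1 hp).2
    rw [Function.comp_apply, this, ← hlaw (down p), this]
  · intro p hp q hq hpq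
    rw [← hud p (Finset.mem_filter.1 hp).2, ← hud q (Finset.mem_filter.1 hq).2, hpq]

theorem lintegral_glue (n : Fin J → ℕ) {f : Path J → ℝ≥0∞} (hf : Measurable f) :
    ∫⁻ ω, f ω ∂(pathLaw lam ν)
      = ∫⁻ h, ∫⁻ y, f (glue n h y) ∂(pathLaw lam ν) ∂(pathLaw lam ν) := by
  conv_lhs => rw [← map_glue (lam := lam) (ν := ν) n]
  rw [lintegral_map hf (measurable_glue n),
    lintegral_prod (fun p => f (glue n p.1 p.2)) (hf.comp (measurable_glue n)).aemeasurable]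

/-- Subtract `c i` from the first interarrival time of each source `i`. -/
def advance (c : Fin J → ℝ) (y : Path J) : Path J
  | Sum.inl (i, 0) => y (Sum.inl (i, 0)) - c i
  | Sum.inl (i, m + 1) => y (Sum.inl (i, m + 1))
  | Sum.inr p => y (Sum.inr p)

/-- Memorylessness of all sources at once, for a deterministic vector of elapsed times. -/
theorem lintegral_advance (hlam : ∀ i, 0 < lam i) {c : Fin J → ℝ} (hc : ∀ i, 0 ≤ c i)
    {g : Path J → ℝ≥0∞} (hg : Measurable g) :
    ∫⁻ y in {y : Path J | ∀ i, c i < y (Sum.inl (i, 0))}, g (advance c y) ∂(pathLaw lam ν)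
      = pathLaw lam ν {y : Path J | ∀ i, c i < y (Sum.inl (i, 0))} *
        ∫⁻ y, g y ∂(pathLaw lam ν) := by
  classical
  let s₀ : Finset ((Fin J × ℕ) ⊕ (Fin J × ℕ)) := Finset.univ.image fun i => Sum.inl (i, 0)
  let cut : (Fin J × ℕ) ⊕ (Fin J × ℕ) → Set ℝ := Sum.elim (fun q => Set.Ioi (c q.1))
    fun _ => Set.univ
  let sub : (Fin J × ℕ) ⊕ (Fin J × ℕ) → ℝ → ℝ := fun p x => match p with
    | Sum.inl (i, 0) => x - c i
    | Sum.inl (_, _ + 1) => x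
    | Sum.inr _ => x
  have hset : {y : Path J | ∀ i, c i < y (Sum.inl (i, 0))} = Set.pi (s₀ : Set _) cut := by
    ext y
    simp [s₀, cut, Set.mem_pi]
  have hadv : advance c = fun (y : Path J) p => sub p (y p) := by
    funext y p
    rcases p with ⟨i, _ | m⟩ | p <;> rfl
  have hcut : ∀ p, MeasurableSet (cut p) := by
    rintro (p | p)
    exacts [measurableSet_Ioi, MeasurableSet.univ]
  have hsub : ∀ p, Measurable (sub p) := by
    rintro (⟨i, _ | m⟩ | p)
    exacts [measurable_id.sub_const _, measurable_id, measurable_id]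
  have hpos : Measure.infinitePi (marginal lam ν) (Set.pi s₀ cut) ≠ 0 := by
    rw [Measure.infinitePi_pi _ fun p _ => hcut p, Finset.prod_ne_zero_iff]
    intro p hp
    simp only [s₀, Finset.mem_image, Finset.mem_univ, true_and] at hp
    obtain ⟨i, rfl⟩ := hp
    exact expMeasure_Ioi_pos (hlam i) _
  have hm : Measurable fun (y : Path J) p => sub p (y p) :=
    measurable_pi_lambda _ fun p => (hsub p).comp (measurable_pi_apply p)
  have key := infinitePi_restrict_map (marginal lam ν) s₀ cut sub hcut hsub (by
      rintro (⟨i, _ | m⟩ | p) hp T hT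
      · simp [s₀] at hp
      · rfl
      · rfl)
    (by
      intro p hp T hT
      simp only [s₀, Finset.mem_image, Finset.mem_univ, true_and] at hp
      obtain ⟨i, rfl⟩ := hp
      exact expMeasure_memoryless (hlam i) (hc i) hT) hpos
  rw [hset, hadv, pathLaw, ← lintegral_map hg hm, key, lintegral_smul_measure, smul_eq_mul]

end PAoI

/-! ### Regeneration when the system is empty -/

namespace PAoI

variable {J : ℕ}

theorem arr_congr {ω ω' : Path J} {n : Fin J → ℕ}
    (h : ∀ i, ∀ m < n i, ω (Sum.inl (i, m)) = ω' (Sum.inl (i, m))) (i : Fin J) (m : ℕ)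
    (hm : m < n i) : ω.arr i m = ω'.arr i m :=
  Finset.sum_congr (s₁ := Finset.range (m + 1)) rfl fun l hl =>
    h i l ((Nat.lt_succ_iff.1 (Finset.mem_range.1 hl)).trans_lt hm)

theorem arr_glue (n : Fin J → ℕ) (h y : Path J) (i : Fin J) :
    (glue n h y).arr i (n i)
      = ∑ m ∈ Finset.range (n i), h (Sum.inl (i, m)) + y (Sum.inl (i, 0)) := by
  rw [Path.arr, arrival, Finset.sum_range_succ]
  congr 1
  · refine Finset.sum_congr rfl fun m hm => ?_
    simp only [glue, Finset.mem_range.1 hm, if_true]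
  · simp [glue]

theorem shiftBy_glue (n : Fin J → ℕ) (h y : Path J) (s : ℝ) :
    Path.shiftBy n s (glue n h y)
      = advance (fun i => s - ∑ m ∈ Finset.range (n i), h (Sum.inl (i, m))) y := by
  funext p
  rcases p with ⟨i, _ | m⟩ | ⟨i, m⟩
  · simp only [Path.shiftBy, advance, arr_glue]
    ring
  · simp only [Path.shiftBy, advance, glue]
    rw [if_neg (by omega), Nat.add_sub_cancel_left]
  · simp only [Path.shiftBy, advance, glue]
    rw [if_neg (by omega), Nat.add_sub_cancel_left]

theorem glue_agree (n : Fin J → ℕ) (h y y' : Path J) (i : Fin J) (m : ℕ) (hm : m < n i) :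
    glue n h y (Sum.inl (i, m)) = glue n h y' (Sum.inl (i, m)) ∧
      glue n h y (Sum.inr (i, m)) = glue n h y' (Sum.inr (i, m)) := by
  simp [glue, hm]

variable {lam : Fin J → ℝ} {ν : Fin J → Measure ℝ} [∀ p, IsProbabilityMeasure (marginal lam ν p)]

theorem ae_inl_pos : ∀ᵐ ω ∂(pathLaw lam ν), ∀ (i : Fin J) (m : ℕ), 0 < ω (Sum.inl (i, m)) := by
  rw [ae_all_iff]
  intro i
  rw [ae_all_iff]
  intro m
  have h := measurePreserving_eval_infinitePi (marginal lam ν) (Sum.inl (i, m))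
  exact h.quasiMeasurePreserving.ae (expMeasure_ae_pos (l := lam i))

variable [NeZero J] {D : Fin J → ℝ} {τ : ℕ → Path J → ℝ}

/-- The two paths agree on all packages among the first `k` services. -/
noncomputable def SameHead (D : Fin J → ℝ) (k : ℕ) (ω ω' : Path J) : Prop :=
  (procState ω.arr D k).served = (procState ω'.arr D k).served ∧
    ∀ i, ∀ m < (procState ω.arr D k).served i,
      ω (Sum.inl (i, m)) = ω' (Sum.inl (i, m)) ∧ ω (Sum.inr (i, m)) = ω' (Sum.inr (i, m))

/-- After `k` services no package arrives up to the time `τ k`. -/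
noncomputable def emptyAt (D : Fin J → ℝ) (τ : ℕ → Path J → ℝ) (k : ℕ) : Set (Path J) :=
  {ω | ∀ i, τ k ω < ω.arr i ((procState ω.arr D k).served i)}

/-- What remains of the path after `k` services, seen from the time `τ k`. -/
noncomputable def after (D : Fin J → ℝ) (τ : ℕ → Path J → ℝ) (k : ℕ) (ω : Path J) : Path J :=
  Path.shiftBy (procState ω.arr D k).served (τ k ω) ω

/-- A time attached to each number of services, from which the system can restart. -/
structure IsClock (D : Fin J → ℝ) (τ : ℕ → Path J → ℝ) : Prop where
  measurable : ∀ k, Measurable (τ k)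
  zero : ∀ ω, τ 0 ω = 0
  free_le : ∀ k (ω : Path J), (procState ω.arr D k).free ≤ τ k ω
  mono : ∀ ω, Monotone fun k => τ k ω
  congr : ∀ k (ω ω' : Path J), SameServices ω.arr ω'.arr D k →
    (∀ i, ∀ m < (procState ω.arr D k).served i, ω.trans i m = ω'.trans i m) →
    ∀ l ≤ k, τ l ω = τ l ω'
  add : ∀ k l ω, ω ∈ emptyAt D τ k → τ (k + (l + 1)) ω = τ k ω + τ (l + 1) (after D τ k ω)

namespace IsClock

theorem restart (hτ : IsClock D τ) {k : ℕ} {ω : Path J} (h : ω ∈ emptyAt D τ k) :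
    Restart ω.arr (after D τ k ω).arr D k (τ k ω) :=
  ⟨hτ.free_le k ω, h, fun _ _ => Path.arr_shiftBy _ _ _ _ _⟩

theorem sameServices (hD : ∀ i, 0 ≤ D i) (hτ : IsClock D τ) {k : ℕ} {ω ω' : Path J}
    (hω : ω ∈ emptyAt D τ k) (hω' : ω' ∈ emptyAt D τ k) (h : SameHead D k ω ω') :
    SameServices ω.arr ω'.arr D k :=
  sameServices_of_agree' hD h.1 (arr_congr fun i m hm => (h.2 i m hm).1)
    (fun i => (hτ.free_le k ω).trans_lt (hω i)) fun i => (hτ.free_le k ω').trans_lt (hω' i)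

theorem trans_eq {k : ℕ} {ω ω' : Path J} (h : SameHead D k ω ω') (i : Fin J) (m : ℕ)
    (hm : m < (procState ω.arr D k).served i) : ω.trans i m = ω'.trans i m := by
  rw [Path.trans, Path.trans, (h.2 i m hm).2]

theorem measurableSet_emptyAt (hτ : IsClock D τ) (k : ℕ) : MeasurableSet (emptyAt D τ k) := by
  have : emptyAt D τ k = ⋂ i, {ω | τ k ω < ω.arr i ((procState ω.arr D k).served i)} := by
    ext ω; simp [emptyAt]
  rw [this]
  exact MeasurableSet.iInter fun i => measurableSet_lt (hτ.measurable k) (measurable_arr_served k i)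

theorem measurable_after (hτ : IsClock D τ) (k : ℕ) : Measurable (after D τ k) :=
  measurable_shift (measurable_served k) (hτ.measurable k)

theorem mem_emptyAt_add (hτ : IsClock D τ) {k : ℕ} (l : ℕ) {ω : Path J}
    (h : ω ∈ emptyAt D τ k) : ω ∈ emptyAt D τ (k + l) ↔ after D τ k ω ∈ emptyAt D τ l := by
  have hτl : τ (k + l) ω = τ k ω + τ l (after D τ k ω) := by
    cases l with
    | zero => rw [hτ.zero, add_zero, add_zero]
    | succ l => exact hτ.add k l ω h
  refine forall_congr' fun i => ?_
  rw [hτl, (hτ.restart h).served, (hτ.restart h).shift]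
  exact add_lt_add_iff_left _

/-- If source `i` has no further service between epochs `l` and `k`, its next package lies beyond
the head. The condition at `l` then follows on both paths from emptiness at `k` and monotonicity of
the clock. -/
theorem emptyAt_congr (hD : ∀ i, 0 ≤ D i) (hτ : IsClock D τ) {k l : ℕ} {ω ω' : Path J}
    (hω : ω ∈ emptyAt D τ k) (hω' : ω' ∈ emptyAt D τ k) (h : SameHead D k ω ω') (hl : l ≤ k) :
    ω ∈ emptyAt D τ l ↔ ω' ∈ emptyAt D τ l := by
  have hs := hτ.sameServices hD hω hω' h
  have hτk := hτ.congr k ω ω' hs (trans_eq h) k le_rfl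
  refine forall_congr' fun i => ?_
  rw [← hτ.congr k ω ω' hs (trans_eq h) l hl, ← hs.state l hl]
  rcases (served_mono (t := ω.arr) (D := D) i hl).lt_or_eq with hlt | heq
  · rw [arr_congr (fun i m hm => (h.2 i m hm).1) i _ hlt]
  · dsimp only at heq
    rw [heq]
    refine iff_of_true ((hτ.mono ω hl).trans_lt (hω i)) ((hτ.mono ω hl).trans_lt ?_)
    have := hω' i
    rwa [← h.1, ← hτk] at this

end IsClock

/-- If one continuation of the head `h` leaves the system empty after serving `n`, the clock is a
function of the head alone. For any other continuation, the event only asks the next interarrival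
times to exceed the thresholds already elapsed. -/
theorem emptyAt_glue_iff (hD : ∀ i, 0 ≤ D i) (hτ : IsClock D τ) {k : ℕ} {n : Fin J → ℕ}
    {h y₀ : Path J} (h₀ : glue n h y₀ ∈ emptyAt D τ k)
    (hn₀ : (procState (glue n h y₀).arr D k).served = n) (y : Path J) :
    (glue n h y ∈ emptyAt D τ k ∧ (procState (glue n h y).arr D k).served = n) ↔
      ∀ i, τ k (glue n h y₀) - ∑ m ∈ Finset.range (n i), h (Sum.inl (i, m))
        < y (Sum.inl (i, 0)) := by
  have hag : ∀ i, ∀ m < (procState (glue n h y₀).arr D k).served i,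
      (glue n h y₀).arr i m = (glue n h y).arr i m := by
    rw [hn₀]
    exact arr_congr fun i m hm => (glue_agree n h y₀ y i m hm).1
  have htr : ∀ i, ∀ m < (procState (glue n h y₀).arr D k).served i,
      (glue n h y₀).trans i m = (glue n h y).trans i m := by
    rw [hn₀]
    intro i m hm
    rw [Path.trans, Path.trans, (glue_agree n h y₀ y i m hm).2]
  constructor
  · rintro ⟨h1, h2⟩ i
    have hs := hτ.sameServices hD h₀ h1 ⟨by rw [hn₀, h2], by
      rw [hn₀]; exact fun i m hm => glue_agree n h y₀ y i m hm⟩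
    have h3 := h1 i
    rw [h2, arr_glue, ← hτ.congr k _ _ hs htr k le_rfl] at h3
    linarith
  · intro hh
    have h4 : ∀ i, τ k (glue n h y₀) < (glue n h y).arr i (n i) := fun i => by
      rw [arr_glue]
      have := hh i
      linarith
    have hs : SameServices (glue n h y₀).arr (glue n h y).arr D k := by
      refine sameServices_of_agree hD hag (fun i => (hτ.free_le k _).trans_lt (h₀ i)) fun i => ?_
      rw [hn₀]
      exact (hτ.free_le k _).trans_lt (h4 i)
    have hst := hs.state k le_rfl
    have hse : (procState (glue n h y).arr D k).served = n := by rw [← hst, hn₀]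
    refine ⟨fun i => ?_, hse⟩
    rw [hse, ← hτ.congr k _ _ hs htr k le_rfl]
    exact h4 i

/-- Split by the vector `n` of packages served and freeze the head. Then `f` is constant, the event
is a box in the next interarrival times, and the path after it is `advance c` of the continuation,
so memorylessness factors the inner integral. -/
theorem IsClock.lintegral_mul (hlam : ∀ i, 0 < lam i) (hD : ∀ i, 0 ≤ D i) (hτ : IsClock D τ)
    (k : ℕ) {f g : Path J → ℝ≥0∞} (hf : Measurable f) (hg : Measurable g)
    (hfd : ∀ ω ω', ω ∈ emptyAt D τ k → ω' ∈ emptyAt D τ k → SameHead D k ω ω' → f ω = f ω') :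
    ∫⁻ ω in emptyAt D τ k, f ω * g (after D τ k ω) ∂(pathLaw lam ν)
      = (∫⁻ ω in emptyAt D τ k, f ω ∂(pathLaw lam ν)) * ∫⁻ ω, g ω ∂(pathLaw lam ν) := by
  classical
  set A : (Fin J → ℕ) → Set (Path J) := fun n =>
    emptyAt D τ k ∩ {ω | (procState ω.arr D k).served = n} with hA
  have hAm : ∀ n, MeasurableSet (A n) := fun n => (hτ.measurableSet_emptyAt k).inter
    ((measurable_pi_lambda _ (measurable_served k)) (measurableSet_singleton n))
  have hAd : Pairwise (Function.onFun Disjoint A) := fun n n' hne =>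
    Set.disjoint_left.2 fun ω h h' => hne (h.2.symm.trans h'.2)
  have hAu : emptyAt D τ k = ⋃ n, A n := by
    ext ω
    simp [hA]
  have hmain : ∀ n, ∫⁻ ω in A n, f ω * g (after D τ k ω) ∂(pathLaw lam ν)
      = (∫⁻ ω in A n, f ω ∂(pathLaw lam ν)) * ∫⁻ ω, g ω ∂(pathLaw lam ν) := by
    intro n
    have hF : Measurable fun ω => f ω * g (after D τ k ω) :=
      hf.mul (hg.comp (hτ.measurable_after k))
    rw [← lintegral_indicator (hAm n), ← lintegral_indicator (hAm n),
      lintegral_glue n (hF.indicator (hAm n)), lintegral_glue n (hf.indicator (hAm n)),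
      ← lintegral_mul_const]
    swap
    · exact Measurable.lintegral_prod_right' (f := fun p : Path J × Path J =>
        (A n).indicator f (glue n p.1 p.2)) ((hf.indicator (hAm n)).comp (measurable_glue n))
    refine lintegral_congr fun h => ?_
    by_cases hex : ∃ y₀, glue n h y₀ ∈ A n
    · obtain ⟨y₀, h₀, hn₀⟩ := hex
      set c : Fin J → ℝ := fun i =>
        τ k (glue n h y₀) - ∑ m ∈ Finset.range (n i), h (Sum.inl (i, m)) with hc
      -- Memorylessness needs nonnegative elapsed times: the last served package of each source
      -- arrived no later than the clock time.
      have hc0 : ∀ i, 0 ≤ c i := by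
        intro i
        have hfr := hτ.free_le k (glue n h y₀)
        rcases Nat.eq_zero_or_pos (n i) with h0 | h0
        · simp only [hc, h0, Finset.range_zero, Finset.sum_empty, sub_zero]
          exact (free_nonneg hD k).trans hfr
        · have hlt : n i - 1 < (procState (glue n h y₀).arr D k).served i := by
            have h5 : (procState (glue n h y₀).arr D k).served = n := hn₀
            rw [h5]
            omega
          have h1 := arrival_le_free hD hlt
          have h2 : (glue n h y₀).arr i (n i - 1)
              = ∑ m ∈ Finset.range (n i), h (Sum.inl (i, m)) := by
            rw [Path.arr, arrival, Nat.sub_add_cancel h0]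
            refine Finset.sum_congr rfl fun m hm => ?_
            simp only [glue, Finset.mem_range.1 hm, if_true]
          simp only [hc]
          linarith
      have hiff : ∀ y, glue n h y ∈ A n ↔ y ∈ {y : Path J | ∀ i, c i < y (Sum.inl (i, 0))} :=
        fun y => emptyAt_glue_iff hD hτ h₀ hn₀ y
      have hhead : ∀ y, glue n h y ∈ A n → SameHead D k (glue n h y₀) (glue n h y) := by
        intro y hy
        have h5 : (procState (glue n h y₀).arr D k).served = n := hn₀
        refine ⟨h5.trans hy.2.symm, ?_⟩
        rw [h5]
        exact fun i m hm => glue_agree n h y₀ y i m hm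
      have hfv : ∀ y, glue n h y ∈ A n → f (glue n h y) = f (glue n h y₀) := fun y hy =>
        (hfd _ _ h₀ hy.1 (hhead y hy)).symm
      have haft : ∀ y, glue n h y ∈ A n → after D τ k (glue n h y) = advance c y := by
        intro y hy
        have hs := hτ.sameServices hD h₀ hy.1 (hhead y hy)
        have h6 : (procState (glue n h y).arr D k).served = n := hy.2
        rw [after, h6, ← hτ.congr k _ _ hs (IsClock.trans_eq (hhead y hy)) k le_rfl,
          shiftBy_glue]
      have hSm : MeasurableSet {y : Path J | ∀ i, c i < y (Sum.inl (i, 0))} := by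
        have : {y : Path J | ∀ i, c i < y (Sum.inl (i, 0))}
            = ⋂ i, {y : Path J | c i < y (Sum.inl (i, 0))} := by ext; simp
        rw [this]
        exact MeasurableSet.iInter fun i => measurableSet_lt measurable_const
          (measurable_pi_apply _)
      have hadvm : Measurable (advance c : Path J → Path J) := by
        refine measurable_pi_lambda _ fun p => ?_
        rcases p with ⟨i, _ | m⟩ | p
        · exact (measurable_pi_apply _).sub_const _
        · exact measurable_pi_apply _
        · exact measurable_pi_apply _
      have hgadv : Measurable fun y => g (advance c y) := hg.comp hadvm
      have e1 : ∀ y, (A n).indicator (fun ω => f ω * g (after D τ k ω)) (glue n h y)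
          = {y : Path J | ∀ i, c i < y (Sum.inl (i, 0))}.indicator
            (fun y => f (glue n h y₀) * g (advance c y)) y := by
        intro y
        by_cases hy : glue n h y ∈ A n
        · rw [Set.indicator_of_mem hy, Set.indicator_of_mem ((hiff y).1 hy), hfv y hy, haft y hy]
        · rw [Set.indicator_of_notMem hy, Set.indicator_of_notMem (mt (hiff y).2 hy)]
      have e2 : ∀ y, (A n).indicator f (glue n h y)
          = {y : Path J | ∀ i, c i < y (Sum.inl (i, 0))}.indicator
            (fun _ => f (glue n h y₀)) y := by
        intro y
        by_cases hy : glue n h y ∈ A n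
        · rw [Set.indicator_of_mem hy, Set.indicator_of_mem ((hiff y).1 hy), hfv y hy]
        · rw [Set.indicator_of_notMem hy, Set.indicator_of_notMem (mt (hiff y).2 hy)]
      simp_rw [e1, e2]
      rw [lintegral_indicator hSm, lintegral_indicator hSm, lintegral_const_mul _ hgadv,
        lintegral_advance hlam hc0 hg, setLIntegral_const, mul_assoc]
    · have hno : ∀ y, glue n h y ∉ A n := fun y hy => hex ⟨y, hy⟩
      simp only [Set.indicator_of_notMem (hno _), lintegral_zero, zero_mul]
  rw [hAu, lintegral_iUnion hAm hAd, lintegral_iUnion hAm hAd, ← ENNReal.tsum_mul_right]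
  exact tsum_congr hmain

theorem IsClock.regeneration (hlam : ∀ i, 0 < lam i) (hD : ∀ i, 0 ≤ D i) (hτ : IsClock D τ) :
    Regeneration (pathLaw lam ν) (emptyAt D τ) (after D τ) (SameHead D) where
  measurableSet := hτ.measurableSet_emptyAt
  measurable := hτ.measurable_after
  ae_zero := by
    filter_upwards [ae_inl_pos] with ω hω i
    rw [hτ.zero]
    simpa [procState, Path.arr, arrival] using hω i 0
  mem_add k l ω h := hτ.mem_emptyAt_add l h
  mem_congr k l ω ω' h1 h2 h3 h4 := hτ.emptyAt_congr hD h1 h2 h3 h4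
  lintegral_mul k f g hf hg h := hτ.lintegral_mul hlam hD k hf hg h

/-! ### The two clocks -/

/-- Time at which the processor is released by the first `k` services. -/
noncomputable def procClock (D : Fin J → ℝ) (k : ℕ) (ω : Path J) : ℝ := (procState ω.arr D k).free

/-- Time at which the transmitter is released by the first `k` processed packages. -/
noncomputable def transClock (D : Fin J → ℝ) (k : ℕ) (ω : Path J) : ℝ := transFree ω.arr D ω.trans k

theorem isClock_procClock (hD : ∀ i, 0 ≤ D i) : IsClock D (procClock D) where
  measurable := measurable_free
  zero _ := rfl
  free_le _ _ := le_rfl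
  mono _ := free_mono hD
  congr k ω ω' h _ l hl := by rw [procClock, procClock, h.state l hl]
  add k l ω h := by
    have hr : Restart ω.arr (after D (procClock D) k ω).arr D k (procClock D k ω) :=
      ⟨le_rfl, h, fun i m => Path.arr_shiftBy _ _ _ _ _⟩
    exact hr.free l

theorem isClock_transClock (hD : ∀ i, 0 ≤ D i) : IsClock D (transClock D) where
  measurable := measurable_transFree
  zero _ := rfl
  free_le k ω := free_le_transFree ω.trans_nonneg k
  mono ω := transFree_mono ω.trans_nonneg
  congr k ω ω' h hz l hl := h.transFree_eq hz hl
  add k l ω h := by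
    have hr : Restart ω.arr (after D (transClock D) k ω).arr D k (transClock D k ω) :=
      ⟨free_le_transFree ω.trans_nonneg k, h, fun i m => Path.arr_shiftBy _ _ _ _ _⟩
    exact hr.transFree_add hD (fun i m => rfl) le_rfl l

theorem emptyAt_transClock_subset (k : ℕ) :
    emptyAt D (transClock D) k ⊆ emptyAt D (procClock D) k := fun ω h i =>
  (free_le_transFree ω.trans_nonneg k).trans_lt (h i)

end PAoI

/-! ### Laws of large numbers for the coordinates, and density of the epochs with empty processor -/

namespace PAoI

section Coordinates

variable {J : ℕ} {lam : Fin J → ℝ} {ν : Fin J → Measure ℝ}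
  [∀ p, IsProbabilityMeasure (marginal lam ν p)]

theorem lintegral_coord (p : (Fin J × ℕ) ⊕ (Fin J × ℕ)) {φ : ℝ → ℝ≥0∞} (hφ : Measurable φ) :
    ∫⁻ ω, φ (ω p) ∂(pathLaw lam ν) = ∫⁻ x, φ x ∂(marginal lam ν p) :=
  (measurePreserving_eval_infinitePi (marginal lam ν) p).lintegral_comp hφ

theorem slln_coord {p : ℕ → (Fin J × ℕ) ⊕ (Fin J × ℕ)} (hp : Function.Injective p)
    {κ : Measure ℝ} (hκ : ∀ l, marginal lam ν (p l) = κ) {φ : ℝ → ℝ≥0∞} (hφ : Measurable φ) :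
    ∀ᵐ ω ∂(pathLaw lam ν), Tendsto (fun n : ℕ => (∑ l ∈ Finset.range n, φ (ω (p l))) / n) atTop
      (𝓝 (∫⁻ x, φ x ∂κ)) := by
  have hind : iIndepFun (fun q (ω : Path J) => φ (ω q)) (pathLaw lam ν) :=
    iIndepFun_infinitePi (P := marginal lam ν) (X := fun _ => φ) fun _ => hφ
  have hm : ∀ l, Measurable fun ω : Path J => φ (ω (p l)) := fun l =>
    hφ.comp (measurable_pi_apply _)
  rw [← hκ 0, ← lintegral_coord (p 0) hφ]
  refine slln_ennreal (fun l (ω : Path J) => φ (ω (p l))) hm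
    (fun a b hab => hind.indepFun (hp.ne hab)) fun l => ?_
  refine IdentDistrib.comp (u := φ) ⟨(measurable_pi_apply (p l)).aemeasurable,
    (measurable_pi_apply (p 0)).aemeasurable, ?_⟩ hφ
  have h1 := (measurePreserving_eval_infinitePi (marginal lam ν) (p l)).map_eq
  have h2 := (measurePreserving_eval_infinitePi (marginal lam ν) (p 0)).map_eq
  rw [hκ] at h1 h2
  exact h1.trans h2.symm

theorem slln_arrival (hlam : ∀ i, 0 < lam i) : ∀ᵐ ω ∂(pathLaw lam ν), ∀ i : Fin J,
    Tendsto (fun n : ℕ => (∑ l ∈ Finset.range n, (ω (Sum.inl (i, l)) : ℝ)) / (n : ℝ)) atTop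
      (𝓝 (1 / lam i)) := by
  rw [ae_all_iff]
  intro i
  have hinj : Function.Injective fun l : ℕ => (Sum.inl (i, l) : (Fin J × ℕ) ⊕ (Fin J × ℕ)) :=
    fun a b hab => by simpa using hab
  filter_upwards [slln_coord (lam := lam) (ν := ν) hinj (κ := expMeasure (lam i)) (fun _ => rfl)
    ENNReal.measurable_ofReal, ae_inl_pos] with ω h1 h2
  rw [lintegral_expMeasure (hlam i)] at h1
  have h3 := (ENNReal.tendsto_toReal ENNReal.ofReal_ne_top).comp h1
  have hl := hlam i
  rw [ENNReal.toReal_ofReal (by positivity)] at h3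
  refine h3.congr fun n => ?_
  rw [Function.comp_apply, ENNReal.toReal_div, ENNReal.toReal_sum fun _ _ => ENNReal.ofReal_ne_top,
    ENNReal.toReal_natCast]
  congr 1
  exact Finset.sum_congr rfl fun l _ => ENNReal.toReal_ofReal (h2 i l).le

theorem slln_trans : ∀ᵐ ω ∂(pathLaw lam ν), ∀ i,
    Tendsto (fun n : ℕ => (∑ l ∈ Finset.range n, ENNReal.ofReal (ω.trans i l)) / n) atTop
      (𝓝 (∫⁻ x, ENNReal.ofReal x ∂(ν i))) := by
  rw [ae_all_iff]
  intro i
  have hinj : Function.Injective fun l : ℕ => (Sum.inr (i, l) : (Fin J × ℕ) ⊕ (Fin J × ℕ)) :=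
    fun a b hab => by simpa using hab
  filter_upwards [slln_coord (lam := lam) (ν := ν) hinj (κ := ν i) (fun _ => rfl)
    ENNReal.measurable_ofReal] with ω h1
  simpa [Path.trans] using h1

end Coordinates

/-- Fatou carries a linear almost sure lower bound to the means; halving `δ` leaves the strict room
needed to pass from the liminf to an eventual bound. -/
theorem eventually_le_lintegral {E : Type*} [MeasurableSpace E] {μ : Measure E}
    [IsProbabilityMeasure μ] {δ : ℝ} (hδ : 0 < δ) {I : ℕ → E → ℝ≥0∞} (hI : ∀ n, Measurable (I n))
    (h : ∀ᵐ ω ∂μ, ∀ᶠ n : ℕ in atTop, ENNReal.ofReal (δ * n) ≤ I n ω) :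
    ∀ᶠ n : ℕ in atTop, ENNReal.ofReal (δ / 2) * n ≤ ∫⁻ ω, I n ω ∂μ := by
  have hfatou : ENNReal.ofReal δ ≤ liminf (fun n : ℕ => ∫⁻ ω, I n ω / n ∂μ) atTop := by
    refine le_trans ?_ (lintegral_liminf_le fun n => (hI n).div_const _)
    calc ENNReal.ofReal δ = ∫⁻ _, ENNReal.ofReal δ ∂μ := by simp
      _ ≤ _ := ?_
    refine lintegral_mono_ae ?_
    filter_upwards [h] with ω hω
    refine le_liminf_of_le (by isBoundedDefault) ?_
    filter_upwards [hω, eventually_gt_atTop 0] with n hn hn0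
    rw [ENNReal.le_div_iff_mul_le (by simp [hn0.ne']) (by simp), ← ENNReal.ofReal_natCast,
      ← ENNReal.ofReal_mul hδ.le]
    exact hn
  have hlt : ENNReal.ofReal (δ / 2) < ENNReal.ofReal δ :=
    (ENNReal.ofReal_lt_ofReal_iff hδ).2 (by linarith)
  filter_upwards [eventually_lt_of_lt_liminf (hlt.trans_le hfatou), eventually_gt_atTop 0]
    with n hn hn0
  simp_rw [div_eq_mul_inv] at hn
  rw [lintegral_mul_const _ (hI n), ← div_eq_mul_inv] at hn
  exact (ENNReal.le_div_iff_mul_le (by simp [hn0.ne']) (by simp)).1 hn.le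

theorem exists_const_of_eventually_le {a b : ℕ → ℝ} (h : ∀ᶠ m in atTop, a m ≤ b m) :
    ∃ c : ℝ, 0 ≤ c ∧ ∀ m, a m - c ≤ b m := by
  obtain ⟨M, hM⟩ := eventually_atTop.1 h
  refine ⟨∑ m ∈ Finset.range M, |a m - b m|, Finset.sum_nonneg fun _ _ => abs_nonneg _,
    fun m => ?_⟩
  rcases lt_or_ge m M with hm | hm
  · have h1 := Finset.single_le_sum (f := fun m => |a m - b m|) (fun _ _ => abs_nonneg _)
      (Finset.mem_range.2 hm)
    have h2 := le_abs_self (a m - b m)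
    linarith
  · have h1 := hM m hm
    have h2 : 0 ≤ ∑ m ∈ Finset.range M, |a m - b m| := Finset.sum_nonneg fun _ _ => abs_nonneg _
    linarith

variable {J : ℕ} [NeZero J] {D : Fin J → ℝ} {lam : Fin J → ℝ} {ν : Fin J → Measure ℝ}
  [∀ p, IsProbabilityMeasure (marginal lam ν p)]

theorem exists_pos_le (hD : ∀ i, 0 < D i) : ∃ d > 0, ∀ i, d ≤ D i := by
  obtain ⟨i, hi⟩ := Finite.exists_min D
  exact ⟨D i, hD i, hi⟩

theorem sum_inl_le_free (hD : ∀ i, 0 ≤ D i) (ω : Path J) (k : ℕ) (i : Fin J) :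
    ∑ l ∈ Finset.range ((procState ω.arr D k).served i), ω (Sum.inl (i, l))
      ≤ (procState ω.arr D k).free := by
  rcases Nat.eq_zero_or_pos ((procState ω.arr D k).served i) with h | h
  · rw [h]
    simpa using free_nonneg hD k
  · have hlt : (procState ω.arr D k).served i - 1 < (procState ω.arr D k).served i := by omega
    refine le_trans (le_of_eq ?_) (arrival_le_free hD hlt)
    change _ = ∑ l ∈ Finset.range ((procState ω.arr D k).served i - 1 + 1), ω (Sum.inl (i, l))
    rw [Nat.sub_add_cancel h]

/-- The processor is idle during a positive fraction of the time. -/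
theorem ae_idle_ge (hlam : ∀ i, 0 < lam i) (hD : ∀ i, 0 < D i) (hρ : ∑ i, lam i * D i < 1) :
    ∃ δ > 0, ∀ᵐ ω ∂(pathLaw lam ν), ∀ᶠ n : ℕ in atTop,
      δ * n ≤ ∑ k ∈ Finset.range n, (procBegin ω.arr D k - (procState ω.arr D k).free) := by
  set ρ := ∑ i, lam i * D i with hρd
  have hρ0 : 0 < ρ := Finset.sum_pos (fun i _ => mul_pos (hlam i) (hD i)) Finset.univ_nonempty
  obtain ⟨d, hd0, hd⟩ := exists_pos_le hD
  -- The estimate below yields `ρ * idle ≥ (1 - ρ) / 2 * d * n - const`, where `d` is the least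
  -- processing time. Half of the slope is given up to absorb the constant.
  refine ⟨(1 - ρ) / 4 * d / ρ, by have := sub_pos.2 hρ; positivity, ?_⟩
  filter_upwards [slln_arrival (ν := ν) hlam] with ω hω
  -- The strong law with slack: `(1 + ρ) / 2` lies strictly between `ρ` and `1`, and a
  -- path-dependent constant makes the bound valid for every `m`.
  have hc : ∀ i, ∃ c : ℝ, 0 ≤ c ∧ ∀ m : ℕ, (1 + ρ) / 2 * m - c
      ≤ lam i * ∑ l ∈ Finset.range m, ω (Sum.inl (i, l)) := by
    intro i
    refine exists_const_of_eventually_le ?_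
    have h1 := (hω i).const_mul (lam i)
    rw [mul_one_div_cancel (hlam i).ne'] at h1
    filter_upwards [h1.eventually (lt_mem_nhds (by linarith : (1 + ρ) / 2 < 1)),
      eventually_gt_atTop 0] with m hm hm0
    have hm' : (0 : ℝ) < m := by exact_mod_cast hm0
    rw [← mul_div_assoc, lt_div_iff₀ hm'] at hm
    exact hm.le
  choose c hc0 hc using hc
  -- All served packages have arrived by the release time `F`, so `ρ * F` is at least `(1 + ρ) / 2`
  -- times the work done, up to a constant. Subtracting `ρ` times the work leaves `ρ` times the idle
  -- time.
  have hbd : ∀ n : ℕ, (1 - ρ) / 2 * d * n - ∑ i, D i * c i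
      ≤ ρ * ∑ k ∈ Finset.range n, (procBegin ω.arr D k - (procState ω.arr D k).free) := by
    intro n
    have h1 := free_eq_idle_add (t := ω.arr) (D := D) n
    set I := ∑ k ∈ Finset.range n, (procBegin ω.arr D k - (procState ω.arr D k).free)
    set W := ∑ i, ((procState ω.arr D n).served i : ℝ) * D i with hW
    have h2 : (1 + ρ) / 2 * W - ∑ i, D i * c i ≤ ρ * (procState ω.arr D n).free := by
      rw [hW, hρd, Finset.mul_sum, ← Finset.sum_sub_distrib, Finset.sum_mul]
      refine Finset.sum_le_sum fun i _ => ?_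
      have h3 := hc i ((procState ω.arr D n).served i)
      have h4 := mul_le_mul_of_nonneg_left (sum_inl_le_free (fun i => (hD i).le) ω n i) (hlam i).le
      have h5 := mul_le_mul_of_nonneg_left (h3.trans h4) (hD i).le
      calc _ = D i * ((1 + ρ) / 2 * (procState ω.arr D n).served i - c i) := by ring
        _ ≤ _ := h5
        _ = _ := by ring
    have h6 : d * n ≤ W := by
      have h7 : ((n : ℕ) : ℝ) = ∑ i, ((procState ω.arr D n).served i : ℝ) := by
        conv_lhs => rw [← sum_served (t := ω.arr) (D := D) n]
        push_cast
        rfl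
      rw [h7, Finset.mul_sum]
      refine Finset.sum_le_sum fun i _ => ?_
      rw [mul_comm]
      exact mul_le_mul_of_nonneg_left (hd i) (Nat.cast_nonneg _)
    have h8 : (1 - ρ) / 2 * (d * n) ≤ (1 - ρ) / 2 * W :=
      mul_le_mul_of_nonneg_left h6 (by linarith)
    rw [h1] at h2
    nlinarith
  have hev : ∀ᶠ n : ℕ in atTop, ∑ i, D i * c i ≤ (1 - ρ) / 4 * d * n := by
    have hpos : 0 < (1 - ρ) / 4 * d := by have := sub_pos.2 hρ; positivity
    exact (tendsto_natCast_atTop_atTop.const_mul_atTop hpos).eventually_ge_atTop _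
  filter_upwards [hev] with n hn
  rw [div_mul_eq_mul_div, div_le_iff₀ hρ0]
  have := hbd n
  nlinarith

/-- Idling before service `k` is possible only if the processor is empty at that epoch, and it is
then the wait for the first arrival of the restarted path. -/
theorem ofReal_idle_eq (hD : ∀ i, 0 ≤ D i) (k : ℕ) (ω : Path J) :
    ENNReal.ofReal (procBegin ω.arr D k - (procState ω.arr D k).free)
      = (emptyAt D (procClock D) k).indicator
        (fun ω => ENNReal.ofReal (procBegin (after D (procClock D) k ω).arr D 0)) ω := by
  by_cases h : ω ∈ emptyAt D (procClock D) k
  · rw [Set.indicator_of_mem h]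
    have h1 := ((isClock_procClock hD).restart h).begins 0
    rw [add_zero] at h1
    rw [h1, procClock, add_sub_cancel_left]
  · rw [Set.indicator_of_notMem h, ENNReal.ofReal_eq_zero]
    simp only [emptyAt, Set.mem_ofPred_eq, not_forall, not_lt] at h
    obtain ⟨i, hi⟩ := h
    rw [sub_nonpos, procBegin, nextBegin]
    exact max_le le_rfl ((iInf_le_arrival _ _ i).trans hi)

/-- The processor becomes empty after a positive fraction of its services. -/
theorem procClock_density (hlam : ∀ i, 0 < lam i) (hD : ∀ i, 0 < D i)
    (hρ : ∑ i, lam i * D i < 1) :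
    ∃ δ : ℝ≥0∞, δ ≠ 0 ∧ ∀ᶠ n : ℕ in atTop,
      δ * n ≤ ∑ k ∈ Finset.range n, pathLaw lam ν (emptyAt D (procClock D) k) := by
  obtain ⟨δ, hδ, hae⟩ := ae_idle_ge (ν := ν) hlam hD hρ
  have hD' := fun i => (hD i).le
  have hreg := (isClock_procClock hD').regeneration (ν := ν) hlam hD'
  set m₀ := ∫⁻ ω, ENNReal.ofReal (procBegin (Path.arr ω) D 0) ∂(pathLaw lam ν) with hm₀
  have hgm : Measurable fun ω : Path J => ENNReal.ofReal (procBegin ω.arr D 0) :=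
    (measurable_procBegin 0).ennreal_ofReal
  -- An idle period ends no later than the first arrival of source `0`.
  have hm₀t : m₀ ≤ ENNReal.ofReal (1 / lam 0) := by
    rw [← lintegral_expMeasure (hlam 0)]
    refine (lintegral_mono fun ω => ?_).trans_eq
      (lintegral_coord (lam := lam) (ν := ν) (Sum.inl (0, 0)) ENNReal.measurable_ofReal)
    have h1 : procBegin (Path.arr ω) D 0 ≤ max 0 (ω (Sum.inl (0, 0))) := by
      refine max_le_max le_rfl ?_
      refine (iInf_le_arrival _ _ 0).trans_eq ?_
      simp [procState, Path.arr, arrival]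
    refine (ENNReal.ofReal_le_ofReal h1).trans ?_
    rw [ENNReal.ofReal_max]
    simp
  have hIk : ∀ k, Measurable fun ω : Path J =>
      ENNReal.ofReal (procBegin ω.arr D k - (procState ω.arr D k).free) := fun k =>
    ((measurable_procBegin k).sub (measurable_free k)).ennreal_ofReal
  set I : ℕ → Path J → ℝ≥0∞ := fun n ω => ∑ k ∈ Finset.range n,
    ENNReal.ofReal (procBegin ω.arr D k - (procState ω.arr D k).free) with hI
  have hIm : ∀ n, Measurable (I n) := fun n => Finset.measurable_fun_sum _ fun k _ => hIk k
  -- By regeneration, the expected total idle time is the expected number of empty epochs times the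
  -- mean of one idle period.
  have hint : ∀ n, ∫⁻ ω, I n ω ∂(pathLaw lam ν)
      = (∑ k ∈ Finset.range n, pathLaw lam ν (emptyAt D (procClock D) k)) * m₀ := by
    intro n
    simp only [hI]
    rw [lintegral_finsetSum _ fun k _ => hIk k, Finset.sum_mul]
    refine Finset.sum_congr rfl fun k _ => ?_
    simp_rw [ofReal_idle_eq hD' k]
    rw [lintegral_indicator (hreg.measurableSet k)]
    have := hreg.lintegral_mul k (fun _ => 1) _ measurable_const hgm fun _ _ _ _ _ => rfl
    simpa using this
  have hev : ∀ᶠ n : ℕ in atTop, ENNReal.ofReal (δ / 2) * n ≤ ∫⁻ ω, I n ω ∂(pathLaw lam ν) := by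
    refine eventually_le_lintegral hδ hIm ?_
    filter_upwards [hae] with ω hω
    filter_upwards [hω] with n hn
    simp only [hI]
    rw [← ENNReal.ofReal_sum_of_nonneg fun k _ => sub_nonneg.2 (free_le_procBegin k)]
    exact ENNReal.ofReal_le_ofReal hn
  have hl0 := hlam 0
  refine ⟨ENNReal.ofReal (δ / 2) / ENNReal.ofReal (1 / lam 0), ?_, ?_⟩
  · exact (ENNReal.div_pos (by simpa using hδ) ENNReal.ofReal_ne_top).ne'
  · filter_upwards [hev] with n h1
    rw [hint] at h1
    have h2 : ENNReal.ofReal (1 / lam 0) ≠ 0 := by simpa using hl0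
    rw [ENNReal.div_eq_inv_mul, mul_assoc, ← ENNReal.div_eq_inv_mul]
    refine ENNReal.div_le_of_le_mul (h1.trans ?_)
    gcongr

end PAoI

/-! ### Packages of one source in a cycle -/

namespace PAoI

variable {J : ℕ} [NeZero J] {D : Fin J → ℝ} {τ : ℕ → Path J → ℝ} {lam : Fin J → ℝ}
  {ν : Fin J → Measure ℝ} [∀ p, IsProbabilityMeasure (marginal lam ν p)]

/-- Number of packages of source `j` in the first cycle. -/
noncomputable def cycleCount (D : Fin J → ℝ) (τ : ℕ → Path J → ℝ) (j : Fin J) (ω : Path J) : ℕ :=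
  (procState ω.arr D (firstReturn (emptyAt D τ) ω)).served j

/-! ### A cycle that consists of a single package -/

/-- If the first package of `j` comes before time `1` and takes at most `b` to transmit, while every
other interarrival time involved exceeds `b + D j + 1`, then it has left the system before any other
package arrives. -/
theorem single_package {b : ℝ} (hb : 0 ≤ b) (hD : ∀ i, 0 ≤ D i) {j : Fin J} {ω : Path J}
    (h0 : 0 < ω (Sum.inl (j, 0))) (h1 : ω (Sum.inl (j, 0)) < 1) (hz : ω (Sum.inr (j, 0)) ≤ b)
    (hx : ∀ i, b + D j + 1 < ω (Sum.inl (i, if i = j then 1 else 0))) :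
    ω ∈ emptyAt D (transClock D) 1 ∧
      ∀ i, (procState ω.arr D 1).served i = if i = j then 1 else 0 := by
  have ht : ∀ i, ω.arr i 0 = ω (Sum.inl (i, 0)) := fun i => by simp [Path.arr, arrival]
  have hDj := hD j
  have hx' : ∀ i, i ≠ j → b + D j + 1 < ω (Sum.inl (i, 0)) := fun i hi => by
    simpa [hi] using hx i
  have hinf : ⨅ i, ω.arr i ((procState ω.arr D 0).served i) = ω (Sum.inl (j, 0)) := by
    refine le_antisymm ((iInf_le_arrival _ _ j).trans_eq (ht j)) (le_iInf_arrival fun i => ?_)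
    change _ ≤ ω.arr i 0
    rw [ht]
    by_cases hi : i = j
    · rw [hi]
    · linarith [hx' i hi]
  have hbeg : nextBegin ω.arr (procState ω.arr D 0) = ω (Sum.inl (j, 0)) := by
    rw [nextBegin, hinf]
    exact max_eq_right h0.le
  have hsrc : procSource ω.arr D 0 = j := by
    refine (nextSource_eq_iff _ _ _).2 ⟨?_, fun l hl => ?_⟩
    · rw [hbeg]
      exact (ht j).le
    · rw [hbeg]
      change _ < ω.arr l 0
      rw [ht]
      linarith [hx' l hl.ne]
  have hse : ∀ i, (procState ω.arr D 1).served i = if i = j then 1 else 0 := fun i => by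
    rw [procState_succ_served, hsrc]
    simp [procState]
  refine ⟨fun i => ?_, hse⟩
  have hidx : procIndex ω.arr D 0 = 0 := rfl
  have hfree : transClock D 1 ω ≤ ω (Sum.inl (j, 0)) + D j + b := by
    rw [transClock, transFree, transBeginAfter, hsrc, hidx, procEnd, procBegin, hbeg, hsrc]
    refine add_le_add (max_le ?_ le_rfl) (max_le hz hb)
    change (0 : ℝ) ≤ _
    linarith
  rw [hse]
  by_cases hi : i = j
  · have h2 := hx i
    subst hi
    rw [if_pos rfl] at h2 ⊢
    have h3 : ω.arr i 1 = ω (Sum.inl (i, 0)) + ω (Sum.inl (i, 1)) := by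
      simp [Path.arr, arrival, Finset.sum_range_succ]
    rw [h3]
    linarith
  · rw [if_neg hi, ht]
    linarith [hx' i hi]

/-- This supplies the aperiodicity for the renewal theorem, through a box of positive probability in
finitely many coordinates. It covers both clocks, since the single-package cycle ends with both
queues empty. -/
theorem cycleCount_eq_one_ne_zero (hlam : ∀ i, 0 < lam i) (hD : ∀ i, 0 ≤ D i)
    (hτ : emptyAt D (transClock D) 1 ⊆ emptyAt D τ 1) (j : Fin J) :
    pathLaw lam ν {ω | cycleCount D τ j ω = 1} ≠ 0 := by
  classical
  have : IsProbabilityMeasure (ν j) :=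
    inferInstanceAs (IsProbabilityMeasure (marginal lam ν (Sum.inr (j, 0))))
  -- The transmission law is arbitrary, so `b` is only chosen large enough to carry some mass below
  -- it.
  obtain ⟨b, hb0, hb⟩ : ∃ b : ℝ, 0 ≤ b ∧ ν j (Set.Iic b) ≠ 0 := by
    have h := tendsto_measure_Iic_atTop (ν j)
    rw [measure_univ] at h
    obtain ⟨b, h1, h2⟩ :=
      ((eventually_ge_atTop (0 : ℝ)).and (h.eventually_ne one_ne_zero)).exists
    exact ⟨b, h1, h2⟩
  let s : Finset ((Fin J × ℕ) ⊕ (Fin J × ℕ)) := insert (Sum.inl (j, 0)) (insert (Sum.inr (j, 0))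
    (Finset.univ.image fun i => Sum.inl (i, if i = j then 1 else 0)))
  let cut : (Fin J × ℕ) ⊕ (Fin J × ℕ) → Set ℝ := Sum.elim
    (fun q => if q = (j, 0) then Set.Ioo 0 1 else Set.Ioi (b + D j + 1)) fun _ => Set.Iic b
  have hbox : pathLaw lam ν (Set.pi s cut) ≠ 0 := by
    rw [pathLaw, Measure.infinitePi_pi, Finset.prod_ne_zero_iff]
    · intro p hp
      simp only [s, Finset.mem_insert, Finset.mem_image, Finset.mem_univ, true_and] at hp
      rcases hp with rfl | rfl | ⟨i, rfl⟩
      · simp only [cut, Sum.elim_inl, if_true]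
        exact expMeasure_Ioo_pos (hlam j) one_pos
      · exact hb
      · have hne : (i, if i = j then 1 else 0) ≠ (j, 0) := by
          intro h
          rw [Prod.mk.injEq] at h
          simp [h.1] at h
        simp only [cut, Sum.elim_inl, if_neg hne]
        exact expMeasure_Ioi_pos (hlam i) _
    · intro p _
      rcases p with p | p
      · simp only [cut, Sum.elim_inl]
        split_ifs
        exacts [measurableSet_Ioo, measurableSet_Ioi]
      · exact measurableSet_Iic
  refine fun h0 => hbox (measure_mono_null (fun ω hω => ?_) h0)
  have hj : ω (Sum.inl (j, 0)) ∈ cut (Sum.inl (j, 0)) := hω _ (by simp [s])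
  have hz : ω (Sum.inr (j, 0)) ∈ cut (Sum.inr (j, 0)) := hω _ (by simp [s])
  simp only [cut, Sum.elim_inl, if_true] at hj
  obtain ⟨h1, h2⟩ := single_package hb0 hD hj.1 hj.2 hz fun i => by
    have hne : (i, if i = j then 1 else 0) ≠ (j, 0) := by
      intro h
      rw [Prod.mk.injEq] at h
      simp [h.1] at h
    have := hω (Sum.inl (i, if i = j then 1 else 0)) (by simp [s])
    simpa only [cut, Sum.elim_inl, if_neg hne, Set.mem_Ioi] using this
  have h3 : firstReturn (emptyAt D τ) ω = 1 :=
    firstReturn_eq (k := 0) (hτ h1) fun l h1 h2 => by omega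
  change (procState ω.arr D (firstReturn (emptyAt D τ) ω)).served j = 1
  rw [h3, h2, if_pos rfl]

/-! ### Packages in a cycle -/

theorem sameServices_of_sameCycle (hD : ∀ i, 0 ≤ D i) (hτ : IsClock D τ) {ω ω' : Path J}
    (h : SameCycle (emptyAt D τ) (SameHead D) ω ω') :
    SameServices ω.arr ω'.arr D (firstReturn (emptyAt D τ) ω) :=
  hτ.sameServices hD h.2.2.1 h.2.2.2.1 h.2.2.2.2

theorem cycleCount_congr {ω ω' : Path J} (h : SameCycle (emptyAt D τ) (SameHead D) ω ω')
    (j : Fin J) : cycleCount D τ j ω = cycleCount D τ j ω' := by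
  rw [cycleCount, cycleCount, ← h.1, h.2.2.2.2.1]

theorem cycleCount_le_firstReturn (j : Fin J) (ω : Path J) :
    cycleCount D τ j ω ≤ firstReturn (emptyAt D τ) ω := served_le _ _

theorem measurable_cycleCount (hK : Measurable (firstReturn (emptyAt D τ))) (j : Fin J) :
    Measurable (cycleCount D τ j) :=
  measurable_comp_countable (f := fun k (ω : Path J) => (procState ω.arr D k).served j)
    (fun k => measurable_served k j) hK

namespace IsClock

/-- Common to both waiting times. Restarting is required only when all packages of the restarted
path get served: otherwise `rank` takes its default value `0` and a wait has no meaning. -/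
theorem limit (hτ : IsClock D τ) (hlam : ∀ i, 0 < lam i) (hD : ∀ i, 0 ≤ D i)
    (hone : emptyAt D (transClock D) 1 ⊆ emptyAt D τ 1)
    (hr : ∑' m, pathLaw lam ν (noReturn (emptyAt D τ) m) ≠ ∞) {j : Fin J}
    {W : ℕ → Path J → ℝ≥0∞} (hWm : ∀ n, Measurable (W n))
    (hgood : ∀ᵐ ω ∂(pathLaw lam ν), ∀ n, ∃ k, n < (procState (Path.arr ω) D k).served j)
    (hadd : ∀ k ω, ω ∈ emptyAt D τ k →
      (∀ n, ∃ l, n < (procState (after D τ k ω).arr D l).served j) →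
      ∀ m, W ((procState ω.arr D k).served j + m) ω = W m (after D τ k ω))
    (hcongr : ∀ k (ω ω' : Path J), SameServices ω.arr ω'.arr D k → SameHead D k ω ω' →
      ∀ n < (procState ω.arr D k).served j, W n ω = W n ω') :
    ∃ w : ℝ≥0∞, Tendsto (fun n => ∫⁻ ω, W n ω ∂(pathLaw lam ν)) atTop (𝓝 w) ∧
      ∀ᵐ ω ∂(pathLaw lam ν), Tendsto (fun n : ℕ => (∑ k ∈ Finset.range n, W k ω) / n) atTop
        (𝓝 w) := by
  have hreg := hτ.regeneration (ν := ν) hlam hD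
  have hret := Regeneration.ae_exists_return hr
  have hcs := hreg.cycleShift hret
  refine hcs.limit (measurable_cycleCount hreg.measurable_firstReturn j)
    (fun ω ω' h => cycleCount_congr h j)
    (cycleCount_eq_one_ne_zero hlam hD hone j) ?_ hWm ?_ ?_
  · refine ne_top_of_le_ne_top (hreg.lintegral_firstReturn_ne_top hr) (lintegral_mono fun ω => ?_)
    exact Nat.cast_le.2 (cycleCount_le_firstReturn j ω)
  · filter_upwards [hret, hcs.measurePreserving.quasiMeasurePreserving.ae hgood] with ω h1 h2
    exact hadd _ ω (firstReturn_spec h1).2 h2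
  · exact fun ω ω' h => hcongr _ ω ω' (sameServices_of_sameCycle hD hτ h) h.2.2.2.2

theorem procWait_limit (hτ : IsClock D τ) (hlam : ∀ i, 0 < lam i) (hD : ∀ i, 0 ≤ D i)
    (hone : emptyAt D (transClock D) 1 ⊆ emptyAt D τ 1)
    (hr : ∑' m, pathLaw lam ν (noReturn (emptyAt D τ) m) ≠ ∞) {j : Fin J}
    (hgood : ∀ᵐ ω ∂(pathLaw lam ν), ∀ n, ∃ k, n < (procState (Path.arr ω) D k).served j) :
    ∃ w : ℝ≥0∞, Tendsto (fun n => ∫⁻ ω, ENNReal.ofReal (procWait (Path.arr ω) D j n)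
      ∂(pathLaw lam ν))
        atTop (𝓝 w) ∧
      ∀ᵐ ω ∂(pathLaw lam ν), Tendsto (fun n : ℕ => (∑ k ∈ Finset.range n,
        ENNReal.ofReal (procWait (Path.arr ω) D j k)) / n) atTop (𝓝 w) := by
  refine hτ.limit hlam hD hone hr (W := fun n ω => ENNReal.ofReal (procWait (Path.arr ω) D j n))
    (fun n => (measurable_procWait j n).ennreal_ofReal) hgood ?_ ?_
  · intro k ω hω hg m
    rw [(hτ.restart hω).procWait_add (hg m)]
  · intro k ω ω' hs hh n hn
    rw [hs.procWait_eq (arr_congr fun i m hm => (hh.2 i m hm).1) hn]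

end IsClock

theorem transWait_limit (hlam : ∀ i, 0 < lam i) (hD : ∀ i, 0 ≤ D i)
    (hr : ∑' m, pathLaw lam ν (noReturn (emptyAt D (transClock D)) m) ≠ ∞) {j : Fin J}
    (hgood : ∀ᵐ ω ∂(pathLaw lam ν), ∀ n, ∃ k, n < (procState (Path.arr ω) D k).served j) :
    ∃ w : ℝ≥0∞, Tendsto (fun n => ∫⁻ ω, ENNReal.ofReal (transWait (Path.arr ω) D (Path.trans ω) j n)
        ∂(pathLaw lam ν)) atTop (𝓝 w) ∧
      ∀ᵐ ω ∂(pathLaw lam ν), Tendsto (fun n : ℕ => (∑ k ∈ Finset.range n,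
        ENNReal.ofReal (transWait (Path.arr ω) D (Path.trans ω) j k)) / n) atTop (𝓝 w) := by
  have hτ := isClock_transClock hD
  refine hτ.limit hlam hD subset_rfl hr
    (W := fun n ω => ENNReal.ofReal (transWait (Path.arr ω) D (Path.trans ω) j n))
    (fun n => (measurable_transWait j n).ennreal_ofReal) hgood ?_ ?_
  · intro k ω hω hg m
    rw [(hτ.restart hω).transWait_add hD (z' := (after D (transClock D) k ω).trans)
      (fun i m => rfl) le_rfl (hg m)]
  · intro k ω ω' hs hh n hn
    rw [hs.transWait_eq (IsClock.trans_eq hh) hn]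

/-! ### Cycles of the processor -/

/-- The path after the first cycle of the processor. -/
noncomputable def procCycle (D : Fin J → ℝ) : Path J → Path J :=
  returnShift (emptyAt D (procClock D)) (after D (procClock D))

/-- Number of services in the first cycle of the processor. -/
noncomputable def cycleLength (D : Fin J → ℝ) : Path J → ℕ := firstReturn (emptyAt D (procClock D))

/-- End of the last service in the first cycle of the processor. -/
noncomputable def cycleTime (D : Fin J → ℝ) (ω : Path J) : ℝ :=
  (procState ω.arr D (cycleLength D ω)).free

/-- Total transmission time of the packages in the first `k` services. -/
noncomputable def serviceSum (D : Fin J → ℝ) (k : ℕ) (ω : Path J) : ℝ :=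
  ∑ l ∈ Finset.range k, ω.trans (procSource ω.arr D l) (procIndex ω.arr D l)

/-- Total transmission time of the packages in the first cycle of the processor. -/
noncomputable def cycleTrans (D : Fin J → ℝ) (ω : Path J) : ℝ := serviceSum D (cycleLength D ω) ω

/-- Every cycle of the processor is finite. -/
def Recurrent (D : Fin J → ℝ) (ω : Path J) : Prop :=
  ∀ c, (procCycle D)^[c] ω ∈ emptyAt D (procClock D) 0 ∧
    ∃ l, 1 ≤ l ∧ (procCycle D)^[c] ω ∈ emptyAt D (procClock D) l

theorem Recurrent.procCycle {ω : Path J} (h : Recurrent D ω) : Recurrent D (procCycle D ω) :=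
  fun c => h (c + 1)

theorem Recurrent.mem_emptyAt {ω : Path J} (h : Recurrent D ω) :
    ω ∈ emptyAt D (procClock D) (cycleLength D ω) :=
  (firstReturn_spec (h 0).2).2

theorem serviceSum_add (hD : ∀ i, 0 ≤ D i) {k : ℕ} {ω : Path J}
    (h : ω ∈ emptyAt D (procClock D) k) (l : ℕ) :
    serviceSum D (k + l) ω = serviceSum D k ω + serviceSum D l (after D (procClock D) k ω) := by
  have hr := (isClock_procClock hD).restart h
  rw [serviceSum, Finset.sum_range_add]
  congr 1
  refine Finset.sum_congr rfl fun m _ => ?_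
  rw [hr.source, hr.index]
  rfl

theorem free_add (hD : ∀ i, 0 ≤ D i) {k : ℕ} {ω : Path J}
    (h : ω ∈ emptyAt D (procClock D) k) (l : ℕ) : (procState ω.arr D (k + l)).free
      = (procState ω.arr D k).free + (procState (after D (procClock D) k ω).arr D l).free := by
  cases l with
  | zero => exact (add_zero _).symm
  | succ l => exact ((isClock_procClock hD).restart h).free l

/-- After `c` cycles the time, the packages served and the transmission work are sums over the
cycles. Sample-path inequalities at cycle ends thus become statements about independent identically
distributed sums. -/
theorem Recurrent.state (hD : ∀ i, 0 ≤ D i) (c : ℕ) {ω : Path J} (h : Recurrent D ω) :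
    ω ∈ emptyAt D (procClock D) (cycleSum (PAoI.procCycle D) (cycleLength D) c ω) ∧
    (procState ω.arr D (cycleSum (PAoI.procCycle D) (cycleLength D) c ω)).free
      = ∑ i ∈ Finset.range c, cycleTime D ((PAoI.procCycle D)^[i] ω) ∧
    (∀ i, (procState ω.arr D (cycleSum (PAoI.procCycle D) (cycleLength D) c ω)).served i
      = cycleSum (PAoI.procCycle D) (cycleCount D (procClock D) i) c ω) ∧
    serviceSum D (cycleSum (PAoI.procCycle D) (cycleLength D) c ω) ω
      = ∑ i ∈ Finset.range c, cycleTrans D ((PAoI.procCycle D)^[i] ω) := by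
  induction c generalizing ω with
  | zero =>
    refine ⟨(h 0).1, ?_, fun i => ?_, ?_⟩ <;> simp [cycleSum, procState, serviceSum]
  | succ c ih =>
    obtain ⟨h1, h2, h3, h4⟩ := ih h.procCycle
    have hm := h.mem_emptyAt
    have hc := isClock_procClock (J := J) hD
    simp only [cycleSum_succ, Finset.sum_range_succ', Function.iterate_succ_apply,
      Function.iterate_zero, id_eq]
    rw [hc.mem_emptyAt_add _ hm, free_add hD hm, serviceSum_add hD hm]
    refine ⟨h1, ?_, fun i => ?_, ?_⟩
    · rw [← h2, add_comm]
      rfl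
    · rw [(hc.restart hm).served, ← h3]
      rfl
    · rw [← h4, add_comm]
      rfl

end PAoI

namespace PAoI

variable {J : ℕ} [NeZero J] {D : Fin J → ℝ} {lam : Fin J → ℝ}
  {ν : Fin J → Measure ℝ} [∀ p, IsProbabilityMeasure (marginal lam ν p)]

/-! ### Means over a cycle of the processor -/

theorem tsum_noReturn_procClock (hlam : ∀ i, 0 < lam i) (hD : ∀ i, 0 < D i)
    (hρ : ∑ i, lam i * D i < 1) :
    ∑' m, pathLaw lam ν (noReturn (emptyAt D (procClock D)) m) ≠ ∞ := by
  obtain ⟨δ, hδ, hu⟩ := procClock_density (ν := ν) hlam hD hρ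
  have hD' := fun i => (hD i).le
  exact ((isClock_procClock hD').regeneration hlam hD').tsum_noReturn_ne_top hδ hu

theorem cycleShift_procCycle (hlam : ∀ i, 0 < lam i) (hD : ∀ i, 0 < D i)
    (hρ : ∑ i, lam i * D i < 1) :
    CycleShift (pathLaw lam ν) (procCycle D)
      (SameCycle (emptyAt D (procClock D)) (SameHead D)) := by
  have hD' := fun i => (hD i).le
  exact ((isClock_procClock hD').regeneration hlam hD').cycleShift
    (Regeneration.ae_exists_return (tsum_noReturn_procClock hlam hD hρ))

theorem ae_recurrent (hlam : ∀ i, 0 < lam i) (hD : ∀ i, 0 < D i) (hρ : ∑ i, lam i * D i < 1) :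
    ∀ᵐ ω ∂(pathLaw lam ν), Recurrent D ω := by
  have hD' := fun i => (hD i).le
  refine ae_all_iff.2 fun c => ?_
  refine ((cycleShift_procCycle (ν := ν) hlam hD hρ).measurePreserving.iterate
    c).quasiMeasurePreserving.ae (p := fun ω => ω ∈ emptyAt D (procClock D) 0 ∧
      ∃ l, 1 ≤ l ∧ ω ∈ emptyAt D (procClock D) l) ?_
  filter_upwards [((isClock_procClock hD').regeneration (ν := ν) hlam hD').ae_zero,
    Regeneration.ae_exists_return (tsum_noReturn_procClock (ν := ν) hlam hD hρ)] with ω h1 h2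
  exact ⟨h1, h2⟩

theorem measurable_cycleLength (hD : ∀ i, 0 ≤ D i) : Measurable (cycleLength D) :=
  measurable_firstReturn (isClock_procClock hD).measurableSet_emptyAt

theorem measurable_cycleTime (hD : ∀ i, 0 ≤ D i) : Measurable (cycleTime D) :=
  measurable_comp_countable (f := fun k (ω : Path J) => (procState ω.arr D k).free) measurable_free
    (measurable_cycleLength hD)

theorem measurable_serviceSum (k : ℕ) : Measurable (serviceSum (J := J) D k) :=
  Finset.measurable_fun_sum _ fun l _ => measurable_serviceTrans l

theorem measurable_cycleTrans (hD : ∀ i, 0 ≤ D i) : Measurable (cycleTrans D) :=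
  measurable_comp_countable (f := serviceSum D) measurable_serviceSum (measurable_cycleLength hD)

theorem cycleTime_congr (hD : ∀ i, 0 ≤ D i) {ω ω' : Path J}
    (h : SameCycle (emptyAt D (procClock D)) (SameHead D) ω ω') :
    cycleTime D ω = cycleTime D ω' := by
  have hs := sameServices_of_sameCycle hD (isClock_procClock hD) h
  rw [cycleTime, cycleTime, cycleLength, hs.state _ le_rfl, ← h.1]

theorem cycleTrans_congr (hD : ∀ i, 0 ≤ D i) {ω ω' : Path J}
    (h : SameCycle (emptyAt D (procClock D)) (SameHead D) ω ω') :
    cycleTrans D ω = cycleTrans D ω' := by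
  have hs := sameServices_of_sameCycle hD (isClock_procClock hD) h
  rw [cycleTrans, cycleTrans, cycleLength, ← h.1]
  refine Finset.sum_congr rfl fun l hl => ?_
  have hl' := Finset.mem_range.1 hl
  rw [← hs.source l hl', ← hs.index hl',
    IsClock.trans_eq h.2.2.2.2 _ _ (procIndex_lt_served hl')]

theorem cycleTime_nonneg (hD : ∀ i, 0 ≤ D i) (ω : Path J) : 0 ≤ cycleTime D ω := free_nonneg hD _

theorem serviceSum_nonneg (k : ℕ) (ω : Path J) : 0 ≤ serviceSum D k ω :=
  Finset.sum_nonneg fun _ _ => ω.trans_nonneg _ _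

theorem cycleTrans_nonneg (ω : Path J) : 0 ≤ cycleTrans D ω := serviceSum_nonneg _ _

theorem lintegral_cycleCount_ne_zero (hlam : ∀ i, 0 < lam i) (hD : ∀ i, 0 ≤ D i) (j : Fin J) :
    ∫⁻ ω, (cycleCount D (procClock D) j ω : ℝ≥0∞) ∂(pathLaw lam ν) ≠ 0 :=
  CycleShift.lintegral_count_ne_zero
    (cycleCount_eq_one_ne_zero hlam hD (emptyAt_transClock_subset 1) j)
    (measurable_cycleCount (measurable_cycleLength hD) j)

theorem lintegral_cycleLength_ne_top (hlam : ∀ i, 0 < lam i) (hD : ∀ i, 0 < D i)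
    (hρ : ∑ i, lam i * D i < 1) : ∫⁻ ω, (cycleLength D ω : ℝ≥0∞) ∂(pathLaw lam ν) ≠ ∞ := by
  have hD' := fun i => (hD i).le
  exact ((isClock_procClock hD').regeneration hlam hD').lintegral_firstReturn_ne_top
    (tsum_noReturn_procClock hlam hD hρ)

theorem lintegral_cycleCount_ne_top (hlam : ∀ i, 0 < lam i) (hD : ∀ i, 0 < D i)
    (hρ : ∑ i, lam i * D i < 1) (j : Fin J) :
    ∫⁻ ω, (cycleCount D (procClock D) j ω : ℝ≥0∞) ∂(pathLaw lam ν) ≠ ∞ :=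
  ne_top_of_le_ne_top (lintegral_cycleLength_ne_top hlam hD hρ)
    (lintegral_mono fun ω => Nat.cast_le.2 (cycleCount_le_firstReturn j ω))

theorem ae_tendsto_cycleCount (hlam : ∀ i, 0 < lam i) (hD : ∀ i, 0 < D i)
    (hρ : ∑ i, lam i * D i < 1) : ∀ᵐ ω ∂(pathLaw lam ν), ∀ j : Fin J,
      Tendsto (fun c => cycleSum (procCycle D) (cycleCount D (procClock D) j) c ω) atTop atTop := by
  have hD' := fun i => (hD i).le
  exact ae_all_iff.2 fun j => (cycleShift_procCycle hlam hD hρ).tendsto_cycleSum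
    (measurable_cycleCount (measurable_cycleLength hD') j) (fun _ _ h => cycleCount_congr h j)
    (lintegral_cycleCount_ne_zero hlam hD' j)

/-- Every package is served. -/
theorem ae_served (hlam : ∀ i, 0 < lam i) (hD : ∀ i, 0 < D i) (hρ : ∑ i, lam i * D i < 1) :
    ∀ᵐ ω ∂(pathLaw lam ν), ∀ (j : Fin J) (n : ℕ),
      ∃ k, n < (procState (Path.arr ω) D k).served j := by
  filter_upwards [ae_recurrent (ν := ν) hlam hD hρ, ae_tendsto_cycleCount (ν := ν) hlam hD hρ]
    with ω h1 h2 j n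
  obtain ⟨c, hc⟩ := ((h2 j).eventually (eventually_gt_atTop n)).exists
  exact ⟨_, hc.trans_eq ((h1.state (fun i => (hD i).le) c).2.2.1 j).symm⟩

theorem ae_tendsto_cycleCount_div (hlam : ∀ i, 0 < lam i) (hD : ∀ i, 0 < D i)
    (hρ : ∑ i, lam i * D i < 1) : ∀ᵐ ω ∂(pathLaw lam ν), ∀ j : Fin J,
      Tendsto (fun c : ℕ => (cycleSum (procCycle D) (cycleCount D (procClock D) j) c ω : ℝ≥0∞) / c)
        atTop (𝓝 (∫⁻ ω, (cycleCount D (procClock D) j ω : ℝ≥0∞) ∂(pathLaw lam ν))) := by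
  have hD' := fun i => (hD i).le
  refine ae_all_iff.2 fun j => ?_
  have hm : Measurable fun ω : Path J => (cycleCount D (procClock D) j ω : ℝ≥0∞) :=
    measurable_from_nat.comp (measurable_cycleCount (measurable_cycleLength hD') j)
  filter_upwards [(cycleShift_procCycle (ν := ν) hlam hD hρ).slln hm
    fun _ _ h => by rw [cycleCount_congr h j]] with ω hω
  refine hω.congr fun c => ?_
  simp only [cycleSum, Nat.cast_sum]

theorem tendsto_comp_div {f : ℕ → ℝ} {l n : ℝ} (hf : Tendsto (fun m : ℕ => f m / m) atTop (𝓝 l))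
    {N : ℕ → ℕ} (hN : Tendsto N atTop atTop)
    (hn : Tendsto (fun c : ℕ => (N c : ℝ) / c) atTop (𝓝 n)) :
    Tendsto (fun c : ℕ => f (N c) / c) atTop (𝓝 (l * n)) := by
  refine ((hf.comp hN).mul hn).congr' ?_
  filter_upwards [hN.eventually (eventually_gt_atTop 0)] with c hc
  have : (N c : ℝ) ≠ 0 := by exact_mod_cast hc.ne'
  simp only [Function.comp_apply]
  field_simp

/-- The end of a cycle falls between the last served arrival and the next arrival of source `j`, so
it is asymptotic to `1 / lam j` times the packages counted. Comparison with the strong law for cycle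
times, along one good path, identifies the mean and shows that it is finite. -/
theorem lintegral_cycleTime (hlam : ∀ i, 0 < lam i) (hD : ∀ i, 0 < D i)
    (hρ : ∑ i, lam i * D i < 1) (j : Fin J) :
    ∫⁻ ω, ENNReal.ofReal (cycleTime D ω) ∂(pathLaw lam ν)
      = ENNReal.ofReal ((1 / lam j)
        * (∫⁻ ω, (cycleCount D (procClock D) j ω : ℝ≥0∞) ∂(pathLaw lam ν)).toReal) := by
  have hD' := fun i => (hD i).le
  set a := ∫⁻ ω, (cycleCount D (procClock D) j ω : ℝ≥0∞) ∂(pathLaw lam ν) with ha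
  have hat : a ≠ ∞ := lintegral_cycleCount_ne_top hlam hD hρ j
  have hL := (cycleShift_procCycle (ν := ν) hlam hD hρ).slln
    (measurable_cycleTime hD').ennreal_ofReal fun _ _ h => by rw [cycleTime_congr hD' h]
  obtain ⟨ω, h1, h2, h3, h4, h5⟩ := (hL.and ((ae_recurrent hlam hD hρ).and
    ((ae_tendsto_cycleCount hlam hD hρ).and ((ae_tendsto_cycleCount_div hlam hD hρ).and
    (slln_arrival hlam))))).exists
  have h4' := (ENNReal.tendsto_toReal hat).comp (h4 j)
  set N : ℕ → ℕ := fun c => cycleSum (procCycle D) (cycleCount D (procClock D) j) c ω with hN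
  have h6 : Tendsto (fun c : ℕ => (N c : ℝ) / c) atTop (𝓝 a.toReal) :=
    h4'.congr fun c => by simp [ENNReal.toReal_div, hN]
  -- The upper bound uses the first package not yet served, hence one more interarrival time; the
  -- extra `1` vanishes after division by `c`.
  have h7 : Tendsto (fun c : ℕ => ((N c + 1 : ℕ) : ℝ) / c) atTop (𝓝 a.toReal) := by
    have := h6.add tendsto_one_div_atTop_nhds_zero_nat
    rw [add_zero] at this
    refine this.congr fun c => ?_
    push_cast
    ring
  have hlo := tendsto_comp_div (f := fun m => ∑ l ∈ Finset.range m, ω (Sum.inl (j, l))) (h5 j)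
    (h3 j) h6
  have hhi := tendsto_comp_div (f := fun m => ∑ l ∈ Finset.range m, ω (Sum.inl (j, l))) (h5 j)
    (tendsto_atTop_mono (fun c => Nat.le_succ _) (h3 j)) h7
  have hst := fun c => h2.state hD' c
  have hmid : Tendsto
      (fun c : ℕ => (∑ i ∈ Finset.range c, cycleTime D ((procCycle D)^[i] ω)) / (c : ℝ))
      atTop (𝓝 (1 / lam j * a.toReal)) := by
    refine tendsto_of_tendsto_of_tendsto_of_le_of_le hlo hhi (fun c => ?_) fun c => ?_
    · refine div_le_div_of_nonneg_right ?_ (Nat.cast_nonneg c)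
      have := sum_inl_le_free hD' ω (cycleSum (procCycle D) (cycleLength D) c ω) j
      rwa [(hst c).2.2.1, (hst c).2.1] at this
    · refine div_le_div_of_nonneg_right ?_ (Nat.cast_nonneg c)
      have := (hst c).1 j
      rw [procClock, (hst c).2.2.1, (hst c).2.1] at this
      exact this.le
  refine tendsto_nhds_unique h1 (((ENNReal.continuous_ofReal.tendsto _).comp hmid).congr' ?_)
  filter_upwards [eventually_gt_atTop 0] with c hc
  rw [Function.comp_apply, ENNReal.ofReal_div_of_pos (by exact_mod_cast hc),
    ENNReal.ofReal_sum_of_nonneg fun i _ => cycleTime_nonneg hD' _, ENNReal.ofReal_natCast]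

theorem lintegral_cycleTime_ne_top (hlam : ∀ i, 0 < lam i) (hD : ∀ i, 0 < D i)
    (hρ : ∑ i, lam i * D i < 1) :
    ∫⁻ ω, ENNReal.ofReal (cycleTime D ω) ∂(pathLaw lam ν) ≠ ∞ := by
  rw [lintegral_cycleTime hlam hD hρ 0]
  exact ENNReal.ofReal_ne_top

theorem lintegral_cycleTime_ne_zero (hlam : ∀ i, 0 < lam i) (hD : ∀ i, 0 < D i)
    (hρ : ∑ i, lam i * D i < 1) :
    ∫⁻ ω, ENNReal.ofReal (cycleTime D ω) ∂(pathLaw lam ν) ≠ 0 := by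
  rw [lintegral_cycleTime hlam hD hρ 0, ENNReal.ofReal_ne_zero_iff]
  have h1 := lintegral_cycleCount_ne_zero (ν := ν) hlam (fun i => (hD i).le) 0
  exact mul_pos (one_div_pos.2 (hlam 0))
    (ENNReal.toReal_pos h1 (lintegral_cycleCount_ne_top hlam hD hρ 0))

theorem lintegral_cycleCount (hlam : ∀ i, 0 < lam i) (hD : ∀ i, 0 < D i)
    (hρ : ∑ i, lam i * D i < 1) (j : Fin J) :
    ∫⁻ ω, (cycleCount D (procClock D) j ω : ℝ≥0∞) ∂(pathLaw lam ν)
      = ENNReal.ofReal (lam j) * ∫⁻ ω, ENNReal.ofReal (cycleTime D ω) ∂(pathLaw lam ν) := by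
  rw [lintegral_cycleTime hlam hD hρ j, ← ENNReal.ofReal_mul (hlam j).le, ← mul_assoc,
    mul_one_div_cancel (hlam j).ne', one_mul,
    ENNReal.ofReal_toReal (lintegral_cycleCount_ne_top hlam hD hρ j)]

/-- The work in `c` cycles, regrouped by source, is a sum over sources of partial sums of
independent transmission times. The number of terms grows like `c` times the mean count, which is
`lam i` times the mean cycle time. -/
theorem lintegral_cycleTrans (hlam : ∀ i, 0 < lam i) (hD : ∀ i, 0 < D i)
    (hρ : ∑ i, lam i * D i < 1) :
    ∫⁻ ω, ENNReal.ofReal (cycleTrans D ω) ∂(pathLaw lam ν)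
      = (∑ i, ENNReal.ofReal (lam i) * ∫⁻ x, ENNReal.ofReal x ∂(ν i))
        * ∫⁻ ω, ENNReal.ofReal (cycleTime D ω) ∂(pathLaw lam ν) := by
  have hD' := fun i => (hD i).le
  have hZ := (cycleShift_procCycle (ν := ν) hlam hD hρ).slln
    (measurable_cycleTrans hD').ennreal_ofReal fun _ _ h => by rw [cycleTrans_congr hD' h]
  obtain ⟨ω, h1, h2, h3, h4, h5⟩ := (hZ.and ((ae_recurrent hlam hD hρ).and
    ((ae_tendsto_cycleCount hlam hD hρ).and ((ae_tendsto_cycleCount_div hlam hD hρ).and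
    slln_trans)))).exists
  set N : Fin J → ℕ → ℕ := fun i c => cycleSum (procCycle D) (cycleCount D (procClock D) i) c ω
    with hN
  have h6 : ∀ i, Tendsto
    (fun c : ℕ => (∑ l ∈ Finset.range (N i c), ENNReal.ofReal (ω.trans i l)) / c)
      atTop (𝓝 ((∫⁻ x, ENNReal.ofReal x ∂(ν i))
        * ∫⁻ ω, (cycleCount D (procClock D) i ω : ℝ≥0∞) ∂(pathLaw lam ν))) := by
    intro i
    refine (ENNReal.Tendsto.mul ((h5 i).comp (h3 i))
      (Or.inr (lintegral_cycleCount_ne_top hlam hD hρ i)) (h4 i)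
      (Or.inl (lintegral_cycleCount_ne_zero hlam hD' i))).congr' ?_
    filter_upwards [(h3 i).eventually (eventually_gt_atTop 0)] with c hc
    simp only [Function.comp_apply]
    rw [div_eq_mul_inv, div_eq_mul_inv, div_eq_mul_inv, mul_assoc, ← mul_assoc _ _ (c : ℝ≥0∞)⁻¹,
      ENNReal.inv_mul_cancel (by exact_mod_cast hc.ne') (by simp), one_mul]
  have h7 := tendsto_finsetSum Finset.univ fun i _ => h6 i
  rw [Finset.sum_mul]
  refine tendsto_nhds_unique h1 ((h7.congr fun c => ?_).trans_eq ?_)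
  · rw [← ENNReal.ofReal_sum_of_nonneg fun i _ => cycleTrans_nonneg _, ← (h2.state hD' c).2.2.2,
      serviceSum, sum_services_eq, ENNReal.ofReal_sum_of_nonneg
        fun i _ => Finset.sum_nonneg fun l _ => ω.trans_nonneg i l]
    simp_rw [div_eq_mul_inv]
    rw [← Finset.sum_mul]
    congr 1
    refine Finset.sum_congr rfl fun i _ => ?_
    rw [ENNReal.ofReal_sum_of_nonneg fun l _ => ω.trans_nonneg i l, (h2.state hD' c).2.2.1]
  · congr 1
    refine Finset.sum_congr rfl fun i _ => ?_
    rw [lintegral_cycleCount hlam hD hρ i]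
    ring

end PAoI

namespace PAoI

theorem pathLaw_forall_lt_ne_zero {J : ℕ} {lam : Fin J → ℝ} {ν : Fin J → Measure ℝ}
    [∀ p, IsProbabilityMeasure (marginal lam ν p)] (hlam : ∀ i, 0 < lam i) (b : ℝ) :
    pathLaw lam ν {ω : Path J | ∀ i, b < ω (Sum.inl (i, 0))} ≠ 0 := by
  classical
  have hset : {ω : Path J | ∀ i, b < ω (Sum.inl (i, 0))} = Set.pi
    (Finset.univ.image fun i : Fin J =>
      (Sum.inl (i, 0) : (Fin J × ℕ) ⊕ (Fin J × ℕ)) : Finset _) fun _ => Set.Ioi b := by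
    ext ω
    simp [Set.mem_pi]
  rw [hset, pathLaw, Measure.infinitePi_pi _ fun _ _ => measurableSet_Ioi, Finset.prod_ne_zero_iff]
  intro p hp
  simp only [Finset.mem_image, Finset.mem_univ, true_and] at hp
  obtain ⟨i, rfl⟩ := hp
  exact expMeasure_Ioi_pos (hlam i) _

variable {J : ℕ} [NeZero J] {D : Fin J → ℝ} {lam : Fin J → ℝ}
  {ν : Fin J → Measure ℝ} [∀ p, IsProbabilityMeasure (marginal lam ν p)]

/-! ### The transmitter when it is stable -/

theorem after_zero {τ : ℕ → Path J → ℝ} (hτ : IsClock D τ) (ω : Path J) : after D τ 0 ω = ω := by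
  funext p
  rcases p with ⟨i, _ | m⟩ | ⟨i, m⟩
  · simp [after, Path.shiftBy, hτ.zero, procState, Path.arr, arrival]
  · simp [after, Path.shiftBy, procState]
  · simp [after, Path.shiftBy, procState]

theorem IsClock.after_add {τ : ℕ → Path J → ℝ} (hτ : IsClock D τ) {k : ℕ} {ω : Path J}
    (h : ω ∈ emptyAt D τ k) (l : ℕ) : after D τ (k + l) ω = after D τ l (after D τ k ω) := by
  have hτl : τ (k + l) ω = τ k ω + τ l (after D τ k ω) := by
    cases l with
    | zero => rw [hτ.zero, add_zero, add_zero]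
    | succ l => exact hτ.add k l ω h
  have hr := hτ.restart h
  funext p
  rcases p with ⟨i, _ | m⟩ | ⟨i, m⟩
  · change ω.arr i ((procState ω.arr D (k + l)).served i) - τ (k + l) ω
      = (after D τ k ω).arr i ((procState (after D τ k ω).arr D l).served i) - τ l (after D τ k ω)
    rw [hr.served, hr.shift, hτl]
    ring
  · change ω (Sum.inl (i, (procState ω.arr D (k + l)).served i + (m + 1)))
      = ω (Sum.inl (i, (procState ω.arr D k).served i
        + ((procState (after D τ k ω).arr D l).served i + m + 1)))
    rw [hr.served]
    congr 3
    ring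
  · change ω (Sum.inr (i, (procState ω.arr D (k + l)).served i + m))
      = ω (Sum.inr (i, (procState ω.arr D k).served i
        + ((procState (after D τ k ω).arr D l).served i + m)))
    rw [hr.served, add_assoc]

theorem Recurrent.after_eq (hD : ∀ i, 0 ≤ D i) (c : ℕ) {ω : Path J} (h : Recurrent D ω) :
    after D (procClock D) (cycleSum (PAoI.procCycle D) (cycleLength D) c ω) ω
      = (PAoI.procCycle D)^[c] ω := by
  induction c generalizing ω with
  | zero => exact after_zero (isClock_procClock hD) ω
  | succ c ih =>
    rw [cycleSum_succ, (isClock_procClock hD).after_add h.mem_emptyAt, Function.iterate_succ_apply,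
      ← ih h.procCycle]
    rfl

/-- Work left in the transmission queue when the processor completes `k` services. -/
noncomputable def backlog (D : Fin J → ℝ) (k : ℕ) (ω : Path J) : ℝ :=
  transClock D k ω - procClock D k ω

theorem backlog_nonneg (k : ℕ) (ω : Path J) : 0 ≤ backlog D k ω :=
  sub_nonneg.2 (free_le_transFree ω.trans_nonneg k)

-- If the transmitter stays busy, the backlog gains the new work and loses the elapsed time. If it
-- idles, the final backlog is at most the new work. Truncating the elapsed time at `M` makes the
-- resulting error at most `M`, and none at all when the initial backlog is at least `M`.
open Classical in
theorem backlog_step (hD : ∀ i, 0 ≤ D i) {k : ℕ} {ω : Path J}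
    (h : ω ∈ emptyAt D (procClock D) k) (l : ℕ) (M : ℝ) :
    backlog D (k + l) ω + min (procState (after D (procClock D) k ω).arr D l).free M
      ≤ backlog D k ω + serviceSum D l (after D (procClock D) k ω)
        + M * if backlog D k ω < M then 1 else 0 := by
  have hr := (isClock_procClock hD).restart h
  set ω' := after D (procClock D) k ω with hω'
  have h1 := hr.transFree_le (z := ω.trans) (z' := ω'.trans) (fun i m => rfl) (V := backlog D k ω)
    (by rw [backlog]; exact (add_sub_cancel _ _).ge) l
  have h2 := transFree_le_free_add (t := ω'.arr) hD ω'.trans_nonneg l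
  have h3 := free_add hD h l
  rw [← hω'] at h3
  change _ ≤ _ + max (_ + serviceSum D l ω') _ at h1
  change _ ≤ _ + serviceSum D l ω' at h2
  have h4 : backlog D (k + l) ω = transFree ω.arr D ω.trans (k + l) -
    (procState ω.arr D (k + l)).free :=
    rfl
  have h5 := backlog_nonneg (D := D) k ω
  have h6 := serviceSum_nonneg (D := D) l ω'
  have h7 : procClock D k ω = (procState ω.arr D k).free := rfl
  rw [h7] at h1
  rw [h4, h3]
  have h8 := min_le_left (procState ω'.arr D l).free M
  have h9 := min_le_right (procState ω'.arr D l).free M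
  rcases max_cases (backlog D k ω + serviceSum D l ω') (transFree ω'.arr D ω'.trans l) with
    ⟨h10, -⟩ | ⟨h10, -⟩
  · rw [h10] at h1
    have h11 : 0 ≤ M * (if backlog D k ω < M then (1 : ℝ) else 0) := by
      split_ifs with hb
      · linarith
      · simp
    linarith
  · rw [h10] at h1
    split_ifs with hb <;> linarith

-- Telescoped over cycles, the excess of truncated cycle time over work is paid for by the cycles
-- that start with backlog below `M`; a positive mean excess therefore forces many of them.
open Classical in
theorem Recurrent.sum_min_le (hD : ∀ i, 0 ≤ D i) {ω : Path J} (h : Recurrent D ω) (M : ℝ) (c : ℕ) :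
    ∑ i ∈ Finset.range c, min (cycleTime D ((PAoI.procCycle D)^[i] ω)) M
      ≤ ∑ i ∈ Finset.range c, cycleTrans D ((PAoI.procCycle D)^[i] ω)
        + M * ∑ i ∈ Finset.range c,
          if backlog D (cycleSum (PAoI.procCycle D) (cycleLength D) i ω) ω < M then (1 : ℝ)
            else 0 := by
  suffices hs : backlog D (cycleSum (PAoI.procCycle D) (cycleLength D) c ω) ω
      + ∑ i ∈ Finset.range c, min (cycleTime D ((PAoI.procCycle D)^[i] ω)) M
      ≤ ∑ i ∈ Finset.range c, cycleTrans D ((PAoI.procCycle D)^[i] ω)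
        + M * ∑ i ∈ Finset.range c,
          if backlog D (cycleSum (PAoI.procCycle D) (cycleLength D) i ω) ω < M then (1 : ℝ)
            else 0 by
    have := backlog_nonneg (D := D) (cycleSum (PAoI.procCycle D) (cycleLength D) c ω) ω
    linarith
  induction c with
  | zero => simp [cycleSum, backlog, transClock, procClock, transFree, procState]
  | succ c ih =>
    have h1 := backlog_step hD (h.state hD c).1 (cycleLength D ((PAoI.procCycle D)^[c] ω)) M
    rw [h.after_eq hD] at h1
    rw [cycleSum_succ', Finset.sum_range_succ, Finset.sum_range_succ, Finset.sum_range_succ]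
    change _ + min (cycleTime D ((PAoI.procCycle D)^[c] ω)) M
      ≤ _ + cycleTrans D ((PAoI.procCycle D)^[c] ω) + _ at h1
    linarith

theorem sum_comp_le_of_strictMono {f : ℕ → ℝ} (hf : ∀ k, 0 ≤ f k) {κ : ℕ → ℕ} (hκ : StrictMono κ)
    {c n : ℕ} (hn : κ c ≤ n) : ∑ i ∈ Finset.range c, f (κ i) ≤ ∑ k ∈ Finset.range n, f k := by
  rw [← Finset.sum_image (g := κ) (s := Finset.range c) (f := f) hκ.injective.injOn]
  refine Finset.sum_le_sum_of_subset_of_nonneg (fun k hk => ?_) fun k _ _ => hf k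
  obtain ⟨i, hi, rfl⟩ := Finset.mem_image.1 hk
  exact Finset.mem_range.2 ((hκ (Finset.mem_range.1 hi)).trans_le hn)

theorem Recurrent.strictMono {ω : Path J} (h : Recurrent D ω) :
    StrictMono fun c => cycleSum (PAoI.procCycle D) (cycleLength D) c ω :=
  strictMono_nat_of_lt_succ fun c => by
    rw [cycleSum_succ']
    have := (firstReturn_spec (h c).2).1
    exact Nat.lt_add_of_pos_right this

theorem eventually_sum_lt {a : ℕ → ℝ} (ha : ∀ i, 0 ≤ a i) {m : ℝ≥0∞}
    (h : Tendsto (fun n : ℕ => (∑ i ∈ Finset.range n, ENNReal.ofReal (a i)) / n) atTop (𝓝 m))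
    {α : ℝ} (hα : m < ENNReal.ofReal α) : ∀ᶠ n : ℕ in atTop, ∑ i ∈ Finset.range n, a i ≤ α * n := by
  filter_upwards [h.eventually (gt_mem_nhds hα), eventually_gt_atTop 0] with n hn hn0
  have hn' : (0 : ℝ) < n := by exact_mod_cast hn0
  rw [← ENNReal.ofReal_sum_of_nonneg fun i _ => ha i, ← ENNReal.ofReal_natCast,
    ← ENNReal.ofReal_div_of_pos hn'] at hn
  exact ((div_lt_iff₀ hn').1 ((ENNReal.ofReal_lt_ofReal_iff'.1 hn).1)).le

theorem eventually_lt_sum {a : ℕ → ℝ} (ha : ∀ i, 0 ≤ a i) {m : ℝ≥0∞}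
    (h : Tendsto (fun n : ℕ => (∑ i ∈ Finset.range n, ENNReal.ofReal (a i)) / n) atTop (𝓝 m))
    {β : ℝ} (hβ : ENNReal.ofReal β < m) : ∀ᶠ n : ℕ in atTop, β * n ≤ ∑ i ∈ Finset.range n, a i := by
  filter_upwards [h.eventually (lt_mem_nhds hβ), eventually_gt_atTop 0] with n hn hn0
  have hn' : (0 : ℝ) < n := by exact_mod_cast hn0
  rw [← ENNReal.ofReal_sum_of_nonneg fun i _ => ha i, ← ENNReal.ofReal_natCast,
    ← ENNReal.ofReal_div_of_pos hn'] at hn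
  exact ((lt_div_iff₀ hn').1 ((ENNReal.ofReal_lt_ofReal_iff'.1 hn).1)).le

theorem lintegral_cycleTrans_lt (hlam : ∀ i, 0 < lam i) (hD : ∀ i, 0 < D i)
    (hρ : ∑ i, lam i * D i < 1)
    (hT : ∑ i, ENNReal.ofReal (lam i) * ∫⁻ x, ENNReal.ofReal x ∂(ν i) < 1) :
    ∫⁻ ω, ENNReal.ofReal (cycleTrans D ω) ∂(pathLaw lam ν)
      < ∫⁻ ω, ENNReal.ofReal (cycleTime D ω) ∂(pathLaw lam ν) := by
  have h := ENNReal.mul_lt_mul_left (lintegral_cycleTime_ne_zero (ν := ν) hlam hD hρ)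
    (lintegral_cycleTime_ne_top (ν := ν) hlam hD hρ) hT
  rw [lintegral_cycleTrans hlam hD hρ]
  simpa using h

theorem exists_lt_lintegral_min {E : Type*} [MeasurableSpace E] {μ : Measure E} {L : E → ℝ}
    (hL : Measurable L) {a : ℝ≥0∞} (h : a < ∫⁻ ω, ENNReal.ofReal (L ω) ∂μ) :
    ∃ M : ℝ, 0 < M ∧ a < ∫⁻ ω, ENNReal.ofReal (min (L ω) M) ∂μ := by
  have ht : Tendsto (fun n : ℕ => ∫⁻ ω, ENNReal.ofReal (min (L ω) n) ∂μ) atTop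
      (𝓝 (∫⁻ ω, ENNReal.ofReal (L ω) ∂μ)) := by
    refine lintegral_tendsto_of_tendsto_of_monotone
      (fun n => (hL.min measurable_const).ennreal_ofReal.aemeasurable) (ae_of_all _ fun ω => ?_)
      (ae_of_all _ fun ω => ?_)
    · intro a b hab
      exact ENNReal.ofReal_le_ofReal (min_le_min le_rfl (by exact_mod_cast hab))
    · refine tendsto_const_nhds.congr' ?_
      filter_upwards [tendsto_natCast_atTop_atTop.eventually_ge_atTop (L ω)] with n hn
      rw [min_eq_left hn]
  obtain ⟨n, h1, h2⟩ := ((ht.eventually (lt_mem_nhds h)).and (eventually_gt_atTop 0)).exists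
  exact ⟨n, by exact_mod_cast h2, h1⟩

open Classical in
/-- A positive fraction of the services complete with an empty processor and a small backlog. -/
theorem ae_small_backlog (hlam : ∀ i, 0 < lam i) (hD : ∀ i, 0 < D i) (hρ : ∑ i, lam i * D i < 1)
    (hT : ∑ i, ENNReal.ofReal (lam i) * ∫⁻ x, ENNReal.ofReal x ∂(ν i) < 1) :
    ∃ M : ℝ, 0 < M ∧ ∃ δ : ℝ, 0 < δ ∧ ∀ᵐ ω ∂(pathLaw lam ν), ∀ᶠ n : ℕ in atTop,
      δ * n ≤ ∑ k ∈ Finset.range n,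
        if ω ∈ emptyAt D (procClock D) k ∧ backlog D k ω < M then (1 : ℝ) else 0 := by
  have hD' := fun i => (hD i).le
  have hcs := cycleShift_procCycle (ν := ν) hlam hD hρ
  -- `M` is large enough that the mean truncated cycle time still exceeds the mean work. Then `α <
  -- β` separate these means, and `a` exceeds the mean number of services per cycle.
  obtain ⟨M, hM, hlt⟩ := exists_lt_lintegral_min (measurable_cycleTime hD')
    (lintegral_cycleTrans_lt (ν := ν) hlam hD hρ hT)
  obtain ⟨α, hα0, hα, hαm⟩ := ENNReal.lt_iff_exists_real_btwn.1 hlt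
  obtain ⟨β, hβ0, hβ, hβm⟩ := ENNReal.lt_iff_exists_real_btwn.1 hαm
  have hαβ : α < β := (ENNReal.ofReal_lt_ofReal_iff'.1 hβ).1
  have hKt := lintegral_cycleLength_ne_top (ν := ν) hlam hD hρ
  obtain ⟨a, ha0, ha, -⟩ := ENNReal.lt_iff_exists_real_btwn.1 hKt.lt_top
  have hapos : 0 < a := by
    rcases ha0.lt_or_eq with h | h
    · exact h
    · rw [← h] at ha
      simp at ha
  refine ⟨M, hM, (β - α) / (2 * a * M), div_pos (sub_pos.2 hαβ) (by positivity), ?_⟩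
  have hKm : Measurable fun ω : Path J => ENNReal.ofReal (cycleLength D ω) :=
    (measurable_from_nat.comp (measurable_cycleLength hD')).ennreal_ofReal
  filter_upwards [ae_recurrent (ν := ν) hlam hD hρ,
    hcs.slln (measurable_cycleTrans hD').ennreal_ofReal fun _ _ h => by rw [cycleTrans_congr hD' h],
    hcs.slln ((measurable_cycleTime hD').min measurable_const).ennreal_ofReal
      fun _ _ h => by rw [cycleTime_congr hD' h],
    hcs.slln hKm fun _ _ h => by rw [cycleLength, h.1]] with ω hr hZ hL hK
  simp only [ENNReal.ofReal_natCast] at hK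
  have e1 := eventually_sum_lt (fun i => cycleTrans_nonneg _) hZ hα
  have e2 := eventually_lt_sum
    (fun i => le_min (cycleTime_nonneg hD' _) hM.le) hL hβm
  have e3 := eventually_sum_lt (a := fun i => (cycleLength D ((procCycle D)^[i] ω) : ℝ))
    (fun i => Nat.cast_nonneg _) (by simpa only [ENNReal.ofReal_natCast] using hK) ha
  -- About `n / a` cycles are complete within `n` services, and each contributes excess at least `β
  -- - α` on average. The factor `2` in `δ` pays for the floor.
  have hfl : Tendsto (fun n : ℕ => ⌊(n : ℝ) / a⌋₊) atTop atTop :=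
    tendsto_nat_floor_atTop.comp (tendsto_natCast_atTop_atTop.atTop_div_const hapos)
  filter_upwards [hfl.eventually (e1.and (e2.and e3)),
    tendsto_natCast_atTop_atTop.eventually_ge_atTop (2 * a)] with n ⟨f1, f2, f3⟩ hn
  set c := ⌊(n : ℝ) / a⌋₊ with hc
  have hca : (c : ℝ) * a ≤ n := (le_div_iff₀ hapos).1 (Nat.floor_le (by positivity))
  have hκ : cycleSum (procCycle D) (cycleLength D) c ω ≤ n := by
    have : ((cycleSum (procCycle D) (cycleLength D) c ω : ℕ) : ℝ) ≤ n := by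
      rw [cycleSum]
      push_cast
      linarith
    exact_mod_cast this
  have h1 := hr.sum_min_le hD' M c
  have h2 := sum_comp_le_of_strictMono (f := fun k =>
    if ω ∈ emptyAt D (procClock D) k ∧ backlog D k ω < M then (1 : ℝ) else 0)
    (fun k => by split_ifs <;> simp) hr.strictMono hκ
  have h3 : ∀ i, ω ∈ emptyAt D (procClock D) (cycleSum (procCycle D) (cycleLength D) i ω) :=
    fun i => (hr.state hD' i).1
  simp only [h3, true_and] at h2
  have h4 : (β - α) * c ≤ M * ∑ k ∈ Finset.range n,
      if ω ∈ emptyAt D (procClock D) k ∧ backlog D k ω < M then (1 : ℝ) else 0 := by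
    have := mul_le_mul_of_nonneg_left h2 hM.le
    linarith
  have h5 : (n : ℝ) ≤ 2 * a * c := by
    have h6 : (n : ℝ) / a < c + 1 := Nat.lt_floor_add_one _
    rw [div_lt_iff₀ hapos] at h6
    nlinarith
  have h7 := sub_pos.2 hαβ
  rw [div_mul_eq_mul_div, div_le_iff₀ (by positivity)]
  nlinarith

theorem measurable_backlog (k : ℕ) : Measurable (backlog (J := J) D k) :=
  (measurable_transFree k).sub (measurable_free k)

theorem backlog_congr (hD : ∀ i, 0 ≤ D i) {k : ℕ} {ω ω' : Path J}
    (hω : ω ∈ emptyAt D (procClock D) k) (hω' : ω' ∈ emptyAt D (procClock D) k)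
    (h : SameHead D k ω ω') : backlog D k ω = backlog D k ω' := by
  have hs := (isClock_procClock hD).sameServices hD hω hω' h
  rw [backlog, backlog, (isClock_transClock hD).congr k ω ω' hs (IsClock.trans_eq h) k le_rfl,
    (isClock_procClock hD).congr k ω ω' hs (IsClock.trans_eq h) k le_rfl]

/-- If the processor is empty with backlog below `M` and every source stays silent for a further
time `M`, the transmitter empties before the next arrival. Regeneration of the processor at `k`
makes the silence independent of the backlog. -/
theorem mul_measure_le_emptyAt_transClock (hlam : ∀ i, 0 < lam i) (hD : ∀ i, 0 ≤ D i) (M : ℝ)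
    (k : ℕ) :
    pathLaw lam ν (emptyAt D (procClock D) k ∩ {ω | backlog D k ω < M})
        * pathLaw lam ν {ω : Path J | ∀ i, M < ω (Sum.inl (i, 0))}
      ≤ pathLaw lam ν (emptyAt D (transClock D) k) := by
  have hτ := isClock_procClock (J := J) hD
  set F : Set (Path J) := {ω | backlog D k ω < M}
  set G : Set (Path J) := {ω : Path J | ∀ i, M < ω (Sum.inl (i, 0))} with hG
  have hF : MeasurableSet F := measurableSet_lt (measurable_backlog k) measurable_const
  have hGm : MeasurableSet G := by
    rw [hG, Set.ofPred_forall]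
    exact MeasurableSet.iInter fun i => measurableSet_lt measurable_const (measurable_pi_apply _)
  have hmain := hτ.lintegral_mul (ν := ν) hlam hD k (f := F.indicator 1) (g := G.indicator 1)
    (measurable_one.indicator hF) (measurable_one.indicator hGm) (fun ω ω' h1 h2 h3 => by
      simp only [Set.indicator_apply, F, Set.mem_ofPred_eq, backlog_congr hD h1 h2 h3,
        Pi.one_apply])
  rw [lintegral_indicator_one hF, lintegral_indicator_one hGm, Measure.restrict_apply hF,
    Set.inter_comm] at hmain
  have hA := hτ.measurableSet_emptyAt k
  rw [← hmain, ← lintegral_indicator hA,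
    ← lintegral_indicator_one ((isClock_transClock hD).measurableSet_emptyAt k)]
  refine lintegral_mono fun ω => ?_
  by_cases h1 : ω ∈ emptyAt D (procClock D) k
  · by_cases h2 : ω ∈ F
    · by_cases h3 : after D (procClock D) k ω ∈ G
      · have h4 : ω ∈ emptyAt D (transClock D) k := fun i => by
          have h5 : after D (procClock D) k ω (Sum.inl (i, 0))
            = ω.arr i ((procState ω.arr D k).served i) - procClock D k ω := rfl
          have h6 := h3 i
          have h7 : transClock D k ω - procClock D k ω < M := h2
          rw [h5] at h6
          linarith
        simp [h1, h2, h3, h4]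
      · rw [Set.indicator_of_mem h1, Set.indicator_of_notMem h3, mul_zero]
        exact zero_le
    · rw [Set.indicator_of_mem h1, Set.indicator_of_notMem h2, zero_mul]
      exact zero_le
  · rw [Set.indicator_of_notMem h1]
    exact zero_le

theorem transClock_density (hlam : ∀ i, 0 < lam i) (hD : ∀ i, 0 < D i) (hρ : ∑ i, lam i * D i < 1)
    (hT : ∑ i, ENNReal.ofReal (lam i) * ∫⁻ x, ENNReal.ofReal x ∂(ν i) < 1) :
    ∃ δ : ℝ≥0∞, δ ≠ 0 ∧ ∀ᶠ n : ℕ in atTop,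
      δ * n ≤ ∑ k ∈ Finset.range n, pathLaw lam ν (emptyAt D (transClock D) k) := by
  classical
  have hD' := fun i => (hD i).le
  obtain ⟨M, hM, δ, hδ, hae⟩ := ae_small_backlog (ν := ν) hlam hD hρ hT
  set B : ℕ → Set (Path J) := fun k => emptyAt D (procClock D) k ∩ {ω | backlog D k ω < M} with hB
  have hBm : ∀ k, MeasurableSet (B k) := fun k =>
    ((isClock_procClock hD').measurableSet_emptyAt k).inter
      (measurableSet_lt (measurable_backlog k) measurable_const)
  have hI := fun k => (measurable_one (α := ℝ≥0∞) (β := Path J)).indicator (hBm k)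
  have hev := eventually_le_lintegral (μ := pathLaw lam ν) hδ
    (I := fun n ω => ∑ k ∈ Finset.range n, (B k).indicator 1 ω)
    (fun n => Finset.measurable_fun_sum _ fun k _ => hI k) (by
      filter_upwards [hae] with ω hω
      filter_upwards [hω] with n hn
      refine (ENNReal.ofReal_le_ofReal hn).trans_eq ?_
      rw [ENNReal.ofReal_sum_of_nonneg fun k _ => by split_ifs <;> simp]
      refine Finset.sum_congr rfl fun k _ => ?_
      by_cases h : ω ∈ emptyAt D (procClock D) k ∧ backlog D k ω < M
      · rw [if_pos h, Set.indicator_of_mem (show ω ∈ B k from h)]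
        simp
      · rw [if_neg h, Set.indicator_of_notMem (show ω ∉ B k from h)]
        simp)
  refine ⟨ENNReal.ofReal (δ / 2) * pathLaw lam ν {ω : Path J | ∀ i, M < ω (Sum.inl (i, 0))},
    mul_ne_zero (by simpa using hδ) (pathLaw_forall_lt_ne_zero hlam M), ?_⟩
  filter_upwards [hev] with n hn
  rw [lintegral_finsetSum _ fun k _ => hI k] at hn
  simp_rw [lintegral_indicator_one (hBm _)] at hn
  calc _ = ENNReal.ofReal (δ / 2) * n
        * pathLaw lam ν {ω : Path J | ∀ i, M < ω (Sum.inl (i, 0))} := by ring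
    _ ≤ (∑ k ∈ Finset.range n, pathLaw lam ν (B k))
        * pathLaw lam ν {ω : Path J | ∀ i, M < ω (Sum.inl (i, 0))} := by gcongr
    _ ≤ _ := by
      rw [Finset.sum_mul]
      exact Finset.sum_le_sum fun k _ => mul_measure_le_emptyAt_transClock hlam hD' M k

theorem tsum_noReturn_transClock (hlam : ∀ i, 0 < lam i) (hD : ∀ i, 0 < D i)
    (hρ : ∑ i, lam i * D i < 1)
    (hT : ∑ i, ENNReal.ofReal (lam i) * ∫⁻ x, ENNReal.ofReal x ∂(ν i) < 1) :
    ∑' m, pathLaw lam ν (noReturn (emptyAt D (transClock D)) m) ≠ ∞ := by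
  obtain ⟨δ, hδ, hu⟩ := transClock_density (ν := ν) hlam hD hρ hT
  have hD' := fun i => (hD i).le
  exact ((isClock_transClock hD').regeneration hlam hD').tsum_noReturn_ne_top hδ hu

end PAoI

namespace PAoI

theorem tendsto_cesaro_top {a : ℕ → ℝ≥0∞} (h : Tendsto a atTop (𝓝 ∞)) :
    Tendsto (fun n : ℕ => (∑ k ∈ Finset.range n, a k) / n) atTop (𝓝 ∞) := by
  refine ENNReal.tendsto_nhds_top fun m => ?_
  obtain ⟨N, hN⟩ := eventually_atTop.1 (h.eventually (lt_mem_nhds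
    (ENNReal.natCast_lt_top (2 * (m + 1)))))
  filter_upwards [eventually_ge_atTop (2 * N + 1)] with n hn
  have h1 : (((2 * (m + 1)) * (n - N) : ℕ) : ℝ≥0∞) ≤ ∑ k ∈ Finset.range n, a k := by
    calc (((2 * (m + 1)) * (n - N) : ℕ) : ℝ≥0∞)
        = ∑ _k ∈ Finset.Ico N n, ((2 * (m + 1) : ℕ) : ℝ≥0∞) := by
          rw [Finset.sum_const, Nat.card_Ico, nsmul_eq_mul, mul_comm]
          push_cast
          ring
      _ ≤ ∑ k ∈ Finset.Ico N n, a k :=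
          Finset.sum_le_sum fun k hk => (hN k (Finset.mem_Ico.1 hk).1).le
      _ ≤ _ := Finset.sum_le_sum_of_subset fun k hk =>
          Finset.mem_range.2 (Finset.mem_Ico.1 hk).2
  have h2 : (((m + 1) * n : ℕ) : ℝ≥0∞) ≤ ∑ k ∈ Finset.range n, a k := by
    refine le_trans (Nat.cast_le.2 ?_) h1
    have h3 : n ≤ 2 * (n - N) := by omega
    calc (m + 1) * n ≤ (m + 1) * (2 * (n - N)) := Nat.mul_le_mul_left _ h3
      _ = _ := by ring
  have hn0 : (n : ℝ≥0∞) ≠ 0 := by simp; omega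
  calc (m : ℝ≥0∞) < ((m + 1 : ℕ) : ℝ≥0∞) := Nat.cast_lt.2 (Nat.lt_succ_self m)
    _ ≤ _ := by
      rw [ENNReal.le_div_iff_mul_le (Or.inl hn0) (Or.inl (ENNReal.natCast_ne_top n))]
      exact_mod_cast h2

/-! ### Averages of peak ages -/

theorem tendsto_numDelivered {d : ℕ → ℝ} (hd : Tendsto d atTop atTop) :
    Tendsto (numDelivered d) atTop atTop := by
  refine tendsto_atTop.2 fun n => ?_
  have h : ∀ᶠ T : ℝ in atTop, ∀ m ∈ Finset.range n, d m ≤ T :=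
    (Finset.eventually_all _).2 fun m _ => eventually_ge_atTop (d m)
  filter_upwards [h] with T hT
  have hfin : {m | d m ≤ T}.Finite := by
    have := hd.eventually (eventually_gt_atTop T)
    rw [← Nat.cofinite_eq_atTop, eventually_cofinite] at this
    simpa using this
  calc n = (Finset.range n : Set ℕ).ncard := by rw [Set.ncard_coe_finset, Finset.card_range]
    _ ≤ _ := Set.ncard_le_ncard (fun m hm => hT m hm) hfin

/-- The interarrival terms telescope to the last arrival time. -/
theorem sum_peakAge (a : ℝ) (t d : ℕ → ℝ) (n : ℕ) :
    ∑ m ∈ Finset.range (n + 1), peakAge a t d m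
      = a + t n + ∑ m ∈ Finset.range (n + 1), (d m - t m) := by
  induction n with
  | zero => simp [peakAge]
  | succ n ih =>
    rw [Finset.sum_range_succ, ih, Finset.sum_range_succ _ (n + 1), peakAge]
    ring

/-- The number delivered tends to infinity with `T`, so it suffices to average over `n` packages.
The initial age disappears, the last arrival time contributes `l` and the sojourn times contribute
`m`. -/
theorem tendsto_avgPeakAge {a : ℝ} (ha : 0 ≤ a) {t d : ℕ → ℝ} (ht : ∀ n, 0 ≤ t n)
    (htd : ∀ n, t n ≤ d n) {l m : ℝ≥0∞} (hl : l ≠ 0)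
    (htl : Tendsto (fun n : ℕ => ENNReal.ofReal (t n) / ((n + 1 : ℕ) : ℝ≥0∞)) atTop (𝓝 l))
    (hm : Tendsto (fun n : ℕ => (∑ k ∈ Finset.range n, ENNReal.ofReal (d k - t k)) / n) atTop
      (𝓝 m)) :
    Tendsto (fun T : ℝ => ENNReal.ofReal (avgPeakAge a t d T)) atTop (𝓝 (l + m)) := by
  have htop : Tendsto t atTop atTop := by
    have h1 := ENNReal.Tendsto.mul htl (Or.inl hl)
      (ENNReal.tendsto_nat_nhds_top.comp (tendsto_add_atTop_nat 1)) (Or.inl ENNReal.top_ne_zero)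
    rw [ENNReal.mul_top hl] at h1
    rw [← ENNReal.tendsto_ofReal_nhds_top]
    refine h1.congr fun n => ?_
    exact ENNReal.div_mul_cancel (by simp) (ENNReal.natCast_ne_top _)
  have hd := tendsto_numDelivered (tendsto_atTop_mono htd htop)
  have havg : Tendsto (fun n : ℕ => ENNReal.ofReal
      ((∑ k ∈ Finset.range n, peakAge a t d k) / (n : ℝ))) atTop (𝓝 (l + m)) := by
    rw [← tendsto_add_atTop_iff_nat 1]
    have h0 : Tendsto (fun n : ℕ => ENNReal.ofReal a / ((n + 1 : ℕ) : ℝ≥0∞)) atTop (𝓝 0) := by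
      have := ENNReal.Tendsto.const_div (a := ENNReal.ofReal a)
        (ENNReal.tendsto_nat_nhds_top.comp (tendsto_add_atTop_nat 1))
        (Or.inr ENNReal.ofReal_ne_top)
      rwa [ENNReal.div_top] at this
    have h1 := (h0.add htl).add (hm.comp (tendsto_add_atTop_nat 1))
    rw [zero_add] at h1
    refine h1.congr fun n => ?_
    have hn : (0 : ℝ) < ((n + 1 : ℕ) : ℝ) := by positivity
    have hs : 0 ≤ ∑ k ∈ Finset.range (n + 1), (d k - t k) :=
      Finset.sum_nonneg fun k _ => sub_nonneg.2 (htd k)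
    rw [Function.comp_apply, ENNReal.ofReal_div_of_pos hn, ENNReal.ofReal_natCast, sum_peakAge,
      ENNReal.ofReal_add (add_nonneg ha (ht n)) hs, ENNReal.ofReal_add ha (ht n),
      ENNReal.ofReal_sum_of_nonneg fun k _ => sub_nonneg.2 (htd k), ENNReal.add_div,
      ENNReal.add_div]
  exact havg.comp hd

section Waits

variable {J : ℕ} [NeZero J] {t : Fin J → ℕ → ℝ} {D : Fin J → ℝ} {z : Fin J → ℕ → ℝ} {j : Fin J}
  {n : ℕ}

theorem delivery_eq (h : ∃ k, n < (procState t D k).served j) :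
    delivery t D z j n
      = t j n + (D j + procWait t D j n + z j n + transWait t D z j n) := by
  obtain ⟨h1, h2⟩ := rank_spec h
  rw [delivery, transFree, transWait, procWait, procEnd, h1, h2]
  ring

theorem procWait_nonneg (h : ∃ k, n < (procState t D k).served j) : 0 ≤ procWait t D j n := by
  obtain ⟨h1, h2⟩ := rank_spec h
  have := arrival_le_procBegin (t := t) (D := D) (rank t D j n)
  rw [h1, h2] at this
  exact sub_nonneg.2 this

theorem transWait_nonneg : 0 ≤ transWait t D z j n := sub_nonneg.2 (le_max_right _ _)

end Waits

variable {J : ℕ} [NeZero J] {D : Fin J → ℝ} {lam : Fin J → ℝ}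
  {ν : Fin J → Measure ℝ} [∀ p, IsProbabilityMeasure (marginal lam ν p)]

/-! ### The transmitter when it is overloaded -/

/-- A package in the cycle following the first `c` cycles is transmitted after all work of those
cycles, yet joins the transmission queue before its own cycle ends. -/
theorem Recurrent.le_transWait (hD : ∀ i, 0 ≤ D i) {ω : Path J} (h : Recurrent D ω) {j : Fin J}
    {c n : ℕ} (h1 : cycleSum (PAoI.procCycle D) (cycleCount D (procClock D) j) c ω ≤ n)
    (h2 : n < cycleSum (PAoI.procCycle D) (cycleCount D (procClock D) j) (c + 1) ω) :
    ∑ i ∈ Finset.range c, cycleTrans D ((PAoI.procCycle D)^[i] ω)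
        - ∑ i ∈ Finset.range (c + 1), cycleTime D ((PAoI.procCycle D)^[i] ω)
      ≤ transWait ω.arr D ω.trans j n := by
  obtain ⟨-, -, hs, hz⟩ := h.state hD c
  obtain ⟨-, hf, hs', -⟩ := h.state hD (c + 1)
  rw [← hs] at h1
  rw [← hs'] at h2
  rw [← hf, ← hz]
  have hr := rank_lt h2
  have hr' : cycleSum (PAoI.procCycle D) (cycleLength D) c ω ≤ rank ω.arr D j n := by
    by_contra hlt
    obtain ⟨h3, h4⟩ := rank_spec ⟨_, h2⟩
    have := procIndex_lt_served (t := ω.arr) (D := D) (not_le.1 hlt)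
    rw [h3, h4] at this
    omega
  have e1 := sum_trans_le_transFree (t := ω.arr) (D := D) (z := ω.trans)
    (cycleSum (PAoI.procCycle D) (cycleLength D) c ω)
  have e2 := transFree_mono (t := ω.arr) (D := D) ω.trans_nonneg hr'
  have e3 := free_mono (t := ω.arr) hD (Nat.succ_le_of_lt hr)
  exact sub_le_sub ((e1.trans e2).trans (le_max_left _ _)) e3

/-- With `α < β` between mean cycle time and mean cycle work, the lower bound grows like `(β - α) *
c - α`, where `c` is the cycle of the package. -/
theorem ae_transWait_tendsto_top (hlam : ∀ i, 0 < lam i) (hD : ∀ i, 0 < D i)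
    (hρ : ∑ i, lam i * D i < 1)
    (hT : 1 < ∑ i, ENNReal.ofReal (lam i) * ∫⁻ x, ENNReal.ofReal x ∂(ν i)) (j : Fin J) :
    ∀ᵐ ω ∂(pathLaw lam ν), Tendsto
      (fun n => ENNReal.ofReal (transWait (Path.arr ω) D (Path.trans ω) j n)) atTop (𝓝 ∞) := by
  have hD' := fun i => (hD i).le
  have hcs := cycleShift_procCycle (ν := ν) hlam hD hρ
  have hlt : ∫⁻ ω, ENNReal.ofReal (cycleTime D ω) ∂(pathLaw lam ν)
      < ∫⁻ ω, ENNReal.ofReal (cycleTrans D ω) ∂(pathLaw lam ν) := by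
    have h := ENNReal.mul_lt_mul_left (lintegral_cycleTime_ne_zero (ν := ν) hlam hD hρ)
      (lintegral_cycleTime_ne_top (ν := ν) hlam hD hρ) hT
    rw [lintegral_cycleTrans hlam hD hρ]
    simpa using h
  obtain ⟨α, hα0, hα, hαm⟩ := ENNReal.lt_iff_exists_real_btwn.1 hlt
  obtain ⟨β, hβ0, hβ, hβm⟩ := ENNReal.lt_iff_exists_real_btwn.1 hαm
  have hαβ : α < β := (ENNReal.ofReal_lt_ofReal_iff'.1 hβ).1
  filter_upwards [ae_recurrent (ν := ν) hlam hD hρ, ae_tendsto_cycleCount (ν := ν) hlam hD hρ,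
    hcs.slln (measurable_cycleTrans hD').ennreal_ofReal fun _ _ h => by rw [cycleTrans_congr hD' h],
    hcs.slln (measurable_cycleTime hD').ennreal_ofReal fun _ _ h => by rw [cycleTime_congr hD' h]]
    with ω hr hN hZ hL
  have e1 := eventually_sum_lt (fun i => cycleTime_nonneg hD' _) hL hα
  have e2 := eventually_lt_sum (fun i => cycleTrans_nonneg _) hZ hβm
  rw [ENNReal.tendsto_ofReal_nhds_top]
  refine tendsto_atTop.2 fun R => ?_
  have e3 : ∀ᶠ c : ℕ in atTop, R + α ≤ (β - α) * c :=
    (tendsto_natCast_atTop_atTop.const_mul_atTop (sub_pos.2 hαβ)).eventually_ge_atTop _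
  obtain ⟨c₀, hc₀⟩ := eventually_atTop.1
    (((tendsto_add_atTop_nat 1).eventually e1).and (e2.and e3))
  filter_upwards [eventually_ge_atTop
    (cycleSum (procCycle D) (cycleCount D (procClock D) j) c₀ ω)] with n hn
  obtain ⟨c, h1, h2⟩ := exists_bracket (S := fun c =>
    cycleSum (procCycle D) (cycleCount D (procClock D) j) c ω) (by simp [cycleSum]) (hN j) n
  have hc : c₀ ≤ c := by
    by_contra hlt
    have := cycleSum_mono (procCycle D) (cycleCount D (procClock D) j) ω
      (Nat.succ_le_of_lt (not_le.1 hlt))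
    simp only [Nat.succ_eq_add_one] at this h2
    omega
  obtain ⟨f1, f2, f3⟩ := hc₀ c hc
  have f4 := hr.le_transWait hD' h1 h2
  push_cast at f1
  linarith

/-- Below critical load the joint cycles have finite mean length. Above it both limits are infinite,
the one for the means by Fatou. At load exactly `1` neither comparison of work and time is strict.
-/
theorem exists_transWait_limit (hlam : ∀ i, 0 < lam i) (hD : ∀ i, 0 < D i)
    (hρ : ∑ i, lam i * D i < 1)
    (hT : ∑ i, ENNReal.ofReal (lam i) * ∫⁻ x, ENNReal.ofReal x ∂(ν i) ≠ 1) (j : Fin J) :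
    ∃ w : ℝ≥0∞, Tendsto (fun n => ∫⁻ ω, ENNReal.ofReal (transWait (Path.arr ω) D (Path.trans ω) j n)
        ∂(pathLaw lam ν)) atTop (𝓝 w) ∧
      ∀ᵐ ω ∂(pathLaw lam ν), Tendsto (fun n : ℕ => (∑ k ∈ Finset.range n,
        ENNReal.ofReal (transWait (Path.arr ω) D (Path.trans ω) j k)) / n) atTop (𝓝 w) := by
  rcases hT.lt_or_gt with h | h
  · refine transWait_limit hlam (fun i => (hD i).le) (tsum_noReturn_transClock hlam hD hρ h) ?_
    filter_upwards [ae_served (ν := ν) hlam hD hρ] with ω hω using hω j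
  · have hae := ae_transWait_tendsto_top (ν := ν) hlam hD hρ h j
    refine ⟨∞, ?_, hae.mono fun ω hω => tendsto_cesaro_top hω⟩
    have hm : ∀ n, Measurable fun ω : Path J =>
        ENNReal.ofReal (transWait (Path.arr ω) D (Path.trans ω) j n) := fun n =>
      (measurable_transWait j n).ennreal_ofReal
    have hf := lintegral_liminf_le (μ := pathLaw lam ν) (u := atTop) hm
    have h1 : ∫⁻ ω, liminf (fun n => ENNReal.ofReal (transWait (Path.arr ω) D (Path.trans ω) j n))
        atTop ∂(pathLaw lam ν) = ∞ := by
      rw [lintegral_congr_ae (g := fun _ => ∞) (hae.mono fun ω hω => hω.liminf_eq)]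
      simp
    rw [h1, top_le_iff] at hf
    exact tendsto_of_le_liminf_of_limsup_le hf.ge le_top

theorem exists_procWait_limit (hlam : ∀ i, 0 < lam i) (hD : ∀ i, 0 < D i)
    (hρ : ∑ i, lam i * D i < 1) (j : Fin J) :
    ∃ w : ℝ≥0∞, Tendsto (fun n => ∫⁻ ω, ENNReal.ofReal (procWait (Path.arr ω) D j n)
        ∂(pathLaw lam ν)) atTop (𝓝 w) ∧
      ∀ᵐ ω ∂(pathLaw lam ν), Tendsto (fun n : ℕ => (∑ k ∈ Finset.range n,
        ENNReal.ofReal (procWait (Path.arr ω) D j k)) / n) atTop (𝓝 w) := by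
  have hD' := fun i => (hD i).le
  refine (isClock_procClock hD').procWait_limit hlam hD' (emptyAt_transClock_subset 1)
    (tsum_noReturn_procClock hlam hD hρ) ?_
  filter_upwards [ae_served (ν := ν) hlam hD hρ] with ω hω using hω j

/-- The average peak age along a path. -/
theorem path_avgPeakAge (hlam : ∀ i, 0 < lam i) (hD : ∀ i, 0 < D i)
    (hρ : ∑ i, lam i * D i < 1)
    (hT : ∑ i, ENNReal.ofReal (lam i) * ∫⁻ x, ENNReal.ofReal x ∂(ν i) ≠ 1) (j : Fin J) :
    ∃ EWP EWT : ℝ≥0∞,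
      Tendsto (fun n => ∫⁻ ω, ENNReal.ofReal (procWait (Path.arr ω) D j n)
        ∂(pathLaw lam ν)) atTop (𝓝 EWP) ∧
      Tendsto (fun n => ∫⁻ ω, ENNReal.ofReal (transWait (Path.arr ω) D (Path.trans ω) j n)
        ∂(pathLaw lam ν)) atTop (𝓝 EWT) ∧
      ∀ᵐ ω ∂(pathLaw lam ν), ∀ a : ℝ, 0 ≤ a → Tendsto
        (fun T : ℝ => ENNReal.ofReal
          (avgPeakAge a (Path.arr ω j) (delivery (Path.arr ω) D (Path.trans ω) j) T)) atTop
        (𝓝 (ENNReal.ofReal (1 / lam j) + ENNReal.ofReal (D j) + EWP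
          + (∫⁻ z, ENNReal.ofReal z ∂(ν j)) + EWT)) := by
  obtain ⟨EWP, hP, hP'⟩ := exists_procWait_limit (ν := ν) hlam hD hρ j
  obtain ⟨EWT, hQ, hQ'⟩ := exists_transWait_limit hlam hD hρ hT j
  refine ⟨EWP, EWT, hP, hQ, ?_⟩
  filter_upwards [hP', hQ', ae_served (ν := ν) hlam hD hρ, slln_arrival (ν := ν) hlam,
    slln_trans (lam := lam) (ν := ν), ae_inl_pos (lam := lam) (ν := ν)]
    with ω h1 h2 h3 h4 h5 h6 a ha
  have ht : ∀ n, 0 ≤ ω.arr j n := fun n =>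
    Finset.sum_nonneg (s := Finset.range (n + 1)) fun l _ => (h6 j l).le
  have hw : ∀ n, delivery ω.arr D ω.trans j n - ω.arr j n
      = D j + procWait ω.arr D j n + ω.trans j n + transWait ω.arr D ω.trans j n := fun n => by
    rw [delivery_eq (h3 j n), add_sub_cancel_left]
  have hlj := hlam j
  rw [show ∀ a b c d e : ℝ≥0∞, a + b + c + d + e = a + (b + c + d + e) by intros; ring]
  refine tendsto_avgPeakAge ha ht (fun n => sub_nonneg.1 ?_) (by simpa using hlj) ?_ ?_
  · rw [hw]
    exact add_nonneg (add_nonneg (add_nonneg (hD j).le (procWait_nonneg (h3 j n)))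
      (ω.trans_nonneg j n)) transWait_nonneg
  · refine ((ENNReal.continuous_ofReal.tendsto _).comp
      ((h4 j).comp (tendsto_add_atTop_nat 1))).congr fun n => ?_
    rw [Function.comp_apply, Function.comp_apply, ENNReal.ofReal_div_of_pos (by positivity),
      ENNReal.ofReal_natCast]
    rfl
  · have hDc : Tendsto (fun n : ℕ => (∑ _k ∈ Finset.range n, ENNReal.ofReal (D j)) / (n : ℝ≥0∞))
        atTop (𝓝 (ENNReal.ofReal (D j))) := by
      refine tendsto_const_nhds.congr' ?_
      filter_upwards [eventually_gt_atTop 0] with n hn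
      rw [Finset.sum_const, Finset.card_range, nsmul_eq_mul, mul_comm,
        ENNReal.mul_div_cancel_right (by exact_mod_cast hn.ne') (ENNReal.natCast_ne_top n)]
    refine (((hDc.add h1).add (h5 j)).add h2).congr fun n => ?_
    rw [← ENNReal.add_div, ← ENNReal.add_div, ← ENNReal.add_div, ← Finset.sum_add_distrib,
      ← Finset.sum_add_distrib, ← Finset.sum_add_distrib]
    congr 1
    refine Finset.sum_congr rfl fun k _ => ?_
    have hk := procWait_nonneg (h3 j k)
    have hz := ω.trans_nonneg j k
    rw [hw, ENNReal.ofReal_add (by have := (hD j).le; positivity) transWait_nonneg,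
      ENNReal.ofReal_add (by have := (hD j).le; positivity) hz,
      ENNReal.ofReal_add (hD j).le hk]

end PAoI

/-- All quantities are functions of the family of interarrival and transmission times. Independence
identifies the law of this family with `PAoI.pathLaw`, and the result on path space is transported.
-/
theorem lemma1 {J : ℕ} [NeZero J]
    {Ω : Type*} [MeasurableSpace Ω] (P : Measure Ω) [IsProbabilityMeasure P]
    -- arrival rates, package sizes before and after processing, processing rates
    (lam C C' τ : Fin J → ℝ)
    (hlam : ∀ i, 0 < lam i) (hC : ∀ i, C' i < C i) (hτ : ∀ i, 0 < τ i)
    -- laws of the transmission times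
    (ν : Fin J → Measure ℝ) (hν : ∀ i, ∀ᵐ z ∂(ν i), 0 ≤ z)
    -- interarrival times, transmission times, initial ages
    (X Z : Fin J → ℕ → Ω → ℝ) (A₀ : Fin J → Ω → ℝ) (hA₀ : ∀ i ω, 0 ≤ A₀ i ω)
    (hX : ∀ i n, HasLaw (X i n) (expMeasure (lam i)) P)
    (hZ : ∀ i n, HasLaw (Z i n) (ν i) P)
    (hindep : iIndepFun
      (Sum.elim (fun p : Fin J × ℕ => X p.1 p.2) (fun p : Fin J × ℕ => Z p.1 p.2)) P)
    -- the processing queue is stable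
    (hproc : ∑ i, lam i * ((C i - C' i) / τ i) < 1)
    -- the transmission queue is not critically loaded
    (htrans : ∑ i, ENNReal.ofReal (lam i) * ∫⁻ z, ENNReal.ofReal z ∂(ν i) ≠ 1)
    (j : Fin J) :
    let D : Fin J → ℝ := fun i => (C i - C' i) / τ i
    let t : Ω → Fin J → ℕ → ℝ := fun ω => PAoI.arrival (fun i n => X i n ω)
    let z : Ω → Fin J → ℕ → ℝ := fun ω i n => Z i n ω
    ∃ EWP EWT : ℝ≥0∞,
      Tendsto (fun n => ∫⁻ ω, ENNReal.ofReal (PAoI.procWait (t ω) D j n) ∂P) atTop (𝓝 EWP) ∧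
      Tendsto (fun n => ∫⁻ ω, ENNReal.ofReal (PAoI.transWait (t ω) D (z ω) j n) ∂P)
        atTop (𝓝 EWT) ∧
      ∀ᵐ ω ∂P, Tendsto
        (fun T : ℝ => ENNReal.ofReal
          (PAoI.avgPeakAge (A₀ j ω) (t ω j) (PAoI.delivery (t ω) D (z ω) j) T))
        atTop
        (𝓝 (ENNReal.ofReal (1 / lam j) + ENNReal.ofReal ((C j - C' j) / τ j)
          + EWP + (∫⁻ z, ENNReal.ofReal z ∂(ν j)) + EWT)) := by
  intro D t z
  have hpX : ∀ i, IsProbabilityMeasure (expMeasure (lam i)) := fun i =>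
    (hX i 0).isProbabilityMeasure_iff.1 inferInstance
  have hpZ : ∀ i, IsProbabilityMeasure (ν i) := fun i =>
    (hZ i 0).isProbabilityMeasure_iff.1 inferInstance
  have hmar : ∀ p, IsProbabilityMeasure (PAoI.marginal lam ν p) := by
    rintro (p | p)
    exacts [hpX p.1, hpZ p.1]
  have hD : ∀ i, 0 < D i := fun i => div_pos (sub_pos.2 (hC i)) (hτ i)
  let Y : Ω → PAoI.Path J := fun ω p =>
    Sum.elim (fun p : Fin J × ℕ => X p.1 p.2) (fun p : Fin J × ℕ => Z p.1 p.2) p ω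
  have hlaw : ∀ p, HasLaw (Sum.elim (fun p : Fin J × ℕ => X p.1 p.2)
      (fun p : Fin J × ℕ => Z p.1 p.2) p) (PAoI.marginal lam ν p) P := by
    rintro (p | p)
    exacts [hX p.1 p.2, hZ p.1 p.2]
  have hY : HasLaw Y (PAoI.pathLaw lam ν) P :=
    hindep.hasLaw_infinitePi hlaw (aemeasurable_pi_lambda _ fun p => (hlaw p).aemeasurable)
  have harr : ∀ ω, PAoI.Path.arr (Y ω) = t ω := fun ω => rfl
  -- Paths clip transmission times at `0`, which changes nothing almost surely.
  have htr : ∀ᵐ ω ∂P, PAoI.Path.trans (Y ω) = z ω := by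
    have h : ∀ᵐ ω ∂P, ∀ i n, 0 ≤ Z i n ω := ae_all_iff.2 fun i => ae_all_iff.2 fun n =>
      ae_of_ae_map (hZ i n).aemeasurable (by rw [(hZ i n).map_eq]; exact hν i)
    filter_upwards [h] with ω hω
    funext i n
    exact max_eq_left (hω i n)
  obtain ⟨EWP, EWT, h1, h2, h3⟩ := PAoI.path_avgPeakAge (ν := ν) hlam hD hproc htrans j
  refine ⟨EWP, EWT, h1.congr fun n => ?_, h2.congr fun n => ?_, ?_⟩
  · exact (hY.lintegral_comp
      (PAoI.measurable_procWait (D := D) j n).ennreal_ofReal.aemeasurable).symm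
  · rw [← hY.lintegral_comp
      (PAoI.measurable_transWait (D := D) j n).ennreal_ofReal.aemeasurable]
    refine lintegral_congr_ae ?_
    filter_upwards [htr] with ω hω
    rw [hω, harr]
  · have h4 := ae_of_ae_map hY.aemeasurable (by rw [hY.map_eq]; exact h3)
    filter_upwards [h4, htr] with ω hω hz
    have := hω (A₀ j ω) (hA₀ j ω)
    rw [hz, harr] at this
    exact this
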